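/- Work in $\mathrm{ZFC}$. Let $H(\kappa)$ be the set of all sets whose transitive closure has cardinality $<\kappa$, and fix a well-ordering $\unlhd$ of $H(\aleph_2)$. An elementary submodel of $H(\aleph_2)$ means a set $M$ with $M\prec(H(\aleph_2),\in,\unlhd)$. Such an $M$ of size $\aleph_1$ is internally approachable if $M=\bigcup_{\xi<\omega_1}P_\xi$ for some increasing continuous $\in$-chain $\langle P_\xi:\xi<\omega_1\rangle$ of countable elementary submodels of $H(\aleph_2)$ with $\langle P_\xi:\xi<\eta\rangle\in P_{\eta+1}$ for all $\eta<\omega_1$. Let $\mathcal E^2$ be the collection consisting of all countable elementary submodels of $H(\aleph_2)$ and all internally approachable elementary submodels of $H(\aleph_2)$ of size $\aleph_1$. Let $\mathbb M$ be the set of all finite sets $p=\{M_0,\dots,M_{n-1}\}\subseteq\mathcal E^2$ with $M_0\in M_1\in\dots\in M_{n-1}$ ($n\ge 0$) such that $M\cap N\in p$ for all $M,N\in p$, ordered by reverse inclusion ($q\le p$ iff $p\subseteq q$). For a notion of forcing $\mathcal P$, a set $M$ is adequate for $\mathcal P$ if any two elements of $\mathcal P\cap M$ that are compatible in $\mathcal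 P$ have a common extension in $\mathcal P\cap M$. If $M$ is adequate, a condition $q$ is $(M,\mathcal P)$-strongly generic if $q$ forces that $\dot G\cap M$ is a $V$-generic filter on $\mathcal P\cap M$. For a collection $\mathcal S$ of sets, $\mathcal P$ is $\mathcal S$-strongly proper if every $M\in\mathcal S$ is adequate for $\mathcal P$ and every $p\in\mathcal P\cap M$ can be extended to an $(M,\mathcal P)$-strongly generic condition. $\mathcal P$ is proper if for every uncountable regular $\theta>2^{|\mathcal P|}$ and every countable $M\prec(H(\theta),\in)$ with $\mathcal P\in M$, every $p\in\mathcal P\cap M$ has an extension $q$ which, for each dense $D\subseteq\mathcal P$ with $D\in M$, forces $\dot G\cap D\cap M\neq\emptyset$. Theorem. $\mathbb M$ is $\mathcal E^2$-strongly proper. Moreover, $\mathbb M$ is proper and preserves $\omega_2$, i.e. every condition forces that the ordinal $\omega_2$ of $V$ is a cardinal. -/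

import Mathlib

open Cardinal Ordinal FirstOrder

universe u v

namespace SideConditions

/-! ## The sets `H(κ)` and elementary submodels

The set-theoretic universe `V` is `ZFSet.{u}`. -/

/-- The set of elements of the transitive closure of `x`, i.e. all `y` with `y ∈ ⋯ ∈ x`. -/
def trcl (x : ZFSet.{u}) : Set ZFSet.{u} := {y | Relation.TransGen (· ∈ ·) y x}

open ZFSet in
/-- `H(κ)`, the set of all sets whose transitive closure has cardinality less than `κ`.
(Such sets have rank less than `κ`, so separating from `V_κ` loses nothing: see `mem_H`.) -/
noncomputable def H (κ : Cardinal.{u}) : ZFSet.{u} :=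
  ZFSet.sep (fun x => #(trcl x) < Cardinal.lift.{u + 1} κ) (V_ κ.ord)

theorem Iio_rank_subset (x : ZFSet.{u}) : Set.Iio x.rank ⊆ ZFSet.rank '' trcl x := by
  induction x using ZFSet.inductionOn with
  | _ x ih =>
    intro o ho
    obtain ⟨y, hy, hoy⟩ := ZFSet.lt_rank_iff.1 (Set.mem_Iio.1 ho)
    rcases hoy.eq_or_lt with rfl | hlt
    · exact ⟨y, Relation.TransGen.single hy, rfl⟩
    · obtain ⟨z, hz, rfl⟩ := ih y hy hlt
      exact ⟨z, Relation.TransGen.tail hz hy, rfl⟩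

theorem mem_H {κ : Cardinal.{u}} {x : ZFSet.{u}} : x ∈ H κ ↔ #(trcl x) < Cardinal.lift.{u + 1} κ := by
  rw [H, ZFSet.mem_sep, ZFSet.mem_vonNeumann, and_iff_right_iff_imp]
  intro h
  rw [lt_ord, ← Cardinal.lift_lt.{u, u + 1}]
  refine lt_of_le_of_lt ?_ h
  rw [← Cardinal.mk_Iio_ordinal]
  exact (mk_le_mk_of_subset (Iio_rank_subset x)).trans mk_image_le

/-- Relation symbols of the language with `n` binary relation symbols. -/
inductive BinRel (n : ℕ) : ℕ → Type
  | sym : Fin n → BinRel n 2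

/-- The first-order language with `n` binary relation symbols and nothing else. -/
def binLang (n : ℕ) : FirstOrder.Language.{0, 0} := ⟨fun _ => Empty, BinRel n⟩

/-- The first-order structure `(A, R 0, …, R (n - 1))`. -/
@[reducible] def binStructure {A : Type v} {n : ℕ} (R : Fin n → A → A → Prop) : (binLang n).Structure A where
  funMap f := nomatch f
  RelMap := fun
    | .sym i, a => R i (a 0) (a 1)

/-- `M` is (the underlying set of) an elementary submodel of the structure
`(X, R 0, …, R (n - 1))`. -/
def IsElementarySubmodel (X : ZFSet.{u}) {n : ℕ} (R : Fin n → X → X → Prop) (M : ZFSet.{u}) :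
    Prop :=
  letI := binStructure R
  M ⊆ X ∧ ∃ S : (binLang n).ElementarySubstructure X, ∀ x : X, x ∈ S ↔ (x : ZFSet.{u}) ∈ M

/-- The membership relation on a set. -/
def memRel (X : ZFSet.{u}) (x y : X) : Prop := (x : ZFSet.{u}) ∈ (y : ZFSet.{u})

/-! ## The models and the poset of pure side conditions

Throughout, `r` is the (strict) well-ordering of `H(ℵ₂)` which is part of the structure. -/

section Models

variable (r : H.{u} (ℵ_ 2) → H.{u} (ℵ_ 2) → Prop)

/-- `M` is an elementary submodel of `(H(ℵ₂), ∈, r)`. -/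
def IsModel (M : ZFSet.{u}) : Prop :=
  IsElementarySubmodel (H (ℵ_ 2)) ![memRel (H (ℵ_ 2)), r] M

/-- The countable elementary submodels of `H(ℵ₂)`. -/
def E0 : Set ZFSet.{u} := {M | IsModel r M ∧ M.card ≤ ℵ₀}

/-- The sequence `⟨P ξ : ξ < η⟩` as a set of ordered pairs. -/
noncomputable def seqBelow (P : Ordinal.{u} → ZFSet.{u}) (η : Ordinal.{u}) : ZFSet.{u} :=
  ZFSet.range fun ξ : Set.Iio η => ZFSet.pair (ξ : Ordinal.{u}).toZFSet (P ξ)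

/-- `⟨P ξ : ξ < ω₁⟩` is an increasing continuous `∈`-chain of countable elementary submodels of
`H(ℵ₂)` with `⟨P ξ : ξ < η⟩ ∈ P (η + 1)` for all `η < ω₁`. (Values at `ξ ≥ ω₁` are irrelevant.) -/
structure IsApproachingChain (P : Ordinal.{u} → ZFSet.{u}) : Prop where
  mem_E0 : ∀ ξ < ω₁, P ξ ∈ E0 r
  subset : ∀ ξ η, ξ < η → η < ω₁ → P ξ ⊆ P η
  mem : ∀ ξ η, ξ < η → η < ω₁ → P ξ ∈ P η
  continuous : ∀ η < ω₁, Order.IsSuccLimit η → ∀ x, x ∈ P η ↔ ∃ ξ < η, x ∈ P ξ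
  seq_mem : ∀ η < ω₁, seqBelow P η ∈ P (η + 1)

/-- `M` is internally approachable: the union of a chain as above. -/
def IsInternallyApproachable (M : ZFSet.{u}) : Prop :=
  ∃ P : Ordinal.{u} → ZFSet.{u}, IsApproachingChain r P ∧ ∀ x, x ∈ M ↔ ∃ ξ < ω₁, x ∈ P ξ

/-- The internally approachable elementary submodels of `H(ℵ₂)` of size `ℵ₁`. -/
def E1 : Set ZFSet.{u} := {M | IsModel r M ∧ M.card = ℵ₁ ∧ IsInternallyApproachable r M}

/-- The collection `𝓔²` of all models allowed in side conditions. -/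
def E2 : Set ZFSet.{u} := E0 r ∪ E1 r

/-- `p` is a finite `∈`-chain `M₀ ∈ M₁ ∈ ⋯ ∈ Mₙ₋₁` (possibly empty): each model is an element of
the next one. -/
def IsFiniteMemChain (p : ZFSet.{u}) : Prop :=
  ∃ l : List ZFSet.{u}, l.IsChain (· ∈ ·) ∧ ∀ x, x ∈ p ↔ x ∈ l

/-- `p` is a pure side condition: a finite `∈`-chain of models in `𝓔²`, closed under
intersection. -/
structure IsSideCondition (p : ZFSet.{u}) : Prop where
  models : ∀ M ∈ p, M ∈ E2 r
  chain : IsFiniteMemChain p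
  inter : ∀ M ∈ p, ∀ N ∈ p, M ∩ N ∈ p

end Models

/-! ## Notions of forcing and the forcing relation -/

/-- A notion of forcing: a preordered set with a largest element. `le q p` means that `q` is
stronger than `p`. -/
structure ForcingNotion where
  carrier : ZFSet.{u}
  le : ZFSet.{u} → ZFSet.{u} → Prop
  refl : ∀ p ∈ carrier, le p p
  trans : ∀ p ∈ carrier, ∀ q ∈ carrier, ∀ s ∈ carrier, le p q → le q s → le p s
  one : ZFSet.{u}
  one_mem : one ∈ carrier
  le_one : ∀ p ∈ carrier, le p one

namespace ForcingNotion

/-- The type of conditions. -/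
def Cond (P : ForcingNotion.{u}) : Type (u + 1) := {p : ZFSet.{u} // p ∈ P.carrier}

/-- The condition, as a set. -/
def Cond.val {P : ForcingNotion.{u}} (p : P.Cond) : ZFSet.{u} := Subtype.val p

theorem Cond.property {P : ForcingNotion.{u}} (p : P.Cond) : p.val ∈ P.carrier := Subtype.property p

instance (P : ForcingNotion.{u}) : Preorder P.Cond where
  le q p := P.le q.val p.val
  le_refl p := P.refl _ p.property
  le_trans p q s := P.trans _ p.property _ q.property _ s.property

instance (P : ForcingNotion.{u}) : OrderTop P.Cond where
  top := ⟨P.one, P.one_mem⟩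
  le_top p := P.le_one _ p.property

instance (P : ForcingNotion.{u}) : Small.{u} P.Cond :=
  inferInstanceAs (Small.{u} {p : ZFSet.{u} // p ∈ P.carrier})

/-- The ordered pair `(P, ≤)` as a set. -/
noncomputable def code (P : ForcingNotion.{u}) : ZFSet.{u} :=
  ZFSet.pair P.carrier
    (ZFSet.sep (fun z => ∃ q p, z = ZFSet.pair q p ∧ P.le q p) (ZFSet.prod P.carrier P.carrier))

end ForcingNotion

/-- `ℙ`-names: (set-indexed) families of pairs consisting of a `ℙ`-name and a condition. -/
inductive PName (ℙ : Type v) : Type (max v (u + 1))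
  | mk (ι : Type u) (nm : ι → PName ℙ) (cond : ι → ℙ) : PName ℙ

section Forcing

variable {ℙ : Type v} [Preorder ℙ]

/-- A statement of the forcing language, given by the conditions that force it. -/
abbrev Stmt (ℙ : Type v) : Type v := ℙ → Prop

/-- `forcesEq a b p` means `p ⊩ a = b`: whenever `(c, s) ∈ a` and `q ≤ p, s`, the set of conditions
`t` such that `t ≤ s'` and `t ⊩ c = d` for some `(d, s') ∈ b` is dense below `q`; and symmetrically. -/
def forcesEq : PName.{u} ℙ → PName.{u} ℙ → Stmt ℙ
  | .mk _ a s, .mk _ b s' => fun p =>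
    (∀ i, ∀ q ≤ p, q ≤ s i → ∃ t ≤ q, ∃ j, t ≤ s' j ∧ forcesEq (a i) (b j) t) ∧
    (∀ j, ∀ q ≤ p, q ≤ s' j → ∃ t ≤ q, ∃ i, t ≤ s i ∧ forcesEq (a i) (b j) t)

/-- `forcesMem a b p` means `p ⊩ a ∈ b`: the set of conditions `t` such that `t ≤ s` and
`t ⊩ a = c` for some `(c, s) ∈ b` is dense below `p`. -/
def forcesMem (a : PName.{u} ℙ) : PName.{u} ℙ → Stmt ℙ
  | .mk _ b s => fun p => ∀ q ≤ p, ∃ t ≤ q, ∃ i, t ≤ s i ∧ forcesEq a (b i) t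

/-- `p ⊩ ¬ φ` iff no extension of `p` forces `φ`. -/
def fNot (φ : Stmt ℙ) : Stmt ℙ := fun p => ∀ q ≤ p, ¬ φ q

/-- `p ⊩ φ ∧ ψ` iff `p ⊩ φ` and `p ⊩ ψ`. -/
def fAnd (φ ψ : Stmt ℙ) : Stmt ℙ := fun p => φ p ∧ ψ p

/-- `p ⊩ ∀ x, φ x` iff `p ⊩ φ a` for all names `a`. -/
def fAll (φ : PName.{u} ℙ → Stmt ℙ) : Stmt ℙ := fun p => ∀ a, φ a p

def fOr (φ ψ : Stmt ℙ) : Stmt ℙ := fNot (fAnd (fNot φ) (fNot ψ))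

def fImp (φ ψ : Stmt ℙ) : Stmt ℙ := fNot (fAnd φ (fNot ψ))

def fIff (φ ψ : Stmt ℙ) : Stmt ℙ := fAnd (fImp φ ψ) (fImp ψ φ)

def fEx (φ : PName.{u} ℙ → Stmt ℙ) : Stmt ℙ := fNot (fAll fun x => fNot (φ x))

/-- `∀ x ∈ a, φ x`. -/
def fAllIn (a : PName.{u} ℙ) (φ : PName.{u} ℙ → Stmt ℙ) : Stmt ℙ :=
  fAll fun x => fImp (forcesMem x a) (φ x)

/-- `∃ x ∈ a, φ x`. -/
def fExIn (a : PName.{u} ℙ) (φ : PName.{u} ℙ → Stmt ℙ) : Stmt ℙ :=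
  fEx fun x => fAnd (forcesMem x a) (φ x)

/-- `z = {x, y}`. -/
def fIsUPair (z x y : PName.{u} ℙ) : Stmt ℙ :=
  fAll fun w => fIff (forcesMem w z) (fOr (forcesEq w x) (forcesEq w y))

/-- `z = (x, y) = {{x}, {x, y}}`. -/
def fIsPair (z x y : PName.{u} ℙ) : Stmt ℙ :=
  fEx fun a => fEx fun b => fAnd (fIsUPair a x x) (fAnd (fIsUPair b x y) (fIsUPair z a b))

/-- `(x, y) ∈ f`. -/
def fPairMem (x y f : PName.{u} ℙ) : Stmt ℙ := fExIn f fun z => fIsPair z x y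

/-- `f` is a function from `a` onto `b`. -/
def fIsSurjection (f a b : PName.{u} ℙ) : Stmt ℙ :=
  fAnd (fAllIn f fun z => fExIn a fun x => fExIn b fun y => fIsPair z x y) <|
  fAnd (fAllIn a fun x => fExIn b fun y => fPairMem x y f) <|
  fAnd (fAll fun x => fAll fun y => fAll fun y' =>
    fImp (fAnd (fPairMem x y f) (fPairMem x y' f)) (forcesEq y y')) <|
  fAllIn b fun y => fExIn a fun x => fPairMem x y f

/-- `a` is a transitive set. -/
def fIsTransitive (a : PName.{u} ℙ) : Stmt ℙ :=
  fAllIn a fun x => fAllIn x fun y => forcesMem y a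

/-- `a` is a cardinal: an ordinal (a transitive set of transitive sets) that is not the image of
any of its elements. -/
def fIsCardinal (a : PName.{u} ℙ) : Stmt ℙ :=
  fAnd (fAnd (fIsTransitive a) (fAllIn a fIsTransitive)) <|
  fAllIn a fun x => fNot (fEx fun f => fIsSurjection f x a)

/-- The canonical name `x̌` of a set `x` of the ground model. -/
noncomputable def check [OrderTop ℙ] (x : ZFSet.{u}) : PName.{u} ℙ :=
  .mk (Shrink.{u} x) (fun i => check ((equivShrink x).symm i : ZFSet.{u})) fun _ => ⊤
termination_by x
decreasing_by exact ((equivShrink x).symm i).2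

end Forcing

namespace ForcingNotion

variable (P : ForcingNotion.{u})

/-- The canonical name `Ġ` of the generic filter. -/
noncomputable def gdot : PName.{u} P.Cond :=
  .mk (Shrink.{u} P.Cond) (fun i => check ((equivShrink P.Cond).symm i).val)
    fun i => (equivShrink P.Cond).symm i

/-- The statement `Ď ∩ Ġ ≠ ∅`, for a set `D` of the ground model. -/
noncomputable def fMeets (D : ZFSet.{u}) : Stmt P.Cond :=
  fExIn (check D) fun x => forcesMem x P.gdot

/-- `D` is a dense subset of the suborder `Q ⊆ P`. -/
def IsDenseIn (Q D : ZFSet.{u}) : Prop := D ⊆ Q ∧ ∀ p ∈ Q, ∃ d ∈ D, P.le d p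

/-- `M` is adequate for `P`: compatible elements of `P ∩ M` have a common extension in `P ∩ M`. -/
def IsAdequate (M : ZFSet.{u}) : Prop :=
  ∀ p ∈ P.carrier ∩ M, ∀ q ∈ P.carrier ∩ M,
    (∃ s ∈ P.carrier, P.le s p ∧ P.le s q) → ∃ s ∈ P.carrier ∩ M, P.le s p ∧ P.le s q

/-- `p` is `(M, P)`-strongly generic: `p` forces that `Ġ ∩ M` is a `V`-generic filter on `P ∩ M`,
i.e. that it is upward closed in `P ∩ M`, that any two of its elements have a common extension in
it, and that it meets every dense subset of `P ∩ M` lying in `V`. (Universal quantifiers over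
elements and subsets of `P ∩ M` in `V` are written outside of the forcing statement.) -/
structure IsStronglyGeneric (M : ZFSet.{u}) (p : P.Cond) : Prop where
  upward : ∀ a ∈ P.carrier ∩ M, ∀ b ∈ P.carrier ∩ M, P.le a b →
    fImp (forcesMem (check a) P.gdot) (forcesMem (check b) P.gdot) p
  directed : ∀ a ∈ P.carrier ∩ M, ∀ b ∈ P.carrier ∩ M,
    fImp (fAnd (forcesMem (check a) P.gdot) (forcesMem (check b) P.gdot))
      (P.fMeets (ZFSet.sep (fun c => P.le c a ∧ P.le c b) (P.carrier ∩ M))) p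
  generic : ∀ D, P.IsDenseIn (P.carrier ∩ M) D → P.fMeets D p

/-- `P` is `𝓢`-strongly proper: all elements of `𝓢` are adequate for `P`, and for each `M ∈ 𝓢`,
every condition in `M` can be extended to an `(M, P)`-strongly generic condition. -/
def IsStronglyProper (𝓢 : Set ZFSet.{u}) : Prop :=
  ∀ M ∈ 𝓢, P.IsAdequate M ∧
    ∀ p : P.Cond, p.val ∈ M → ∃ q ≤ p, P.IsStronglyGeneric M q

/-- `p` is `(M, P)`-generic: for every dense `D ⊆ P` with `D ∈ M`, `p` forces that `Ġ` meets
`D ∩ M`. -/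
def IsGeneric (M : ZFSet.{u}) (p : P.Cond) : Prop :=
  ∀ D ∈ M, P.IsDenseIn P.carrier D → P.fMeets (D ∩ M) p

/-- `P` is proper: for every uncountable regular `θ > 2 ^ |P|` and every countable elementary
submodel `M` of `(H(θ), ∈)` with `P ∈ M`, every condition in `M` can be extended to an
`(M, P)`-generic condition. -/
def IsProper : Prop :=
  ∀ θ : Cardinal.{u}, θ.IsRegular → ℵ₀ < θ → 2 ^ P.carrier.card < θ →
    ∀ M : ZFSet.{u}, IsElementarySubmodel (H θ) ![memRel (H θ)] M → M.card ≤ ℵ₀ → P.code ∈ M →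
      ∀ p : P.Cond, p.val ∈ M → ∃ q ≤ p, P.IsGeneric M q

/-- `P` preserves the cardinal `ω_ o`: every condition forces that the ordinal `ω_ o` of the ground
model is a cardinal. -/
def PreservesOmega (o : Ordinal.{u}) : Prop :=
  ∀ p : P.Cond, fIsCardinal (check (ω_ o).toZFSet) p

end ForcingNotion

/-- The poset `𝕄` of pure side conditions, ordered by reverse inclusion. -/
noncomputable def sidePoset (r : H.{u} (ℵ_ 2) → H.{u} (ℵ_ 2) → Prop) : ForcingNotion.{u} where
  carrier := ZFSet.sep (IsSideCondition r) (ZFSet.powerset (ZFSet.powerset (H (ℵ_ 2))))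
  le q p := p ⊆ q
  refl _ _ := fun _ h => h
  trans _ _ _ _ _ _ h₁ h₂ := fun _ h => h₁ (h₂ h)
  one := ∅
  one_mem := by
    refine ZFSet.mem_sep.2 ⟨ZFSet.mem_powerset.2 (ZFSet.empty_subset _), ?_, ⟨[], ?_, ?_⟩, ?_⟩ <;>
      simp
  le_one p _ := ZFSet.empty_subset p

theorem mem_sidePoset (r : H.{u} (ℵ_ 2) → H.{u} (ℵ_ 2) → Prop) (p : ZFSet.{u}) :
    p ∈ (sidePoset r).carrier ↔ IsSideCondition r p := by
  refine ZFSet.mem_sep.trans (and_iff_right_of_imp fun h => ?_)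
  refine ZFSet.mem_powerset.2 fun M hM => ZFSet.mem_powerset.2 ?_
  rcases h.models M hM with h | h
  · exact h.1.1
  · exact h.1.1

end SideConditions

/-! The heart of the matter is amalgamation (`IsSideCondition.exists_common_extension`): a side
condition `p` with `M ∈ p` is compatible with every side condition `q ⊆ M` that extends `p ∩ M`.
Since `p ∩ M` is a side condition and, being a finite subset of `M`, an element of `M`, the map `p ↦
p ∩ M` is a reduction of `p` to the suborder of conditions in `M`. Hence every condition having `M`
as a member is strongly generic for `M`, and a condition lying in `M` acquires `M` as a member by
amalgamation with `{M}`. Adequacy follows by intersecting a common extension with `M`.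

Amalgamation rests on two facts about an uncountable `U` in `𝓔²`: `U` is a transitive set
(`subset_of_mem_E1`), and `U ∩ C ∈ U` whenever `U ∈ C` with `C` countable (`inter_mem_of_mem_E1`).
So an uncountable member of a side condition contains all earlier members, while the earlier members
missing from a countable member `C` fill intervals `[N ∩ C, N)` with `N ∈ C` uncountable
(`exists_interval`). If `M` is uncountable, `p ∪ q` is already a common extension. If `M` is
countable, intersections `A ∩ K` with `A ∈ q` uncountable and `K ∈ p` countable must be added; they
are inserted below `A` and above all members of `q` in `A`.

For properness, a countable `M ≺ H(θ)` containing the poset has trace `M ∩ H(ℵ₂)` in `E0`, because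
the trace is a directed union of countable models belonging to `M`; strong genericity for the trace
is applied to the dense set `D ∩ M`.

For `ω₂`, suppose `t` forces `f` to map some `B < ω₂` onto `ω₂`. Take `U` in `E1` containing `t` and
`B` and closed under functions that choose, for a condition below `t` and `z ∈ B`, an extension
deciding `f(z)` and the decided value (`exists_mem_E1`). Some `y < ω₂` is outside `U`, and some `s'
≤ t` with `U ∈ s'` forces `f(z) = y`. But `s' ∩ U` has an extension in `U` giving `f(z)` a value in
`U`, and this extension is compatible with `s'`. -/

namespace SideConditions

/-! ## Definability with parameters -/

section Definability

variable {A : Type v} {n : ℕ} {R : Fin n → A → A → Prop} {S : Set A}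

/-- The predicate `P`, in variables indexed by `ℕ`, is definable in `(A, R 0, …, R (n - 1))` with
parameters from `S`. -/
def Dfn (R : Fin n → A → A → Prop) (S : Set A) (P : (ℕ → A) → Prop) : Prop :=
  letI := binStructure R
  S.Definable (binLang n) {v | P v}

/-- A term: a variable or a parameter. -/
inductive Tm (S : Set A) : ((ℕ → A) → A) → Prop
  | var (i : ℕ) : Tm S fun v => v i
  | param (a : A) : a ∈ S → Tm S fun _ => a

theorem Tm.shift {t : (ℕ → A) → A} (h : Tm S t) : Tm S fun v => t fun i => v (i + 1) := by
  cases h with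
  | var i => exact Tm.var (i + 1)
  | param a h => exact Tm.param a h

namespace Dfn

theorem mono {P : (ℕ → A) → Prop} {T : Set A} (hST : S ⊆ T) (hP : Dfn R S P) : Dfn R T P :=
  let := binStructure R
  Set.Definable.mono hP hST

theorem and {P Q : (ℕ → A) → Prop} (hP : Dfn R S P) (hQ : Dfn R S Q) :
    Dfn R S fun v => P v ∧ Q v :=
  let := binStructure R
  Set.Definable.inter hP hQ

theorem or {P Q : (ℕ → A) → Prop} (hP : Dfn R S P) (hQ : Dfn R S Q) :
    Dfn R S fun v => P v ∨ Q v :=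
  let := binStructure R
  Set.Definable.union hP hQ

theorem not {P : (ℕ → A) → Prop} (hP : Dfn R S P) : Dfn R S fun v => ¬ P v :=
  let := binStructure R
  Set.Definable.compl hP

theorem imp {P Q : (ℕ → A) → Prop} (hP : Dfn R S P) (hQ : Dfn R S Q) :
    Dfn R S fun v => P v → Q v := by
  simpa only [imp_iff_not_or] using hP.not.or hQ

theorem iff {P Q : (ℕ → A) → Prop} (hP : Dfn R S P) (hQ : Dfn R S Q) :
    Dfn R S fun v => P v ↔ Q v := by
  simpa only [iff_iff_implies_and_implies] using (hP.imp hQ).and (hQ.imp hP)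

/-- The bound variable gets index `0` and the free variables move up by one, as with de Bruijn
indices; `Tm.shift` makes the corresponding change in terms. -/
theorem ex {P : (ℕ → A) → A → Prop} (hP : Dfn R S fun v => P (fun i => v (i + 1)) (v 0)) :
    Dfn R S fun v => ∃ x, P v x := by
  let := binStructure R
  have h := (Set.Definable.preimage_comp
    (fun i : ℕ => Nat.casesOn (motive := fun _ => ℕ ⊕ Fin 1) i (Sum.inr 0) Sum.inl)
    hP).exists_of_finite
  refine (congr_arg _ (Set.ext fun v => ?_)).mp h
  change (∃ w : Fin 1 → A, P v (w 0)) ↔ ∃ x, P v x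
  exact ⟨fun ⟨w, hw⟩ => ⟨w 0, hw⟩, fun ⟨x, hx⟩ => ⟨fun _ => x, hx⟩⟩

theorem all {P : (ℕ → A) → A → Prop} (hP : Dfn R S fun v => P (fun i => v (i + 1)) (v 0)) :
    Dfn R S fun v => ∀ x, P v x := by
  simpa only [not_exists, not_not] using (ex (P := fun v x => ¬ P v x) hP.not).not

theorem rel (i : Fin n) {s t : (ℕ → A) → A} (hs : Tm S s) (ht : Tm S t) :
    Dfn R S fun v => R i (s v) (t v) := by
  let := binStructure R
  have key : ∀ {s}, Tm S s → ∃ τ : (binLang n)[[S]].Term ℕ, ∀ v, τ.realize v = s v := by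
    rintro s (i | ⟨a, ha⟩)
    · exact ⟨.var i, fun v => rfl⟩
    · exact ⟨((binLang n).con (⟨a, ha⟩ : S)).term, fun v => by simp⟩
  obtain ⟨σ, hσ⟩ := key hs
  obtain ⟨τ, hτ⟩ := key ht
  let r : (binLang n)[[S]].Relations 2 := Sum.inl (BinRel.sym i)
  refine ⟨r.formula₂ σ τ, Set.ext fun v => ?_⟩
  change R i (s v) (t v) ↔ (r.formula₂ σ τ).Realize v
  rw [Language.Formula.realize_rel₂, hσ, hτ]
  rfl

theorem exists_finset {P : (ℕ → A) → Prop} (hP : Dfn R S P) :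
    ∃ T : Finset A, (T : Set A) ⊆ S ∧ Dfn R T P :=
  let := binStructure R
  Set.definable_iff_finitely_definable.1 hP

end Dfn

theorem dfn_definable₁ {D : Set A} :
    (letI := binStructure R; S.Definable₁ (binLang n) D) ↔ Dfn R S fun v => v 0 ∈ D := by
  let := binStructure R
  exact ⟨fun h => Set.Definable.preimage_comp (fun _ : Fin 1 => (0 : ℕ)) h,
    fun h => Set.Definable.preimage_comp (fun _ : ℕ => (0 : Fin 1)) h⟩

/-- A formula and a list of parameters defining a given set. -/
theorem Dfn.exists_formula {Q : A → Prop} (h : Dfn R S fun v => Q (v 0)) (d : A) :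
    letI := binStructure R
    ∃ (φ : (binLang n).Formula ℕ) (l : List A), (∀ a ∈ l, a ∈ S) ∧
      ∀ x, φ.Realize (fun i => (x :: l).getD i d) ↔ Q x := by
  classical
  let := binStructure R
  obtain ⟨T, hTS, hT⟩ := h.exists_finset
  have hT' : (T : Set A).Definable₁ (binLang n) {x | Q x} := dfn_definable₁.2 hT
  obtain ⟨φ, hφ⟩ := Set.definable_iff_exists_formula_sum.1 hT'
  -- In the list `x :: l` the free variable sits at position `0`, so each parameter is read at its
  -- index in `T.toList` plus one.
  refine ⟨φ.relabel (Sum.elim (fun a : (T : Set A) => T.toList.idxOf (a : A) + 1) fun _ => 0), T.toList,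
    fun a ha => hTS (by simpa using ha), fun x => ?_⟩
  rw [Language.Formula.realize_relabel]
  have := Set.ext_iff.1 hφ fun _ => x
  refine Iff.trans (iff_of_eq (congr_arg _ ?_)) this.symm
  funext i
  rcases i with a | i
  · have : (a : A) ∈ T.toList := by simp
    simp [List.getElem?_idxOf this]
  · simp

end Definability

/-! ### Elementary submodels through definable predicates -/

section Elementary

variable {X M : ZFSet.{u}} {n : ℕ} {R : Fin n → X → X → Prop}

/-- The part of `X` lying in `M`. -/
def inside (X M : ZFSet.{u}) : Set X := {x | (x : ZFSet.{u}) ∈ M}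

/-- This is the Tarski–Vaught test, with formulas replaced by predicates definable from parameters
in the submodel. -/
theorem isElementarySubmodel_iff :
    IsElementarySubmodel X R M ↔ M ⊆ X ∧ ∀ Q : X → Prop, Dfn R (inside X M) (fun v => Q (v 0)) →
      (∃ x, Q x) → ∃ x : X, (x : ZFSet.{u}) ∈ M ∧ Q x := by
  let := binStructure R
  refine and_congr_right fun hM => ⟨?_, fun h => ?_⟩
  · rintro ⟨S, hS⟩ Q hQ ⟨x, hx⟩
    have : (S : Set X) = inside X M := Set.ext hS
    obtain ⟨y, hy, hyS⟩ := S.meetsDefinable {x | Q x} ⟨x, hx⟩ (by rw [this]; exact dfn_definable₁.2 hQ)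
    exact ⟨y, (hS y).1 hyS, hy⟩
  · have hA : (binLang n).MeetsDefinable (inside X M) := by
      rintro D ⟨x, hx⟩ hD
      obtain ⟨y, hy, hyD⟩ := h (· ∈ D) (dfn_definable₁.1 hD) ⟨x, hx⟩
      exact ⟨y, hyD, hy⟩
    refine ⟨hA.toElementarySubstructure, fun x => ?_⟩
    change x ∈ Language.Substructure.closure (binLang n) (inside X M) ↔ x ∈ inside X M
    rw [← SetLike.mem_coe, hA.closure_eq_self]

theorem IsElementarySubmodel.subset (hM : IsElementarySubmodel X R M) : M ⊆ X := hM.1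

theorem IsElementarySubmodel.exists_mem (hM : IsElementarySubmodel X R M) {Q : X → Prop}
    (hQ : Dfn R (inside X M) fun v => Q (v 0)) (h : ∃ x, Q x) : ∃ x : X, (x : ZFSet.{u}) ∈ M ∧ Q x :=
  (isElementarySubmodel_iff.1 hM).2 Q hQ h

/-- An element which is the only one with a definable property belongs to the submodel. -/
theorem IsElementarySubmodel.mem_of_unique (hM : IsElementarySubmodel X R M) {Q : X → Prop}
    (hQ : Dfn R (inside X M) fun v => Q (v 0)) {a : X} (ha : Q a) (h : ∀ b, Q b → b = a) :
    (a : ZFSet.{u}) ∈ M := by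
  obtain ⟨b, hb, hQb⟩ := hM.exists_mem hQ ⟨a, ha⟩
  exact h b hQb ▸ hb

/-- The intersection of two elementary submodels of a well-ordered structure is elementary. -/
theorem IsElementarySubmodel.inter {N : ZFSet.{u}} (i : Fin n) [IsWellOrder X (R i)]
    (hM : IsElementarySubmodel X R M) (hN : IsElementarySubmodel X R N) :
    IsElementarySubmodel X R (M ∩ N) := by
  refine isElementarySubmodel_iff.2 ⟨fun x hx => hM.subset (ZFSet.mem_inter.1 hx).1, ?_⟩
  rintro Q hQ ⟨x, hx⟩
  -- The `R i`-least witness is definable from the same parameters as `Q`, which lie in both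
  -- submodels, so it belongs to both.
  obtain ⟨a, ha, hmin⟩ := (IsWellFounded.wf (r := R i)).has_min {x | Q x} ⟨x, hx⟩
  have hQ' : ∀ K, M ∩ N ⊆ K → Dfn R (inside X K) fun v => Q (v 0) :=
    fun K hK => hQ.mono fun x hx => hK hx
  have key : ∀ K, IsElementarySubmodel X R K → M ∩ N ⊆ K → (a : ZFSet.{u}) ∈ K := by
    intro K hK h
    refine hK.mem_of_unique (Q := fun x => Q x ∧ ∀ y, Q y → ¬ R i y x) ?_ ⟨ha, hmin⟩ ?_
    · refine (hQ' K h).and (Dfn.all (Dfn.imp (hQ' K h) (Dfn.rel i (Tm.var 0) (Tm.var 1)).not))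
    · rintro b ⟨hb, hb'⟩
      by_contra hne
      rcases trichotomous_of (R i) b a with h | h | h
      · exact hmin b hb h
      · exact hne h
      · exact hb' a ha h
  exact ⟨a, ZFSet.mem_inter.2 ⟨key M hM fun x hx => (ZFSet.mem_inter.1 hx).1,
    key N hN fun x hx => (ZFSet.mem_inter.1 hx).2⟩, ha⟩

/-- The union of a directed system of elementary submodels is elementary. -/
theorem isElementarySubmodel_of_directed {𝓒 : Set ZFSet.{u}} (h𝓒 : ∀ C ∈ 𝓒, IsElementarySubmodel X R C)
    (hne : 𝓒.Nonempty) (hdir : ∀ C ∈ 𝓒, ∀ D ∈ 𝓒, ∃ E ∈ 𝓒, C ⊆ E ∧ D ⊆ E)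
    (hM : ∀ x, x ∈ M ↔ ∃ C ∈ 𝓒, x ∈ C) : IsElementarySubmodel X R M := by
  classical
  refine isElementarySubmodel_iff.2 ⟨fun x hx => ?_, fun Q hQ h => ?_⟩
  · obtain ⟨C, hC, hxC⟩ := (hM x).1 hx
    exact (h𝓒 C hC).subset hxC
  -- A definition uses only finitely many parameters, and by directedness these lie in a single
  -- member of the system.
  · obtain ⟨T, hT, hQT⟩ := hQ.exists_finset
    have : ∃ C ∈ 𝓒, ∀ x ∈ T, (x : ZFSet.{u}) ∈ C := by
      clear hQT
      induction T using Finset.induction_on with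
      | empty => exact ⟨_, hne.some_mem, by simp⟩
      | insert a T _ ih =>
        obtain ⟨C, hC, hTC⟩ := ih fun x hx => hT (by simp at hx ⊢; exact Or.inr hx)
        obtain ⟨D, hD, haD⟩ := (hM a).1 (hT (by simp : a ∈ ((insert a T : Finset _) : Set _)))
        obtain ⟨E, hE, hCE, hDE⟩ := hdir C hC D hD
        refine ⟨E, hE, fun x hx => ?_⟩
        rcases Finset.mem_insert.1 hx with rfl | hx
        · exact hDE haD
        · exact hCE (hTC x hx)
    obtain ⟨C, hC, hTC⟩ := this
    obtain ⟨x, hx, hQx⟩ := (h𝓒 C hC).exists_mem (hQT.mono fun x hx => hTC x hx) h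
    exact ⟨x, (hM x).2 ⟨C, hC, hx⟩, hQx⟩

end Elementary

/-! ## Hulls -/

section Hull

variable {A : Type v} {ι : Type} (G : ι → List A → A)

/-- The closure of a set under a family of finitary functions. -/
inductive FunClosure (S : Set A) : A → Prop
  | base {a} : a ∈ S → FunClosure S a
  | app (i : ι) (l : List A) : (∀ a ∈ l, FunClosure S a) → FunClosure S (G i l)

theorem countable_lists {s : Set A} (h : s.Countable) : {l : List A | ∀ a ∈ l, a ∈ s}.Countable := by
  have : Countable ↥s := h.to_subtype
  rw [← Set.range_list_map_coe]
  exact Set.countable_range _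

/-- The closure is exhausted by `ω` stages, each adding the values of countably many functions at
the finite lists from the previous stage. -/
theorem FunClosure.countable [Countable ι] {S : Set A} (hS : S.Countable) :
    {a | FunClosure G S a}.Countable := by
  let step : ℕ → Set A := fun k => k.rec S fun _ T =>
    T ∪ ⋃ i, G i '' {l | ∀ a ∈ l, a ∈ T}
  have hstep : ∀ k, step (k + 1) = step k ∪ ⋃ i, G i '' {l | ∀ a ∈ l, a ∈ step k} := fun k => rfl
  have hmono : Monotone step := monotone_nat_of_le_succ fun k => by
    rw [hstep]; exact Set.subset_union_left
  have hc : ∀ k, (step k).Countable := by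
    intro k
    induction k with
    | zero => exact hS
    | succ k ih =>
      rw [hstep]
      exact ih.union (Set.countable_iUnion fun i => (countable_lists ih).image _)
  refine (Set.countable_iUnion hc).mono fun a ha => ?_
  induction ha with
  | base h => exact Set.mem_iUnion.2 ⟨0, h⟩
  | app i l _ ih =>
    have : ∃ k, ∀ a ∈ l, a ∈ step k := by
      clear * - ih hmono
      induction l with
      | nil => exact ⟨0, by simp⟩
      | cons b l ihl =>
        obtain ⟨k, hk⟩ := ihl fun a ha => ih a (List.mem_cons_of_mem _ ha)
        obtain ⟨m, hm⟩ := Set.mem_iUnion.1 (ih b List.mem_cons_self)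
        refine ⟨max k m, fun a ha => ?_⟩
        rcases List.mem_cons.1 ha with rfl | ha
        · exact hmono (le_max_right _ _) hm
        · exact hmono (le_max_left _ _) (hk a ha)
    obtain ⟨k, hk⟩ := this
    refine Set.mem_iUnion.2 ⟨k + 1, ?_⟩
    rw [hstep]
    exact Or.inr (Set.mem_iUnion.2 ⟨i, l, hk, rfl⟩)

end Hull

/-- Skolem functions: countably many functions such that every set closed under them
is elementary. -/
theorem exists_skolem {X : ZFSet.{u}} (hX : X.Nonempty) {n : ℕ} (R : Fin n → X → X → Prop) :
    ∃ G : (binLang n).Formula ℕ → List X → X, ∀ M ⊆ X,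
      (∀ φ l, (∀ a ∈ l, a ∈ inside X M) → (G φ l : ZFSet.{u}) ∈ M) →
      IsElementarySubmodel X R M := by
  classical
  let := binStructure R
  -- `d` serves twice as a default: as the value of variables beyond the end of the parameter list,
  -- and as the Skolem value when there is no witness.
  let d : X := ⟨hX.some, hX.some_mem⟩
  refine ⟨fun φ l => if h : ∃ x, φ.Realize (fun i => (x :: l).getD i d) then h.choose else d,
    fun M hMX hM => isElementarySubmodel_iff.2 ⟨hMX, fun Q hQ h => ?_⟩⟩
  obtain ⟨φ, l, hl, hφ⟩ := hQ.exists_formula d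
  have h' : ∃ x, φ.Realize (fun i => (x :: l).getD i d) := h.imp fun x => (hφ x).2
  have := hM φ l hl
  simp only [dif_pos h'] at this
  exact ⟨_, this, (hφ _).1 h'.choose_spec⟩

instance (n : ℕ) : Countable (binLang n).Symbols := by
  have h₁ : IsEmpty (Σ k, (binLang n).Functions k) := ⟨fun x => nomatch x.2⟩
  have h₂ : Countable (Σ k, (binLang n).Relations k) := by
    refine Function.Surjective.countable (α := Fin n) (f := fun i => ⟨2, BinRel.sym i⟩) ?_
    rintro ⟨_, ⟨i⟩⟩
    exact ⟨i, rfl⟩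
  exact inferInstanceAs (Countable (_ ⊕ _))

/-! ## Closure properties of `H(κ)` -/

section HClosure

theorem countable_iff_card_le {x : ZFSet.{u}} : (x : Set ZFSet.{u}).Countable ↔ x.card ≤ ℵ₀ := by
  rw [← Cardinal.le_aleph0_iff_set_countable, ← Cardinal.lift_le_aleph0.{u, u + 1},
    ← ZFSet.cardinalMk_coe_sort]
  rfl

theorem mem_trcl_iff {x z : ZFSet.{u}} : z ∈ trcl x ↔ ∃ y ∈ x, z = y ∨ z ∈ trcl y := by
  constructor
  · intro h
    rcases Relation.TransGen.tail'_iff.1 h with ⟨y, hzy, hy⟩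
    exact ⟨y, hy, Relation.reflTransGen_iff_eq_or_transGen.1 hzy |>.imp Eq.symm id⟩
  · rintro ⟨y, hy, rfl | h⟩
    · exact Relation.TransGen.single hy
    · exact Relation.TransGen.tail h hy

variable {κ : Cardinal.{u}} {x y : ZFSet.{u}}

theorem mem_H_of_trcl_subset (hx : x ∈ H κ) (h : trcl y ⊆ trcl x) : y ∈ H κ :=
  mem_H.2 ((mk_le_mk_of_subset h).trans_lt (mem_H.1 hx))

theorem mem_H_of_mem (hx : x ∈ H κ) (h : y ∈ x) : y ∈ H κ :=
  mem_H_of_trcl_subset hx fun _ hz => mem_trcl_iff.2 ⟨y, h, Or.inr hz⟩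

theorem mem_H_of_subset (hx : x ∈ H κ) (h : y ⊆ x) : y ∈ H κ :=
  mem_H_of_trcl_subset hx fun _ hz => by
    obtain ⟨w, hw, h'⟩ := mem_trcl_iff.1 hz
    exact mem_trcl_iff.2 ⟨w, h hw, h'⟩

theorem card_lt_of_mem_H (hx : x ∈ H κ) : x.card < κ := by
  rw [← Cardinal.lift_lt.{u, u + 1}, ← ZFSet.cardinalMk_coe_sort]
  exact (mk_le_mk_of_subset (s := (x : Set ZFSet.{u})) fun y hy => Relation.TransGen.single hy).trans_lt (mem_H.1 hx)

/-- The transitive closure of `x` is a union of fewer than `κ` sets of size `< κ`, and `κ` is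
regular. -/
theorem mem_H_of_subset_H (hκ : κ.IsRegular) (hx : x ⊆ H κ) (hc : x.card < κ) : x ∈ H κ := by
  have hκ' : (Cardinal.lift.{u + 1} κ).IsRegular := hκ.lift
  have : trcl x = ⋃ y : x, insert (y : ZFSet.{u}) (trcl y) := by
    ext z
    rw [mem_trcl_iff, Set.mem_iUnion]
    simp
  rw [mem_H, this, card_iUnion_lt_iff_forall_of_isRegular hκ']
  · intro y
    refine mk_insert_le.trans_lt (add_lt_of_lt hκ'.aleph0_le (mem_H.1 (hx y.2)) ?_)
    exact one_lt_aleph0.trans_le hκ'.aleph0_le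
  · rwa [ZFSet.cardinalMk_coe_sort, Cardinal.lift_lt]

theorem empty_mem_H (hκ : κ.IsRegular) : ∅ ∈ H κ :=
  mem_H_of_subset_H hκ (ZFSet.empty_subset _) (by simpa using hκ.pos)

theorem insert_mem_H (hκ : κ.IsRegular) (hx : x ∈ H κ) (hy : y ∈ H κ) : insert x y ∈ H κ := by
  refine mem_H_of_subset_H hκ (fun z hz => ?_) ?_
  · rcases ZFSet.mem_insert_iff.1 hz with rfl | hz
    · exact hx
    · exact mem_H_of_mem hy hz
  · exact ZFSet.card_insert_le.trans_lt (add_lt_of_lt hκ.aleph0_le (card_lt_of_mem_H hy)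
      (one_lt_aleph0.trans_le hκ.aleph0_le))

theorem mem_H_of_countable (hκ : κ.IsRegular) (h₀ : ℵ₀ < κ) (hx : x ⊆ H κ)
    (hc : (x : Set ZFSet.{u}).Countable) : x ∈ H κ :=
  mem_H_of_subset_H hκ hx ((countable_iff_card_le.1 hc).trans_lt h₀)

theorem mem_H_of_finite (hκ : κ.IsRegular) (hx : x ⊆ H κ)
    (hc : (x : Set ZFSet.{u}).Finite) : x ∈ H κ := by
  refine mem_H_of_subset_H hκ hx (lt_of_lt_of_le ?_ hκ.aleph0_le)
  rw [← Cardinal.lift_lt.{u, u + 1}, ← ZFSet.cardinalMk_coe_sort, Cardinal.lift_aleph0]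
  exact Cardinal.lt_aleph0_iff_set_finite.2 hc

end HClosure

/-! ## Definability in `H(κ)` -/

section DfnMem

variable {κ : Cardinal.{u}} {n : ℕ} {R : Fin n → H κ → H κ → Prop} {i : Fin n}
  {S : Set (H κ)} {s t w : (ℕ → H κ) → H κ}

namespace Dfn

theorem mem (hi : R i = memRel (H κ)) (hs : Tm S s) (ht : Tm S t) :
    Dfn R S fun v => (s v : ZFSet.{u}) ∈ (t v : ZFSet.{u}) := by
  have := Dfn.rel (R := R) i hs ht
  rwa [hi] at this

/-- As `H κ` is transitive, a quantifier over the elements of a set in `H κ` may be bounded by `H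
κ`. The definitions of the other basic set-theoretic relations rest on the same remark. -/
theorem subset (hi : R i = memRel (H κ)) (hs : Tm S s) (ht : Tm S t) :
    Dfn R S fun v => (s v : ZFSet.{u}) ⊆ (t v : ZFSet.{u}) := by
  have : ∀ v, ((s v : ZFSet.{u}) ⊆ (t v : ZFSet.{u})) ↔
      ∀ x : H κ, (x : ZFSet.{u}) ∈ (s v : ZFSet.{u}) → (x : ZFSet.{u}) ∈ (t v : ZFSet.{u}) :=
    fun v => ⟨fun h x hx => h hx, fun h x hx => h ⟨x, mem_H_of_mem (s v).2 hx⟩ hx⟩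
  simp only [this]
  exact all (imp (mem hi (Tm.var 0) hs.shift) (mem hi (Tm.var 0) ht.shift))

theorem eq (hi : R i = memRel (H κ)) (hs : Tm S s) (ht : Tm S t) : Dfn R S fun v => s v = t v := by
  have : ∀ v, s v = t v ↔ (s v : ZFSet.{u}) ⊆ (t v : ZFSet.{u}) ∧ (t v : ZFSet.{u}) ⊆ (s v : ZFSet.{u}) :=
    fun v => ⟨fun h => by rw [h]; exact ⟨fun _ => id, fun _ => id⟩, fun h => Subtype.ext (subset_antisymm h.1 h.2)⟩
  simp only [this]
  exact (subset hi hs ht).and (subset hi ht hs)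

theorem eq_empty (hi : R i = memRel (H κ)) (hs : Tm S s) :
    Dfn R S fun v => (s v : ZFSet.{u}) = ∅ := by
  have : ∀ v, (s v : ZFSet.{u}) = ∅ ↔ ∀ x : H κ, ¬ (x : ZFSet.{u}) ∈ (s v : ZFSet.{u}) :=
    fun v => ⟨fun h x => by rw [h]; exact ZFSet.notMem_empty _, fun h => (ZFSet.eq_empty _).2 fun x hx =>
      h ⟨x, mem_H_of_mem (s v).2 hx⟩ hx⟩
  simp only [this]
  exact all (mem hi (Tm.var 0) hs.shift).not

theorem eq_insert (hi : R i = memRel (H κ)) (hs : Tm S s) (ht : Tm S t) (hw : Tm S w) :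
    Dfn R S fun v => (s v : ZFSet.{u}) = insert (t v : ZFSet.{u}) (w v : ZFSet.{u}) := by
  have : ∀ v, (s v : ZFSet.{u}) = insert (t v : ZFSet.{u}) (w v : ZFSet.{u}) ↔
      ∀ x : H κ, (x : ZFSet.{u}) ∈ (s v : ZFSet.{u}) ↔
        x = t v ∨ (x : ZFSet.{u}) ∈ (w v : ZFSet.{u}) := by
    refine fun v => ⟨fun h x => by rw [h, ZFSet.mem_insert_iff, Subtype.ext_iff], fun h => ZFSet.ext fun x => ?_⟩
    rw [ZFSet.mem_insert_iff]
    constructor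
    · exact fun hx => (h ⟨x, mem_H_of_mem (s v).2 hx⟩).1 hx |>.imp (congr_arg Subtype.val) id
    · rintro (rfl | hx)
      · exact (h (t v)).2 (Or.inl rfl)
      · exact (h ⟨x, mem_H_of_mem (w v).2 hx⟩).2 (Or.inr hx)
  simp only [this]
  exact all ((mem hi (Tm.var 0) hs.shift).iff
    ((eq hi (Tm.var 0) ht.shift).or (mem hi (Tm.var 0) hw.shift)))

theorem eq_inter (hi : R i = memRel (H κ)) (hs : Tm S s) (ht : Tm S t) (hw : Tm S w) :
    Dfn R S fun v => (s v : ZFSet.{u}) = (t v : ZFSet.{u}) ∩ (w v : ZFSet.{u}) := by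
  have : ∀ v, (s v : ZFSet.{u}) = (t v : ZFSet.{u}) ∩ (w v : ZFSet.{u}) ↔
      ∀ x : H κ, (x : ZFSet.{u}) ∈ (s v : ZFSet.{u}) ↔
        (x : ZFSet.{u}) ∈ (t v : ZFSet.{u}) ∧ (x : ZFSet.{u}) ∈ (w v : ZFSet.{u}) := by
    refine fun v => ⟨fun h x => by rw [h, ZFSet.mem_inter], fun h => ZFSet.ext fun x => ?_⟩
    rw [ZFSet.mem_inter]
    exact ⟨fun hx => (h ⟨x, mem_H_of_mem (s v).2 hx⟩).1 hx,
      fun hx => (h ⟨x, mem_H_of_mem (t v).2 hx.1⟩).2 hx⟩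
  simp only [this]
  exact all ((mem hi (Tm.var 0) hs.shift).iff
    ((mem hi (Tm.var 0) ht.shift).and (mem hi (Tm.var 0) hw.shift)))

end Dfn

/-- `c` is a `⊆`-chain of sets, starting with `∅` and obtained by repeatedly adding one element,
whose union contains `x`. -/
structure IsEnumeration (c x : H κ) : Prop where
  empty : ∃ e : H κ, (e : ZFSet.{u}) ∈ (c : ZFSet.{u}) ∧ (e : ZFSet.{u}) = ∅
  unique : ∀ s y z a b : H κ, (a : ZFSet.{u}) ∈ (c : ZFSet.{u}) → (b : ZFSet.{u}) ∈ (c : ZFSet.{u}) →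
    (s : ZFSet.{u}) ∈ (c : ZFSet.{u}) → ¬ (y : ZFSet.{u}) ∈ (s : ZFSet.{u}) →
    ¬ (z : ZFSet.{u}) ∈ (s : ZFSet.{u}) → (a : ZFSet.{u}) = insert (y : ZFSet.{u}) (s : ZFSet.{u}) →
    (b : ZFSet.{u}) = insert (z : ZFSet.{u}) (s : ZFSet.{u}) → y = z
  cover : ∀ y : H κ, (y : ZFSet.{u}) ∈ (x : ZFSet.{u}) →
    ∃ s : H κ, (s : ZFSet.{u}) ∈ (c : ZFSet.{u}) ∧ (y : ZFSet.{u}) ∈ (s : ZFSet.{u})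
  minimal : ∀ d : H κ, (d : ZFSet.{u}) ⊆ (c : ZFSet.{u}) →
    (∃ e : H κ, (e : ZFSet.{u}) ∈ (d : ZFSet.{u}) ∧ (e : ZFSet.{u}) = ∅) →
    (∀ s y a : H κ, (s : ZFSet.{u}) ∈ (d : ZFSet.{u}) → (a : ZFSet.{u}) ∈ (c : ZFSet.{u}) →
      (a : ZFSet.{u}) = insert (y : ZFSet.{u}) (s : ZFSet.{u}) → (a : ZFSet.{u}) ∈ (d : ZFSet.{u})) →
    (c : ZFSet.{u}) ⊆ (d : ZFSet.{u})

/-- With this substitution, definability of a binary predicate need only be checked for two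
variables, without moving arbitrary terms under its quantifiers. -/
theorem Dfn.comp₂ (hi : R i = memRel (H κ)) {Q : H κ → H κ → Prop}
    (hQ : Dfn R S fun v => Q (v 0) (v 1)) (hs : Tm S s) (ht : Tm S t) :
    Dfn R S fun v => Q (s v) (t v) := by
  have : ∀ v, Q (s v) (t v) ↔ ∃ y x, x = s v ∧ y = t v ∧ Q x y := fun v => by simp
  simp only [this]
  exact Dfn.ex (Dfn.ex ((Dfn.eq hi (Tm.var 0) hs.shift.shift).and
    ((Dfn.eq hi (Tm.var 1) ht.shift.shift).and hQ)))

theorem Dfn.isEnumeration (hi : R i = memRel (H κ)) (hs : Tm S s) (ht : Tm S t) :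
    Dfn R S fun v => IsEnumeration (s v) (t v) := by
  refine Dfn.comp₂ (Q := IsEnumeration) hi ?_ hs ht
  have : ∀ c x : H κ, IsEnumeration c x ↔ _ ∧ _ ∧ _ ∧ _ := fun c x =>
    ⟨fun h => ⟨h.1, h.2, h.3, h.4⟩, fun h => ⟨h.1, h.2.1, h.2.2.1, h.2.2.2⟩⟩
  simp only [this]
  repeat' first
    | exact Tm.var _ | apply Dfn.not | apply Dfn.and | apply Dfn.mem hi | apply Dfn.eq hi
    | apply Dfn.eq_empty hi | apply Dfn.eq_insert hi | apply Dfn.subset hi | apply Dfn.imp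
    | apply Dfn.all | apply Dfn.ex

/-- `x` has an enumeration in type at most `ω`. -/
def IsEnumerable (x : H κ) : Prop := ∃ c, IsEnumeration c x

theorem Dfn.isEnumerable (hi : R i = memRel (H κ)) (hs : Tm S s) :
    Dfn R S fun v => IsEnumerable (s v) :=
  Dfn.ex (Dfn.isEnumeration hi (Tm.var 0) hs.shift)

end DfnMem

/-! ## Elementary submodels of `H(κ)` -/

section Submodels

variable {κ : Cardinal.{u}} {n : ℕ} {R : Fin n → H κ → H κ → Prop} {i : Fin n} {M x y : ZFSet.{u}}

namespace IsElementarySubmodel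

theorem empty_mem (hM : IsElementarySubmodel (H κ) R M) (hκ : κ.IsRegular) (hi : R i = memRel (H κ)) :
    ∅ ∈ M :=
  hM.mem_of_unique (Q := fun z => (z : ZFSet.{u}) = ∅) (a := ⟨∅, empty_mem_H hκ⟩) (Dfn.eq_empty hi (Tm.var 0)) rfl
    fun _ hb => Subtype.ext hb

theorem insert_mem (hM : IsElementarySubmodel (H κ) R M) (hκ : κ.IsRegular)
    (hi : R i = memRel (H κ)) (hx : x ∈ M) (hy : y ∈ M) : insert x y ∈ M :=
  hM.mem_of_unique (Q := fun z => (z : ZFSet.{u}) = insert x y) (a := ⟨insert x y, insert_mem_H hκ (hM.subset hx) (hM.subset hy)⟩)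
    (Dfn.eq_insert hi (Tm.var 0) (Tm.param ⟨x, hM.subset hx⟩ hx) (Tm.param ⟨y, hM.subset hy⟩ hy)) rfl
    fun _ hb => Subtype.ext hb

theorem inter_mem (hM : IsElementarySubmodel (H κ) R M) (hi : R i = memRel (H κ))
    (hx : x ∈ M) (hy : y ∈ M) : x ∩ y ∈ M :=
  hM.mem_of_unique (Q := fun z => (z : ZFSet.{u}) = x ∩ y)
    (a := ⟨x ∩ y, mem_H_of_subset (hM.subset hx) fun _ hz => (ZFSet.mem_inter.1 hz).1⟩)
    (Dfn.eq_inter hi (Tm.var 0) (Tm.param ⟨x, hM.subset hx⟩ hx) (Tm.param ⟨y, hM.subset hy⟩ hy)) rfl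
    fun _ hb => Subtype.ext hb

theorem mem_of_finite (hM : IsElementarySubmodel (H κ) R M) (hκ : κ.IsRegular)
    (hi : R i = memRel (H κ)) (hx : (x : Set ZFSet.{u}).Finite) (h : x ⊆ M) : x ∈ M := by
  obtain ⟨s, hs⟩ : ∃ s : Set ZFSet.{u}, s = x := ⟨_, rfl⟩
  rw [← hs] at hx
  induction s, hx using Set.Finite.induction_on generalizing x with
  | empty =>
    rw [(ZFSet.eq_empty x).2 fun y hy => (hs ▸ SetLike.mem_coe.2 hy : y ∈ (∅ : Set ZFSet))]
    exact hM.empty_mem hκ hi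
  | @insert a s ha hf ih =>
    have hmem : ∀ y, y ∈ x ↔ y = a ∨ y ∈ s := fun y => by
      rw [← SetLike.mem_coe, ← hs, Set.mem_insert_iff]
    have h₁ : (ZFSet.sep (· ∈ s) x : ZFSet.{u}) ∈ M := by
      refine ih (fun y hy => h (ZFSet.mem_sep.1 hy).1) ?_
      ext y
      simp only [SetLike.mem_coe, ZFSet.mem_sep, hmem]
      tauto
    have h₂ : x = insert a (ZFSet.sep (· ∈ s) x) := by
      ext y
      simp only [ZFSet.mem_insert_iff, ZFSet.mem_sep, hmem]
      tauto
    rw [h₂]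
    exact hM.insert_mem hκ hi (h ((hmem a).2 (Or.inl rfl))) h₁

/-- `M` contains an enumeration `c` of `x`. Let `d` consist of those `s ∈ c` that are both elements
and subsets of `M`. Then `∅ ∈ d`, and a successor of `s ∈ d` within `c` is again in `d`, because the
added point is definable from `c` and `s` by `unique`. So `minimal` gives `c ⊆ d`, and `cover`
yields `x ⊆ M`. -/
theorem subset_of_isEnumerable (hM : IsElementarySubmodel (H κ) R M) (hκ : κ.IsRegular)
    (hi : R i = memRel (H κ)) {x : H κ} (hx : (x : ZFSet.{u}) ∈ M) (h : IsEnumerable x) :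
    (x : ZFSet.{u}) ⊆ M := by
  obtain ⟨c, hcM, hc⟩ := hM.exists_mem (Q := fun c => IsEnumeration c x)
    (Dfn.isEnumeration hi (Tm.var 0) (Tm.param x hx)) h
  have hins : ∀ s y a : H κ, (s : ZFSet.{u}) ∈ M → (s : ZFSet.{u}) ⊆ M →
      (s : ZFSet.{u}) ∈ (c : ZFSet.{u}) → (a : ZFSet.{u}) ∈ (c : ZFSet.{u}) →
      (a : ZFSet.{u}) = insert (y : ZFSet.{u}) (s : ZFSet.{u}) → (y : ZFSet.{u}) ∈ M := by
    intro s y a hsM hsM' hs ha hay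
    by_cases hys : (y : ZFSet.{u}) ∈ (s : ZFSet.{u})
    · exact hsM' hys
    · refine hM.mem_of_unique (Q := fun y => ¬ (y : ZFSet.{u}) ∈ (s : ZFSet.{u}) ∧
        ∃ a : H κ, (a : ZFSet.{u}) ∈ (c : ZFSet.{u}) ∧
          (a : ZFSet.{u}) = insert (y : ZFSet.{u}) (s : ZFSet.{u})) ?_ ⟨hys, a, ha, hay⟩ ?_
      · exact (Dfn.mem hi (Tm.var 0) (Tm.param s hsM)).not.and (Dfn.ex
          ((Dfn.mem hi (Tm.var 0) (Tm.param c hcM)).and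
            (Dfn.eq_insert hi (Tm.var 0) (Tm.var 1) (Tm.param s hsM))))
      · rintro z ⟨hzs, b, hb, hbz⟩
        exact hc.unique s z y b a hb ha hs hzs hys hbz hay
  let d : ZFSet.{u} := ZFSet.sep (fun s => s ∈ M ∧ s ⊆ M) (c : ZFSet.{u})
  have hmem : ∀ s, s ∈ d ↔ s ∈ (c : ZFSet.{u}) ∧ s ∈ M ∧ s ⊆ M := fun s => ZFSet.mem_sep
  have hd : d ⊆ c := fun s hs => ((hmem s).1 hs).1
  have hcd := hc.minimal ⟨d, mem_H_of_subset c.2 hd⟩ hd ?_ ?_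
  · intro y hy
    obtain ⟨s, hs, hys⟩ := hc.cover ⟨y, mem_H_of_mem x.2 hy⟩ hy
    exact ((hmem _).1 (hcd hs)).2.2 hys
  · obtain ⟨e, he, he'⟩ := hc.empty
    refine ⟨e, (hmem _).2 ⟨he, ?_⟩, he'⟩
    rw [he']
    exact ⟨hM.empty_mem hκ hi, ZFSet.empty_subset _⟩
  · intro s y a hs ha hay
    obtain ⟨hs, hsM, hsM'⟩ := (hmem _).1 hs
    have hyM := hins s y a hsM hsM' hs ha hay
    refine (hmem _).2 ⟨ha, ?_⟩
    rw [hay]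
    refine ⟨hM.insert_mem hκ hi hyM hsM, fun z hz => ?_⟩
    rcases ZFSet.mem_insert_iff.1 hz with rfl | hz
    · exact hyM
    · exact hsM' hz

end IsElementarySubmodel

/-- From an injection `e` of `x` into `ℕ`, the enumeration consists of the initial segments `{y ∈ x
| e y < k}`. -/
theorem isEnumerable_of_countable (hκ : κ.IsRegular) (h₀ : ℵ₀ < κ) {x : H κ}
    (hx : ((x : ZFSet.{u}) : Set ZFSet.{u}).Countable) : IsEnumerable x := by
  obtain ⟨e, he⟩ := Set.countable_iff_exists_injOn.1 hx
  let s : ℕ → ZFSet.{u} := fun k => ZFSet.sep (fun y => e y < k) (x : ZFSet.{u})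
  have hs : ∀ {k y}, y ∈ s k ↔ y ∈ (x : ZFSet.{u}) ∧ e y < k := ZFSet.mem_sep
  have hsx : ∀ k, s k ⊆ x := fun k y hy => (hs.1 hy).1
  have hmono : ∀ {k m}, k ≤ m → s k ⊆ s m := fun h y hy => hs.2 ⟨(hs.1 hy).1, (hs.1 hy).2.trans_le h⟩
  have hzero : s 0 = ∅ := (ZFSet.eq_empty _).2 fun y hy => by simpa using (hs.1 hy).2
  have hsH : ∀ k, s k ∈ H κ := fun k => mem_H_of_subset x.2 (hsx k)
  have hcH : ZFSet.range s ∈ H κ := by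
    refine mem_H_of_countable hκ h₀ (fun y hy => ?_) ?_
    · obtain ⟨k, rfl⟩ := ZFSet.mem_range.1 hy
      exact hsH k
    · rw [ZFSet.coe_range]
      exact Set.countable_range s
  refine ⟨⟨_, hcH⟩, ⟨⟨s 0, hsH 0⟩, ZFSet.mem_range_self 0, hzero⟩, ?_, ?_, ?_⟩
  · rintro r y z a b ha hb - hy hz hay hbz
    obtain ⟨k, hk⟩ := ZFSet.mem_range.1 ha
    obtain ⟨m, hm⟩ := ZFSet.mem_range.1 hb
    -- The two one-point extensions are initial segments, hence comparable, so the point added by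
    -- the smaller one also lies in the larger one.
    apply Subtype.ext
    rcases le_total k m with h | h
    · have : (y : ZFSet.{u}) ∈ (b : ZFSet.{u}) := by
        rw [← hm]; apply hmono h; rw [hk, hay]; exact ZFSet.mem_insert _ _
      rw [hbz] at this
      exact (ZFSet.mem_insert_iff.1 this).resolve_right hy
    · have : (z : ZFSet.{u}) ∈ (a : ZFSet.{u}) := by
        rw [← hk]; apply hmono h; rw [hm, hbz]; exact ZFSet.mem_insert _ _
      rw [hay] at this
      exact ((ZFSet.mem_insert_iff.1 this).resolve_right hz).symm
  · exact fun y hy => ⟨⟨s (e y + 1), hsH _⟩, ZFSet.mem_range_self _, hs.2 ⟨hy, Nat.lt_succ_self _⟩⟩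
  · rintro d - ⟨e', he', he''⟩ hclosed a ha
    obtain ⟨k, rfl⟩ := ZFSet.mem_range.1 ha
    clear ha
    induction k with
    | zero => rwa [hzero, ← he'']
    | succ k ih =>
      by_cases h : ∃ y ∈ (x : ZFSet.{u}), e y = k
      · obtain ⟨y, hy, hyk⟩ := h
        refine hclosed ⟨s k, hsH k⟩ ⟨y, mem_H_of_mem x.2 hy⟩ ⟨s (k + 1), hsH _⟩ ih
          (ZFSet.mem_range_self _) (ZFSet.ext fun z => ?_)
        change z ∈ s (k + 1) ↔ z ∈ insert y (s k)
        rw [ZFSet.mem_insert_iff, hs, hs, Nat.lt_succ_iff_lt_or_eq]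
        constructor
        · rintro ⟨hz, h | h⟩
          · exact Or.inr ⟨hz, h⟩
          · exact Or.inl (he hz hy (h.trans hyk.symm))
        · rintro (rfl | h)
          · exact ⟨hy, Or.inr hyk⟩
          · exact ⟨h.1, Or.inl h.2⟩
      -- If `e` omits the value `k`, the segment does not grow at this stage.
      · have : s (k + 1) = s k := by
          ext z
          rw [hs, hs, Nat.lt_succ_iff_lt_or_eq]
          exact ⟨fun hz => ⟨hz.1, hz.2.resolve_right fun h' => h ⟨z, hz.1, h'⟩⟩,
            fun hz => ⟨hz.1, Or.inl hz.2⟩⟩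
        rwa [this]

theorem IsElementarySubmodel.subset_of_countable (hM : IsElementarySubmodel (H κ) R M)
    (hκ : κ.IsRegular) (h₀ : ℵ₀ < κ) (hi : R i = memRel (H κ)) (hx : x ∈ M)
    (hc : (x : Set ZFSet.{u}).Countable) : x ⊆ M :=
  hM.subset_of_isEnumerable hκ hi (x := ⟨x, hM.subset hx⟩) hx (isEnumerable_of_countable hκ h₀ hc)

/-- A hull operation: every subset of `H(κ)` generates an elementary submodel closed under `F`,
and countable sets generate countable submodels. -/
theorem exists_hull (hκ : κ.IsRegular) (R : Fin n → H κ → H κ → Prop)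
    (F : List (H κ) → H κ) : ∃ hull : Set (H κ) → ZFSet.{u},
      (∀ S, IsElementarySubmodel (H κ) R (hull S)) ∧
      (∀ S, ∀ x : H κ, x ∈ S → (x : ZFSet.{u}) ∈ hull S) ∧
      (∀ S, S.Countable → (hull S : Set ZFSet.{u}).Countable) ∧
      (∀ S, ∀ l : List (H κ), (∀ a ∈ l, (a : ZFSet.{u}) ∈ hull S) → (F l : ZFSet.{u}) ∈ hull S) ∧
      ∀ 𝓢 : Set (Set (H κ)), 𝓢.Nonempty → (∀ S ∈ 𝓢, ∀ T ∈ 𝓢, ∃ W ∈ 𝓢, S ⊆ W ∧ T ⊆ W) →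
        ∀ x, x ∈ hull (⋃₀ 𝓢) → ∃ S ∈ 𝓢, x ∈ hull S := by
  obtain ⟨G, hG⟩ := exists_skolem ⟨∅, empty_mem_H hκ⟩ R
  -- The extra index `none` adjoins `F` to the Skolem functions.
  let G' : Option ((binLang n).Formula ℕ) → List (H κ) → H κ := fun o => o.elim F G
  let hull : Set (H κ) → ZFSet.{u} := fun S =>
    ZFSet.sep (fun x => ∃ h : x ∈ H κ, FunClosure G' S ⟨x, h⟩) (H κ)
  have hmem : ∀ {S} {x : H κ}, (x : ZFSet.{u}) ∈ hull S ↔ FunClosure G' S x := fun {S x} =>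
    ⟨fun h => (ZFSet.mem_sep.1 h).2.2, fun h => ZFSet.mem_sep.2 ⟨x.2, x.2, h⟩⟩
  have hsub : ∀ S, hull S ⊆ H κ := fun S x h => (ZFSet.mem_sep.1 h).1
  refine ⟨hull, fun S => ?_, fun S x hx => hmem.2 (.base hx), fun S hS => ?_, fun S l hl => ?_, ?_⟩
  · exact hG _ (hsub S) fun φ l hl => hmem.2 (FunClosure.app (G := G') (some φ) l
      fun a ha => hmem.1 (hl a ha))
  · refine ((FunClosure.countable G' hS).image ((↑) : H κ → ZFSet.{u})).mono fun x hx => ?_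
    exact ⟨⟨x, hsub S hx⟩, hmem.1 hx, rfl⟩
  · exact hmem.2 (FunClosure.app (G := G') none l fun a ha => hmem.1 (hl a ha))
  · intro 𝓢 hne hdir x hx
    have hmono : ∀ {S T} {a}, S ⊆ T → FunClosure G' S a → FunClosure G' T a := by
      intro S T a hST h
      induction h with
      | base h => exact .base (hST h)
      | app j l _ ih => exact .app j l ih
    obtain ⟨a, rfl⟩ : ∃ a : H κ, (a : ZFSet.{u}) = x := ⟨⟨x, hsub _ hx⟩, rfl⟩
    suffices ∃ S ∈ 𝓢, FunClosure G' S a by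
      obtain ⟨S, hS, h⟩ := this
      exact ⟨S, hS, hmem.2 h⟩
    have hx' := hmem.1 hx
    clear hx
    induction hx' with
    | base h =>
      obtain ⟨S, hS, h⟩ := h
      exact ⟨S, hS, .base h⟩
    | app j l _ ih =>
      -- Only finitely many arguments occur, so directedness provides one set generating all of
      -- them.
      have : ∃ S ∈ 𝓢, ∀ a ∈ l, FunClosure G' S a := by
        clear * - ih hne hdir hmono
        induction l with
        | nil => exact ⟨_, hne.some_mem, by simp⟩
        | cons b l ihl =>
          obtain ⟨S, hS, h⟩ := ihl fun a ha => ih a (List.mem_cons_of_mem _ ha)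
          obtain ⟨T, hT, h'⟩ := ih b List.mem_cons_self
          obtain ⟨W, hW, hSW, hTW⟩ := hdir S hS T hT
          refine ⟨W, hW, fun a ha => ?_⟩
          rcases List.mem_cons.1 ha with rfl | ha
          · exact hmono hTW h'
          · exact hmono hSW (h a ha)
      obtain ⟨S, hS, h⟩ := this
      exact ⟨S, hS, .app j l h⟩

theorem exists_countable_submodel (hκ : κ.IsRegular) (R : Fin n → H κ → H κ → Prop)
    {S : Set (H κ)} (hS : S.Countable) : ∃ M, IsElementarySubmodel (H κ) R M ∧
      (M : Set ZFSet.{u}).Countable ∧ ∀ x : H κ, x ∈ S → (x : ZFSet.{u}) ∈ M := by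
  obtain ⟨hull, h₁, h₂, h₃, -⟩ := exists_hull hκ R fun _ => ⟨∅, empty_mem_H hκ⟩
  exact ⟨hull S, h₁ S, h₃ S hS, h₂ S⟩

/-- Some countable elementary submodel has `x` as an element and therefore includes it. -/
theorem countable_of_isEnumerable (hκ : κ.IsRegular) {x : H κ} (hx : IsEnumerable x) :
    ((x : ZFSet.{u}) : Set ZFSet.{u}).Countable := by
  obtain ⟨M, hM, hc, hxM⟩ := exists_countable_submodel hκ ![memRel (H κ)] (Set.countable_singleton x)
  exact hc.mono (hM.subset_of_isEnumerable (i := 0) hκ rfl (hxM x rfl) hx)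

end Submodels

/-! ## Models in `𝓔²` -/

theorem isRegular_aleph_two : (ℵ_ 2 : Cardinal.{u}).IsRegular := by
  have := isRegular_aleph_add_one.{u} 1
  rwa [one_add_one_eq_two] at this

theorem aleph_one_lt_aleph_two : (ℵ₁ : Cardinal.{u}) < ℵ_ 2 := by
  rw [aleph_lt_aleph]; exact one_lt_two

theorem aleph0_lt_aleph_two : (ℵ₀ : Cardinal.{u}) < ℵ_ 2 :=
  aleph0_lt_aleph_one.trans aleph_one_lt_aleph_two

theorem lt_aleph_two_iff {c : Cardinal.{u}} : c < ℵ_ 2 ↔ c ≤ ℵ₁ := by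
  rw [← one_add_one_eq_two, ← succ_aleph, Order.lt_succ_iff]

theorem toZFSet_mem_H {o : Ordinal.{u}} (ho : o < ω_ 2) : o.toZFSet ∈ H (ℵ_ 2) := by
  induction o using WellFoundedLT.induction with
  | ind o ih =>
    refine mem_H_of_subset_H isRegular_aleph_two (fun x hx => ?_) ?_
    · obtain ⟨a, ha, rfl⟩ := Ordinal.mem_toZFSet_iff.1 hx
      exact ih a ha (ha.trans ho)
    · rw [Ordinal.card_toZFSet]
      exact lt_omega_iff_card_lt.1 ho

theorem countable_Iio_of_lt_omega_one {o : Ordinal.{u}} (ho : o < ω₁) : (Set.Iio o).Countable := by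
  rw [← Cardinal.le_aleph0_iff_set_countable, Cardinal.mk_Iio_ordinal, Cardinal.lift_le_aleph0,
    ← Cardinal.lt_aleph_one_iff]
  exact lt_omega_iff_card_lt.1 ho

theorem omega_one_lt_omega_two : (ω₁ : Ordinal.{u}) < ω_ 2 := by
  rw [omega_lt_omega]; exact one_lt_two

theorem add_one_lt_omega_one {o : Ordinal.{u}} (ho : o < ω₁) : o + 1 < ω₁ :=
  (isSuccLimit_omega 1).add_one_lt ho

/-- A family of at most `ℵ₁` members, given by a function on `ω₁`. -/
theorem range_Iio_mem_H {f : Ordinal.{u} → ZFSet.{u}} (hf : ∀ ξ < ω₁, f ξ ∈ H (ℵ_ 2)) :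
    ZFSet.range (fun ξ : Set.Iio (ω₁ : Ordinal.{u}) => f ξ) ∈ H (ℵ_ 2) := by
  refine mem_H_of_subset_H isRegular_aleph_two (fun x hx => ?_) (lt_aleph_two_iff.2 ?_)
  · obtain ⟨ξ, rfl⟩ := ZFSet.mem_range.1 hx
    exact hf ξ ξ.2
  · rw [← Cardinal.lift_le.{u + 1}, ← ZFSet.cardinalMk_coe_sort]
    have h := Cardinal.mk_range_le (f := fun ξ : Set.Iio (ω₁ : Ordinal.{u}) => f ξ)
    rw [Cardinal.mk_Iio_ordinal, card_omega, ← ZFSet.coe_range] at h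
    exact h

/-- `c` is a `⊆`-chain of countable sets covering `x`. -/
def IsCountableCover (c x : H.{u} (ℵ_ 2)) : Prop :=
  (∀ s : H (ℵ_ 2), (s : ZFSet.{u}) ∈ (c : ZFSet.{u}) → IsEnumerable s) ∧
  (∀ s t : H (ℵ_ 2), (s : ZFSet.{u}) ∈ (c : ZFSet.{u}) → (t : ZFSet.{u}) ∈ (c : ZFSet.{u}) →
    (s : ZFSet.{u}) ⊆ (t : ZFSet.{u}) ∨ (t : ZFSet.{u}) ⊆ (s : ZFSet.{u})) ∧
  ∀ y : H (ℵ_ 2), (y : ZFSet.{u}) ∈ (x : ZFSet.{u}) →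
    ∃ s : H (ℵ_ 2), (s : ZFSet.{u}) ∈ (c : ZFSet.{u}) ∧ (y : ZFSet.{u}) ∈ (s : ZFSet.{u})

theorem Dfn.isCountableCover {n : ℕ} {R : Fin n → H.{u} (ℵ_ 2) → H.{u} (ℵ_ 2) → Prop} {i : Fin n}
    {S : Set (H.{u} (ℵ_ 2))} {s t : (ℕ → H.{u} (ℵ_ 2)) → H.{u} (ℵ_ 2)}
    (hi : R i = memRel (H (ℵ_ 2))) (hs : Tm S s) (ht : Tm S t) :
    Dfn R S fun v => IsCountableCover (s v) (t v) := by
  refine Dfn.comp₂ (Q := IsCountableCover) hi ?_ hs ht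
  unfold IsCountableCover
  repeat' first
    | exact Tm.var _ | apply Dfn.isEnumerable hi | apply Dfn.and | apply Dfn.or | apply Dfn.mem hi
    | apply Dfn.subset hi | apply Dfn.imp | apply Dfn.all | apply Dfn.ex

/-- Inject `x` into `ω₁` and take preimages of the countable initial segments; the bound `α + 1`
puts the point with index `α` into the set `s α`. -/
theorem exists_isCountableCover (x : H.{u} (ℵ_ 2)) : ∃ c, IsCountableCover c x := by
  obtain ⟨x, hx⟩ := x
  classical
  have hcard : #x ≤ #(Set.Iio (ω₁ : Ordinal.{u})) := by
    rw [ZFSet.cardinalMk_coe_sort, Cardinal.mk_Iio_ordinal, card_omega, Cardinal.lift_le]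
    exact lt_aleph_two_iff.1 (card_lt_of_mem_H hx)
  obtain ⟨e⟩ := Cardinal.le_def _ _ |>.1 hcard
  let s : Ordinal.{u} → ZFSet.{u} := fun α => ZFSet.sep (fun y => ∃ h : y ∈ x, (e ⟨y, h⟩ : Ordinal.{u}) < α + 1) x
  have hs : ∀ {α y}, y ∈ s α ↔ ∃ h : y ∈ x, (e ⟨y, h⟩ : Ordinal.{u}) < α + 1 := fun {α y} =>
    ZFSet.mem_sep.trans (and_iff_right_of_imp fun h => h.1)
  have hmono : ∀ {α β}, α ≤ β → s α ⊆ s β := fun hαβ y hy => by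
    obtain ⟨h, h'⟩ := hs.1 hy
    exact hs.2 ⟨h, h'.trans_le (by gcongr)⟩
  have hsH : ∀ α, s α ∈ H (ℵ_ 2) := fun α => mem_H_of_subset hx fun y hy => (hs.1 hy).1
  refine ⟨⟨_, range_Iio_mem_H (f := s) fun ξ _ => hsH ξ⟩, fun t ht => ?_, fun t t' ht ht' => ?_, fun y hy => ?_⟩
  · obtain ⟨⟨α, hα⟩, h⟩ := ZFSet.mem_range.1 ht
    refine isEnumerable_of_countable isRegular_aleph_two aleph0_lt_aleph_two ?_
    rw [← h]
    have : ((s α : ZFSet.{u}) : Set ZFSet.{u}) ⊆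
        (fun z : x => (z : ZFSet.{u})) '' ((fun z => (e z : Ordinal.{u})) ⁻¹' Set.Iio (α + 1)) := by
      intro y hy
      obtain ⟨h, h'⟩ := hs.1 hy
      exact ⟨⟨y, h⟩, h', rfl⟩
    refine Set.Countable.mono this (Set.Countable.image (Set.Countable.preimage_of_injOn
      (countable_Iio_of_lt_omega_one (add_one_lt_omega_one hα)) ?_) _)
    exact (Subtype.val_injective.comp e.injective).injOn
  · obtain ⟨α, h⟩ := ZFSet.mem_range.1 ht
    obtain ⟨β, h'⟩ := ZFSet.mem_range.1 ht'
    rw [← h, ← h']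
    exact (le_total (α : Ordinal.{u}) β).imp hmono hmono
  · exact ⟨⟨s (e ⟨y, hy⟩), hsH _⟩, ZFSet.mem_range_self _, hs.2 ⟨hy, Order.lt_succ _⟩⟩

section Models

variable {r : H.{u} (ℵ_ 2) → H.{u} (ℵ_ 2) → Prop} {M N U C x y : ZFSet.{u}}

theorem IsModel.empty_mem (hM : IsModel r M) : ∅ ∈ M :=
  IsElementarySubmodel.empty_mem hM (i := 0) isRegular_aleph_two rfl

theorem IsModel.inter_mem (hM : IsModel r M) (hx : x ∈ M) (hy : y ∈ M) : x ∩ y ∈ M :=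
  IsElementarySubmodel.inter_mem hM (i := 0) rfl hx hy

theorem IsModel.mem_of_finite (hM : IsModel r M) (hx : (x : Set ZFSet.{u}).Finite) (h : x ⊆ M) :
    x ∈ M :=
  IsElementarySubmodel.mem_of_finite hM (i := 0) isRegular_aleph_two rfl hx h

theorem IsModel.subset_of_countable (hM : IsModel r M) (hx : x ∈ M)
    (hc : (x : Set ZFSet.{u}).Countable) : x ⊆ M :=
  IsElementarySubmodel.subset_of_countable hM (i := 0) isRegular_aleph_two aleph0_lt_aleph_two
    rfl hx hc

theorem IsModel.subset_of_isEnumerable (hM : IsModel r M) {x : H (ℵ_ 2)} (hx : (x : ZFSet.{u}) ∈ M)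
    (h : IsEnumerable x) : (x : ZFSet.{u}) ⊆ M :=
  IsElementarySubmodel.subset_of_isEnumerable hM (i := 0) isRegular_aleph_two rfl hx h

theorem IsModel.inter [IsWellOrder _ r] (hM : IsModel r M) (hN : IsModel r N) : IsModel r (M ∩ N) :=
  haveI : IsWellOrder (H (ℵ_ 2)) ((![memRel (H (ℵ_ 2)), r] : Fin 2 → _ → _ → Prop) 1) :=
    inferInstanceAs (IsWellOrder _ r)
  IsElementarySubmodel.inter 1 hM hN

theorem mem_E0_iff : C ∈ E0 r ↔ IsModel r C ∧ (C : Set ZFSet.{u}).Countable := by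
  rw [countable_iff_card_le]; rfl

theorem countable_of_mem_E0 (hC : C ∈ E0 r) : (C : Set ZFSet.{u}).Countable := (mem_E0_iff.1 hC).2

theorem isModel_of_mem_E2 (hM : M ∈ E2 r) : IsModel r M := hM.elim And.left And.left

theorem mem_H_of_mem_E2 (hM : M ∈ E2 r) : M ∈ H (ℵ_ 2) := by
  refine mem_H_of_subset_H isRegular_aleph_two (isModel_of_mem_E2 hM).subset (lt_aleph_two_iff.2 ?_)
  rcases hM with h | h
  · exact h.2.trans aleph0_lt_aleph_one.le
  · exact h.2.1.le

/-! ### Unions of approaching chains -/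

section Chain

variable {P : Ordinal.{u} → ZFSet.{u}}

theorem IsApproachingChain.mono (hP : IsApproachingChain r P) {ξ η : Ordinal.{u}} (h : ξ ≤ η)
    (hη : η < ω₁) : P ξ ⊆ P η := by
  rcases h.eq_or_lt with rfl | h
  · exact fun _ => id
  · exact hP.subset _ _ h hη

theorem IsApproachingChain.isModel (hP : IsApproachingChain r P) {ξ : Ordinal.{u}} (h : ξ < ω₁) :
    IsModel r (P ξ) := (hP.mem_E0 ξ h).1

/-- A countable subset of the union of a chain is contained in a member of the chain. -/
theorem IsApproachingChain.exists_subset (hP : IsApproachingChain r P) {A : Set ZFSet.{u}}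
    (hA : A.Countable) (h : ∀ x ∈ A, ∃ ξ < ω₁, x ∈ P ξ) : ∃ η < ω₁, ∀ x ∈ A, x ∈ P η := by
  choose! f hf hfx using h
  have := hA.to_subtype
  refine ⟨⨆ x : A, f x, Ordinal.iSup_lt_omega_one fun x => hf x x.2, fun x hx => ?_⟩
  exact hP.mono (Ordinal.le_iSup (fun x : A => f x) ⟨x, hx⟩)
    (Ordinal.iSup_lt_omega_one fun x => hf x x.2) (hfx x hx)

/-- If `U` were countable it would be included in some `P η`, but `P η ∈ P (η + 1) ⊆ U` would then
give `P η ∈ P η`. -/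
theorem IsApproachingChain.not_countable (hP : IsApproachingChain r P)
    (hU : ∀ x, x ∈ U ↔ ∃ ξ < ω₁, x ∈ P ξ) : ¬ (U : Set ZFSet.{u}).Countable := by
  intro h
  obtain ⟨η, hη, hUη⟩ := hP.exists_subset h fun x hx => (hU x).1 hx
  have h₁ := add_one_lt_omega_one hη
  exact ZFSet.mem_irrefl _ (hUη _ ((hU _).2 ⟨η + 1, h₁, hP.mem _ _ (Order.lt_succ η) h₁⟩))

/-- If `y ∈ x` were missing from `U`, then `x ∩ U` would be countable by the cover argument, hence
included in one model of the chain. But later models of the chain see that `x` is not covered by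
that one, and so contain further elements of `x`. This transitivity is what separates uncountable
from countable models throughout. -/
theorem IsApproachingChain.subset_union (hP : IsApproachingChain r P)
    (hU : ∀ x, x ∈ U ↔ ∃ ξ < ω₁, x ∈ P ξ) (hx : x ∈ U) : x ⊆ U := by
  intro y hyx
  by_contra hyU
  obtain ⟨ξ, hξ, hxξ⟩ := (hU x).1 hx
  have hxH := (hP.isModel hξ).subset hxξ
  have hi : (![memRel (H (ℵ_ 2)), r] : Fin 2 → _ → _ → Prop) 0 = memRel (H (ℵ_ 2)) := rfl
  obtain ⟨c, hcP, hc₁, hc₂, hc₃⟩ := (hP.isModel hξ).exists_mem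
    (Q := fun c => IsCountableCover c ⟨x, hxH⟩)
    (Dfn.isCountableCover hi (Tm.var 0) (Tm.param (⟨x, hxH⟩ : H (ℵ_ 2)) hxξ)) (exists_isCountableCover ⟨x, hxH⟩)
  obtain ⟨s, hs, hys⟩ := hc₃ ⟨y, mem_H_of_mem hxH hyx⟩ hyx
  -- A member `t ∋ z` of the cover can be found in `U`, and then `t ⊆ U` since `t` is countable. As
  -- `y ∈ s` is outside `U`, comparability leaves only `t ⊆ s`.
  have hxs : ∀ z ∈ x ∩ U, z ∈ (s : ZFSet.{u}) := by
    intro z hz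
    obtain ⟨hzx, hzU⟩ := ZFSet.mem_inter.1 hz
    obtain ⟨η, hη, hzη⟩ := (hU z).1 hzU
    have hm : max ξ η < ω₁ := max_lt hξ hη
    have hcm := hP.mono (le_max_left _ _) hm hcP
    have hzm := hP.mono (le_max_right _ _) hm hzη
    have hzH := (hP.isModel hm).subset hzm
    obtain ⟨t, htP, htc, hzt⟩ := (hP.isModel hm).exists_mem
      (Q := fun t => (t : ZFSet.{u}) ∈ (c : ZFSet.{u}) ∧ z ∈ (t : ZFSet.{u}))
      ((Dfn.mem hi (Tm.var 0) (Tm.param c hcm)).and (Dfn.mem hi (Tm.param ⟨z, hzH⟩ hzm) (Tm.var 0)))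
      (hc₃ ⟨z, hzH⟩ hzx)
    have htU : (t : ZFSet.{u}) ⊆ U := fun w hw =>
      (hU w).2 ⟨_, hm, (hP.isModel hm).subset_of_isEnumerable htP (hc₁ t htc) hw⟩
    rcases hc₂ s t hs htc with h | h
    · exact absurd (htU (h hys)) hyU
    · exact h hzt
  have hcount : ((x ∩ U : ZFSet.{u}) : Set ZFSet.{u}).Countable :=
    (countable_of_isEnumerable isRegular_aleph_two (hc₁ s hs)).mono hxs
  obtain ⟨η, hη, hη'⟩ := hP.exists_subset hcount fun z hz => (hU z).1 (ZFSet.mem_inter.1 hz).2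
  have hm : max ξ η < ω₁ := max_lt hξ hη
  have hm' := add_one_lt_omega_one hm
  have hPm := hP.mem _ _ (Order.lt_succ (max ξ η)) hm'
  have hPH := (hP.isModel hm').subset hPm
  have hxm := hP.mono ((le_max_left _ _).trans (Order.le_succ (max ξ η))) hm' hxξ
  -- `y` witnesses that `x` is not included in `P (max ξ η)`. The next model has both sets as
  -- elements, so it contains such a witness itself, although all of `x ∩ U` is in `P η`.
  obtain ⟨z, hzP, hzx, hz⟩ := (hP.isModel hm').exists_mem
    (Q := fun z => (z : ZFSet.{u}) ∈ x ∧ ¬ (z : ZFSet.{u}) ∈ P (max ξ η))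
    ((Dfn.mem hi (Tm.var 0) (Tm.param ⟨x, hxH⟩ hxm)).and
      (Dfn.mem hi (Tm.var 0) (Tm.param ⟨_, hPH⟩ hPm)).not)
    ⟨⟨y, mem_H_of_mem hxH hyx⟩, hyx, fun h => hyU ((hU y).2 ⟨_, hm, h⟩)⟩
  have hzxU : (z : ZFSet.{u}) ∈ x ∩ U := ZFSet.mem_inter.2 ⟨hzx, (hU z).2 ⟨_, hm', hzP⟩⟩
  exact hz (hP.mono (le_max_right _ _) hm (hη' z hzxU))

end Chain

theorem not_countable_of_mem_E1 (hU : U ∈ E1 r) : ¬ (U : Set ZFSet.{u}).Countable := by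
  obtain ⟨-, -, P, hP, h⟩ := hU
  exact hP.not_countable h

theorem subset_of_mem_E1 (hU : U ∈ E1 r) (hx : x ∈ U) : x ⊆ U := by
  obtain ⟨-, -, P, hP, h⟩ := hU
  exact hP.subset_union h hx

theorem not_mem_E1_of_mem_E0 (hC : C ∈ E0 r) : C ∉ E1 r :=
  fun h => not_countable_of_mem_E1 h (countable_of_mem_E0 hC)

theorem subset_of_mem_E0 (hC : C ∈ E0 r) (hM : M ∈ E2 r) (h : C ∈ M) : C ⊆ M :=
  (isModel_of_mem_E2 hM).subset_of_countable h (countable_of_mem_E0 hC)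

/-- A countable model is not transitive. -/
theorem exists_not_subset_of_mem_E0 (hC : C ∈ E0 r) : ∃ x ∈ C, ¬ x ⊆ C := by
  -- `ω₁` is an uncountable element of `H(ℵ₂)`, so by elementarity `C` has an uncountable element,
  -- which cannot be a subset of `C`.
  obtain ⟨x, hxC, hx⟩ := hC.1.exists_mem (Q := fun x => ¬ IsEnumerable x)
    (Dfn.isEnumerable (i := 0) rfl (Tm.var 0)).not
    ⟨⟨_, toZFSet_mem_H omega_one_lt_omega_two⟩, fun h => by
      have := countable_of_isEnumerable isRegular_aleph_two h
      rw [countable_iff_card_le, Ordinal.card_toZFSet, card_omega] at this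
      exact absurd this aleph0_lt_aleph_one.not_ge⟩
  exact ⟨x, hxC, fun h => hx (isEnumerable_of_countable isRegular_aleph_two aleph0_lt_aleph_two
    ((countable_of_mem_E0 hC).mono h))⟩

/-- `F` is a continuous family of countable elements of `U` with union `U`. -/
def IsFiltration (F U : H.{u} (ℵ_ 2)) : Prop :=
  (∀ p : H (ℵ_ 2), (p : ZFSet.{u}) ∈ (F : ZFSet.{u}) → (p : ZFSet.{u}) ∈ (U : ZFSet.{u}) ∧ IsEnumerable p) ∧
  (∀ x : H (ℵ_ 2), (x : ZFSet.{u}) ∈ (U : ZFSet.{u}) →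
    ∃ p : H (ℵ_ 2), (p : ZFSet.{u}) ∈ (F : ZFSet.{u}) ∧ (x : ZFSet.{u}) ∈ (p : ZFSet.{u})) ∧
  ∀ G W : H (ℵ_ 2), (G : ZFSet.{u}) ⊆ (F : ZFSet.{u}) →
    (∃ p : H (ℵ_ 2), (p : ZFSet.{u}) ∈ (G : ZFSet.{u})) →
    (∀ x : H (ℵ_ 2), (x : ZFSet.{u}) ∈ (W : ZFSet.{u}) ↔
      ∃ p : H (ℵ_ 2), (p : ZFSet.{u}) ∈ (G : ZFSet.{u}) ∧ (x : ZFSet.{u}) ∈ (p : ZFSet.{u})) →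
    ¬ (W = U) → (W : ZFSet.{u}) ∈ (F : ZFSet.{u})

theorem Dfn.isFiltration {n : ℕ} {R : Fin n → H.{u} (ℵ_ 2) → H.{u} (ℵ_ 2) → Prop} {i : Fin n}
    {S : Set (H.{u} (ℵ_ 2))} {s t : (ℕ → H.{u} (ℵ_ 2)) → H.{u} (ℵ_ 2)}
    (hi : R i = memRel (H (ℵ_ 2))) (hs : Tm S s) (ht : Tm S t) :
    Dfn R S fun v => IsFiltration (s v) (t v) := by
  refine Dfn.comp₂ (Q := IsFiltration) hi ?_ hs ht
  unfold IsFiltration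
  repeat' first
    | exact Tm.var _ | apply Dfn.isEnumerable hi | apply Dfn.not | apply Dfn.and | apply Dfn.iff
    | apply Dfn.mem hi | apply Dfn.subset hi | apply Dfn.eq hi | apply Dfn.imp | apply Dfn.all
    | apply Dfn.ex

/-- The range of an approaching chain for `U` is such a family; it need not belong to `U`. -/
theorem exists_isFiltration (hU : U ∈ E1 r) :
    ∃ F, IsFiltration F ⟨U, mem_H_of_mem_E2 (Or.inr hU)⟩ := by
  obtain ⟨-, -, P, hP, h⟩ := id hU
  have hPU : ∀ ξ < ω₁, P ξ ⊆ U := fun ξ hξ x hx => (h x).2 ⟨ξ, hξ, hx⟩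
  have hPmem : ∀ ξ < ω₁, P ξ ∈ U := fun ξ hξ =>
    hPU _ (add_one_lt_omega_one hξ) (hP.mem _ _ (Order.lt_succ ξ) (add_one_lt_omega_one hξ))
  have hPH : ∀ ξ < ω₁, P ξ ∈ H (ℵ_ 2) := fun ξ hξ => mem_H_of_mem_E2 (Or.inl (hP.mem_E0 ξ hξ))
  refine ⟨⟨_, range_Iio_mem_H hPH⟩, fun p hp => ?_, fun x hx => ?_, fun G W hG hne hW hWU => ?_⟩
  · obtain ⟨⟨ξ, hξ⟩, hp⟩ := ZFSet.mem_range.1 hp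
    rw [← hp]
    refine ⟨hPmem ξ hξ, isEnumerable_of_countable isRegular_aleph_two aleph0_lt_aleph_two ?_⟩
    rw [← hp]
    exact countable_of_mem_E0 (hP.mem_E0 ξ hξ)
  · obtain ⟨ξ, hξ, hx⟩ := (h x).1 hx
    exact ⟨⟨_, hPH ξ hξ⟩, ZFSet.mem_range_self (⟨ξ, hξ⟩ : Set.Iio (ω₁ : Ordinal.{u})), hx⟩
  · have hGP : ∀ p ∈ (G : ZFSet.{u}), ∃ ξ < ω₁, P ξ = p := fun p hp => by
      obtain ⟨⟨ξ, hξ⟩, hp⟩ := ZFSet.mem_range.1 (hG hp)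
      exact ⟨ξ, hξ, hp⟩
    have hGW : ∀ p ∈ (G : ZFSet.{u}), p ⊆ W := fun p hp x hx =>
      (hW ⟨x, mem_H_of_mem (mem_H_of_mem G.2 hp) hx⟩).2 ⟨⟨p, mem_H_of_mem G.2 hp⟩, hp, hx⟩
    have hmem : ∀ x ∈ (W : ZFSet.{u}), ∃ p ∈ (G : ZFSet.{u}), x ∈ p := fun x hx => by
      obtain ⟨p, hp, hxp⟩ := (hW ⟨x, mem_H_of_mem W.2 hx⟩).1 hx
      exact ⟨p, hp, hxp⟩
    -- If `G` were unbounded in the chain, its union `W` would be all of `U`.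
    have hbdd : ∃ η, η < ω₁ ∧ ∀ p ∈ (G : ZFSet.{u}), p ⊆ P η := by
      by_contra! hcon
      refine hWU (Subtype.ext (ZFSet.ext fun x => ⟨fun hx => ?_, fun hx => ?_⟩))
      · obtain ⟨p, hp, hxp⟩ := hmem x hx
        obtain ⟨ξ, hξ, rfl⟩ := hGP p hp
        exact hPU ξ hξ hxp
      · obtain ⟨η, hη, hxη⟩ := (h x).1 hx
        obtain ⟨p, hp, hpη⟩ := hcon η hη
        obtain ⟨ξ, hξ, rfl⟩ := hGP p hp
        rcases le_total ξ η with h' | h'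
        · exact absurd (hP.mono h' hη) hpη
        · exact hGW _ hp (hP.mono h' hξ hxη)
    -- For the least bound `η` the union of `G` is exactly `P η`; continuity of the chain is needed
    -- when `η` is a limit.
    obtain ⟨η, ⟨hη, hGη⟩, hmin⟩ := WellFounded.has_min (wellFounded_lt (α := Ordinal.{u}))
      {η | η < ω₁ ∧ ∀ p ∈ (G : ZFSet.{u}), p ⊆ P η} hbdd
    have hlt : ∀ ζ < η, ∃ ξ, ζ < ξ ∧ ξ < ω₁ ∧ P ξ ∈ (G : ZFSet.{u}) := by
      intro ζ hζ
      by_contra! hcon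
      refine hmin ζ ⟨hζ.trans hη, fun p hp => ?_⟩ hζ
      obtain ⟨ξ, hξ, rfl⟩ := hGP p hp
      exact hP.mono (le_of_not_gt fun h' => hcon ξ h' hξ hp) (hζ.trans hη)
    suffices P η ⊆ W by
      refine ZFSet.mem_range.2 ⟨⟨η, hη⟩, subset_antisymm this fun x hx => ?_⟩
      obtain ⟨p, hp, hxp⟩ := hmem x hx
      exact hGη p hp hxp
    rcases zero_or_succ_or_isSuccLimit η with rfl | ⟨ζ, rfl⟩ | hlim
    · obtain ⟨p, hp⟩ := hne
      obtain ⟨ξ, hξ, h'⟩ := hGP p hp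
      exact fun x hx => hGW p hp (h' ▸ hP.mono zero_le hξ hx)
    · obtain ⟨ξ, hξ, hξ', hG'⟩ := hlt ζ (Order.lt_succ ζ)
      exact fun x hx => hGW _ hG' (hP.mono (Order.succ_le_of_lt hξ) hξ' hx)
    · intro x hx
      obtain ⟨ζ, hζ, hxζ⟩ := (hP.continuous η hη hlim x).1 hx
      obtain ⟨ξ, hξ, hξ', hG'⟩ := hlt ζ hζ
      exact hGW _ hG' (hP.mono hξ.le hξ' hxζ)

/-- If `U` belongs to the countable model `C`, then `U ∩ C` belongs to `U`. -/
theorem inter_mem_of_mem_E1 (hU : U ∈ E1 r) (hC : C ∈ E0 r) (h : U ∈ C) : U ∩ C ∈ U := by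
  have hi : (![memRel (H (ℵ_ 2)), r] : Fin 2 → _ → _ → Prop) 0 = memRel (H (ℵ_ 2)) := rfl
  have hUH := mem_H_of_mem_E2 (Or.inr hU)
  obtain ⟨F, hFC, hF₁, hF₂, hF₃⟩ := hC.1.exists_mem (Q := fun F => IsFiltration F ⟨U, hUH⟩)
    (Dfn.isFiltration hi (Tm.var 0) (Tm.param (⟨U, hUH⟩ : H (ℵ_ 2)) h)) (exists_isFiltration hU)
  have hsub : U ∩ C ⊆ U := fun x hx => (ZFSet.mem_inter.1 hx).1
  have key : ∀ x ∈ U ∩ C, ∃ p : H.{u} (ℵ_ 2), (p : ZFSet.{u}) ∈ (F : ZFSet.{u}) ∩ C ∧ x ∈ (p : ZFSet.{u}) := by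
    intro x hx
    obtain ⟨hxU, hxC⟩ := ZFSet.mem_inter.1 hx
    have hxH := hC.1.subset hxC
    obtain ⟨p, hpC, hpF, hxp⟩ := hC.1.exists_mem
      (Q := fun p => (p : ZFSet.{u}) ∈ (F : ZFSet.{u}) ∧ x ∈ (p : ZFSet.{u}))
      ((Dfn.mem hi (Tm.var 0) (Tm.param F hFC)).and (Dfn.mem hi (Tm.param ⟨x, hxH⟩ hxC) (Tm.var 0)))
      (hF₂ ⟨x, hxH⟩ hxU)
    exact ⟨p, ZFSet.mem_inter.2 ⟨hpF, hpC⟩, hxp⟩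
  have hFCsub : (F : ZFSet.{u}) ∩ C ⊆ F := fun x hx => (ZFSet.mem_inter.1 hx).1
  -- `U ∩ C` is the union of `F ∩ C`: elementarity of `C` gives one inclusion, and countability of
  -- the members of `F` the other. It is countable, hence different from `U`, so the filtration is
  -- closed under this union.
  refine (hF₁ ⟨_, mem_H_of_subset hUH hsub⟩ (hF₃ ⟨_, mem_H_of_subset F.2 hFCsub⟩ _ hFCsub ?_ ?_ ?_)).1
  · have : ∅ ∈ U ∩ C := ZFSet.mem_inter.2 ⟨hU.1.empty_mem, hC.1.empty_mem⟩
    exact (key ∅ this).imp fun p hp => hp.1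
  · refine fun x => ⟨fun hx => key x hx, ?_⟩
    rintro ⟨p, hp, hxp⟩
    obtain ⟨hpF, hpC⟩ := ZFSet.mem_inter.1 hp
    obtain ⟨hpU, hp'⟩ := hF₁ p hpF
    exact ZFSet.mem_inter.2 ⟨subset_of_mem_E1 hU hpU hxp, hC.1.subset_of_isEnumerable hpC hp' hxp⟩
  · intro h'
    refine not_countable_of_mem_E1 hU ((countable_of_mem_E0 hC).mono fun x hx => ?_)
    have e : U ∩ C = U := congr_arg Subtype.val h'
    have hx' : x ∈ U ∩ C := by rw [e]; exact hx
    exact (ZFSet.mem_inter.1 hx').2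

theorem inter_mem_E0 [IsWellOrder _ r] (hM : M ∈ E2 r) (hC : C ∈ E0 r) : M ∩ C ∈ E0 r :=
  mem_E0_iff.2 ⟨(isModel_of_mem_E2 hM).inter hC.1,
    (countable_of_mem_E0 hC).mono fun _ hx => (ZFSet.mem_inter.1 hx).2⟩

end Models

/-! ## Internally approachable models closed under a given function -/

section Stationarity

/-- The elements from which the `η`-th model of a chain starting as `P` is to be generated. -/
def chainGenerators (A : Set (H.{u} (ℵ_ 2))) (P : Ordinal.{u} → ZFSet.{u}) (η : Ordinal.{u}) :
    Set (H.{u} (ℵ_ 2)) :=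
  A ∪ {x | ∃ ξ < η, (x : ZFSet.{u}) ∈ P ξ ∨ (x : ZFSet.{u}) = P ξ ∨ (x : ZFSet.{u}) = seqBelow P ξ}

theorem seqBelow_congr {P P' : Ordinal.{u} → ZFSet.{u}} {η : Ordinal.{u}}
    (h : ∀ ξ < η, P ξ = P' ξ) : seqBelow P η = seqBelow P' η := by
  unfold seqBelow
  congr 1
  funext ξ
  rw [h ξ ξ.2]

theorem chainGenerators_congr {A : Set (H.{u} (ℵ_ 2))} {P P' : Ordinal.{u} → ZFSet.{u}}
    {η : Ordinal.{u}} (h : ∀ ξ < η, P ξ = P' ξ) :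
    chainGenerators A P η = chainGenerators A P' η := by
  unfold chainGenerators
  congr 1
  ext x
  refine exists_congr fun ξ => and_congr_right fun hξ => ?_
  rw [h ξ hξ, seqBelow_congr fun ζ hζ => h ζ (hζ.trans hξ)]

theorem chainGenerators_mono (A : Set (H.{u} (ℵ_ 2))) (P : Ordinal.{u} → ZFSet.{u}) :
    Monotone (chainGenerators A P) := fun _ _ h =>
  Set.union_subset_union_right _ fun _ ⟨ξ, hξ, hx⟩ => ⟨ξ, hξ.trans_le h, hx⟩

/-- By well-founded recursion: the generators at `η` depend only on values below `η`, so the default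
`∅` used elsewhere is never read. -/
theorem exists_chain (A : Set (H.{u} (ℵ_ 2))) (hull : Set (H.{u} (ℵ_ 2)) → ZFSet.{u}) :
    ∃ P : Ordinal.{u} → ZFSet.{u}, ∀ η, P η = hull (chainGenerators A P η) := by
  classical
  let P : Ordinal.{u} → ZFSet.{u} := (wellFounded_lt (α := Ordinal.{u})).fix fun η g =>
    hull (chainGenerators A (fun ξ => if h : ξ < η then g ξ h else ∅) η)
  refine ⟨P, fun η => ?_⟩
  change WellFounded.fix _ _ η = _
  rw [WellFounded.fix_eq]
  refine congr_arg hull (chainGenerators_congr fun ξ hξ => ?_)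
  rw [dif_pos hξ]

theorem seqBelow_mem_H {P : Ordinal.{u} → ZFSet.{u}} {η : Ordinal.{u}} (hη : η < ω₁)
    (hP : ∀ ξ < η, P ξ ∈ H (ℵ_ 2)) : seqBelow P η ∈ H (ℵ_ 2) := by
  have hκ := isRegular_aleph_two.{u}
  have hsing : ∀ {x}, x ∈ H.{u} (ℵ_ 2) → {x} ∈ H.{u} (ℵ_ 2) := fun {x} hx => by
    rw [← insert_empty_eq]
    exact insert_mem_H hκ hx (empty_mem_H hκ)
  refine mem_H_of_countable hκ aleph0_lt_aleph_two (fun x hx => ?_) ?_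
  · obtain ⟨⟨ξ, hξ⟩, rfl⟩ := ZFSet.mem_range.1 hx
    have h₁ := toZFSet_mem_H ((hξ.trans hη).trans omega_one_lt_omega_two)
    exact insert_mem_H hκ (hsing h₁) (hsing (insert_mem_H hκ h₁ (hsing (hP ξ hξ))))
  · have := (countable_Iio_of_lt_omega_one hη).to_subtype
    rw [seqBelow, ZFSet.coe_range]
    exact Set.countable_range _

/-- Iterate the hull `ω₁` times, feeding in all earlier models and sequences. The union is
approached by these hulls, and finitary closure under `F` passes to it. This supplies the models
used to preserve `ω₂`. -/
theorem exists_mem_E1 (r : H.{u} (ℵ_ 2) → H.{u} (ℵ_ 2) → Prop) {A : Set (H.{u} (ℵ_ 2))}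
    (hA : A.Countable) (F : List (H.{u} (ℵ_ 2)) → H.{u} (ℵ_ 2)) :
    ∃ U ∈ E1 r, (∀ a : H.{u} (ℵ_ 2), a ∈ A → (a : ZFSet.{u}) ∈ U) ∧
      ∀ l : List (H.{u} (ℵ_ 2)), (∀ a ∈ l, (a : ZFSet.{u}) ∈ U) → (F l : ZFSet.{u}) ∈ U := by
  obtain ⟨hull, hmod, hbase, hcount, hF, hdir⟩ :=
    exists_hull isRegular_aleph_two ![memRel (H (ℵ_ 2)), r] F
  obtain ⟨P, hP⟩ := exists_chain A hull
  have hmodel : ∀ η, IsModel r (P η) := fun η => by rw [hP]; exact hmod _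
  have hgen : ∀ {η} {x : H.{u} (ℵ_ 2)}, x ∈ chainGenerators A P η → (x : ZFSet.{u}) ∈ P η :=
    fun {η x} h => by rw [hP]; exact hbase _ x h
  have hE0 : ∀ η < ω₁, P η ∈ E0 r := by
    intro η
    induction η using WellFoundedLT.induction with
    | ind η ih =>
      intro hη
      refine mem_E0_iff.2 ⟨hmodel η, ?_⟩
      rw [hP]
      refine hcount _ (hA.union ?_)
      have : {x : H.{u} (ℵ_ 2) | ∃ ξ < η, (x : ZFSet.{u}) ∈ P ξ ∨ (x : ZFSet.{u}) = P ξ ∨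
          (x : ZFSet.{u}) = seqBelow P ξ} ⊆ ((↑) : H.{u} (ℵ_ 2) → ZFSet.{u}) ⁻¹'
          ⋃ ξ ∈ Set.Iio η, (P ξ : Set ZFSet.{u}) ∪ {P ξ, seqBelow P ξ} := by
        rintro x ⟨ξ, hξ, hx⟩
        exact Set.mem_biUnion hξ hx
      refine Set.Countable.mono this (Set.Countable.preimage_of_injOn ?_ Subtype.val_injective.injOn)
      exact (countable_Iio_of_lt_omega_one hη).biUnion fun ξ hξ =>
        (countable_of_mem_E0 (ih ξ hξ (hξ.trans hη))).union (Set.to_countable _)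
  have hPH : ∀ η < ω₁, P η ∈ H (ℵ_ 2) := fun η hη => mem_H_of_mem_E2 (Or.inl (hE0 η hη))
  have hsub : ∀ ξ η, ξ < η → P ξ ⊆ P η := fun ξ η h x hx =>
    hgen (x := ⟨x, (hmodel ξ).subset hx⟩) (Or.inr ⟨ξ, h, Or.inl hx⟩)
  have hmono : ∀ ξ η, ξ ≤ η → P ξ ⊆ P η := fun ξ η h => by
    rcases h.eq_or_lt with rfl | h
    · exact fun _ => id
    · exact hsub ξ η h
  have hchain : IsApproachingChain r P := by
    refine ⟨hE0, fun ξ η h _ => hsub ξ η h, fun ξ η h hη => ?_, fun η hη hlim x => ⟨fun hx => ?_, ?_⟩,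
      fun η hη => ?_⟩
    · exact hgen (x := ⟨P ξ, hPH ξ (h.trans hη)⟩) (Or.inr ⟨ξ, h, Or.inr (Or.inl rfl)⟩)
    -- At a limit the generators are the directed union of the earlier generators, and the hull is
    -- finitary; this yields continuity.
    · have hunion : chainGenerators A P η = ⋃₀ (chainGenerators A P '' Set.Iio η) := by
        refine subset_antisymm ?_ (Set.sUnion_subset ?_)
        · rintro x (hx | ⟨ξ, hξ, hx⟩)
          · exact ⟨_, ⟨0, hlim.bot_lt, rfl⟩, Or.inl hx⟩
          · exact ⟨_, ⟨_, hlim.succ_lt hξ, rfl⟩, Or.inr ⟨ξ, Order.lt_succ ξ, hx⟩⟩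
        · rintro _ ⟨ξ, hξ, rfl⟩
          exact chainGenerators_mono A P hξ.le
      rw [hP, hunion] at hx
      obtain ⟨_, ⟨ξ, hξ, rfl⟩, hx⟩ := hdir (chainGenerators A P '' Set.Iio η) ⟨_, 0, hlim.bot_lt, rfl⟩ (by
        rintro _ ⟨ξ, hξ, rfl⟩ _ ⟨ζ, hζ, rfl⟩
        exact ⟨_, ⟨max ξ ζ, Set.mem_Iio.2 (max_lt hξ hζ), rfl⟩, chainGenerators_mono A P (le_max_left _ _),
          chainGenerators_mono A P (le_max_right _ _)⟩) x hx
      rw [← hP] at hx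
      exact ⟨ξ, hξ, hx⟩
    · rintro ⟨ξ, hξ, hx⟩
      exact hsub ξ η hξ hx
    -- The generators at `η + 1` include `seqBelow P ξ` for every `ξ < η + 1`, in particular for `ξ
    -- = η`.
    · exact hgen (x := ⟨_, seqBelow_mem_H hη fun ξ hξ => hPH ξ (hξ.trans hη)⟩)
        (Or.inr ⟨η, Order.lt_succ η, Or.inr (Or.inr rfl)⟩)
  let U : ZFSet.{u} := ZFSet.sep (fun x => ∃ ξ < ω₁, x ∈ P ξ) (H (ℵ_ 2))
  have hU : ∀ x, x ∈ U ↔ ∃ ξ < ω₁, x ∈ P ξ := fun x =>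
    ZFSet.mem_sep.trans (and_iff_right_of_imp fun ⟨ξ, _, hx⟩ => (hmodel ξ).subset hx)
  have hω : (0 : Ordinal.{u}) < ω₁ := omega_pos 1
  refine ⟨U, ⟨?_, ?_, P, hchain, hU⟩, fun a ha => (hU a).2 ⟨0, hω, hgen (Or.inl ha)⟩, fun l hl => ?_⟩
  · refine isElementarySubmodel_of_directed (𝓒 := P '' Set.Iio ω₁) ?_ ⟨_, 0, hω, rfl⟩ ?_ ?_
    · rintro _ ⟨ξ, hξ, rfl⟩
      exact hmodel ξ
    · rintro _ ⟨ξ, hξ, rfl⟩ _ ⟨ζ, hζ, rfl⟩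
      exact ⟨_, ⟨max ξ ζ, Set.mem_Iio.2 (max_lt hξ hζ), rfl⟩, hmono _ _ (le_max_left _ _), hmono _ _ (le_max_right _ _)⟩
    · intro x
      rw [hU]
      exact ⟨fun ⟨ξ, hξ, hx⟩ => ⟨_, ⟨ξ, hξ, rfl⟩, hx⟩, fun ⟨_, ⟨ξ, hξ, rfl⟩, hx⟩ => ⟨ξ, hξ, hx⟩⟩
  · refine le_antisymm ?_ ?_
    · rw [← Cardinal.lift_le.{u + 1}, ← ZFSet.cardinalMk_coe_sort]
      have h : (U : Set ZFSet.{u}) = ⋃ ξ : Set.Iio (ω₁ : Ordinal.{u}), (P ξ : Set ZFSet.{u}) := by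
        ext x
        simp [hU]
      change #(U : Set ZFSet.{u}) ≤ _
      rw [h]
      refine (mk_iUnion_le _).trans ?_
      rw [Cardinal.mk_Iio_ordinal, card_omega, Cardinal.lift_aleph]
      refine mul_le_of_le (aleph0_le_aleph _) le_rfl (ciSup_le' fun ξ => ?_)
      exact (Cardinal.le_aleph0_iff_set_countable.2 (countable_of_mem_E0 (hE0 ξ ξ.2))).trans
        (aleph0_le_aleph _)
    · rw [aleph_one_le_iff]
      by_contra! h
      exact hchain.not_countable hU (countable_iff_card_le.2 h)
  · obtain ⟨η, hη, hl'⟩ := hchain.exists_subset (A := {x | ∃ a ∈ l, (a : ZFSet.{u}) = x})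
      ((List.finite_toSet l).image _).countable (by
        rintro _ ⟨a, ha, rfl⟩
        exact (hU a).1 (hl a ha))
    refine (hU _).2 ⟨η, hη, ?_⟩
    have := hF (chainGenerators A P η) l fun a ha => by
      rw [← hP]; exact hl' _ ⟨a, ha, rfl⟩
    rwa [← hP] at this

end Stationarity

/-! ## Finite `∈`-chains -/

section Chains

/-- `A` comes before `B`, as witnessed by an element of `p`. -/
def Prec (p A B : ZFSet.{u}) : Prop := ∃ Z ∈ p, A.rank ≤ Z.rank ∧ Z ∈ B

variable {p q A B : ZFSet.{u}}

theorem Prec.rank_lt (h : Prec p A B) : A.rank < B.rank := by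
  obtain ⟨Z, _, hZ, hZB⟩ := h
  exact hZ.trans_lt (ZFSet.rank_lt_of_mem hZB)

theorem Prec.mono (h : Prec p A B) (hpq : p ⊆ q) : Prec q A B := by
  obtain ⟨Z, hZ, hZ'⟩ := h
  exact ⟨Z, hpq hZ, hZ'⟩

theorem pairwise_rank_lt {l : List ZFSet.{u}} (hl : l.IsChain (· ∈ ·)) :
    l.Pairwise fun x y => x.rank < y.rank := by
  have : IsTrans ZFSet.{u} fun x y => x.rank < y.rank := ⟨fun _ _ _ => lt_trans⟩
  exact List.isChain_iff_pairwise.1 (hl.imp fun _ _ => ZFSet.rank_lt_of_mem)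

/-- Membership need not be transitive along the chain, so `A ∈ B` may fail; the immediate
predecessor of `B` is always a witness. -/
theorem exists_mem_of_isChain {l : List ZFSet.{u}} (hl : l.IsChain (· ∈ ·)) (hA : A ∈ l) (hB : B ∈ l)
    (h : A.rank < B.rank) : ∃ Z ∈ l, A.rank ≤ Z.rank ∧ Z ∈ B := by
  have hpw := pairwise_rank_lt hl
  induction l generalizing A with
  | nil => simp at hA
  | cons a l ih =>
    rw [List.pairwise_cons] at hpw
    have hBl : B ∈ l := by
      refine (List.mem_cons.1 hB).resolve_left ?_
      rintro rfl
      rcases List.mem_cons.1 hA with rfl | hA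
      · exact lt_irrefl _ h
      · exact (hpw.1 A hA).asymm h
    rcases List.mem_cons.1 hA with rfl | hA
    · cases l with
      | nil => simp at hBl
      | cons b l =>
        rw [List.isChain_cons_cons] at hl
        rcases List.mem_cons.1 hBl with rfl | hBl'
        · exact ⟨A, by simp, le_rfl, hl.1⟩
        · obtain ⟨Z, hZ, hbZ, hZB⟩ := ih hl.2 List.mem_cons_self hBl
            ((List.pairwise_cons.1 hpw.2).1 B hBl') hpw.2
          exact ⟨Z, List.mem_cons_of_mem _ hZ, (hpw.1 b List.mem_cons_self).le.trans hbZ, hZB⟩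
    · obtain ⟨Z, hZ, h'⟩ := ih hl.tail hA hBl h hpw.2
      exact ⟨Z, List.mem_cons_of_mem _ hZ, h'⟩

/-- Remove the element `a` of least rank. Witnesses between the remaining elements have larger rank
than `a`, so the hypothesis survives and induction applies. -/
theorem exists_isChain_list {s : Set ZFSet.{u}} (hs : s.Finite)
    (h : ∀ A ∈ s, ∀ B ∈ s, A ≠ B →
      (∃ Z ∈ s, A.rank ≤ Z.rank ∧ Z ∈ B) ∨ ∃ Z ∈ s, B.rank ≤ Z.rank ∧ Z ∈ A) :
    ∃ l : List ZFSet.{u}, l.IsChain (· ∈ ·) ∧ ∀ x, x ∈ s ↔ x ∈ l := by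
  obtain ⟨k, hk⟩ : ∃ k, s.ncard = k := ⟨_, rfl⟩
  induction k generalizing s with
  | zero =>
    rw [Set.ncard_eq_zero hs] at hk
    exact ⟨[], List.isChain_nil, by simp [hk]⟩
  | succ k ih =>
    have hne : s.Nonempty := Set.nonempty_of_ncard_ne_zero (by omega)
    obtain ⟨a, ha, hmin⟩ := Set.exists_min_image s ZFSet.rank hs hne
    have hlt : ∀ B ∈ s, B ≠ a → a.rank < B.rank := by
      intro B hB hBa
      obtain ⟨Z, hZ, _, hZa⟩ | ⟨Z, hZ, hZ', hZB⟩ := h B hB a ha hBa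
      · exact absurd (hmin Z hZ) (ZFSet.rank_lt_of_mem hZa).not_ge
      · exact hZ'.trans_lt (ZFSet.rank_lt_of_mem hZB)
    have hrest : ∀ A ∈ s \ {a}, ∀ B : ZFSet.{u}, (∃ Z ∈ s, A.rank ≤ Z.rank ∧ Z ∈ B) →
        ∃ Z ∈ s \ {a}, A.rank ≤ Z.rank ∧ Z ∈ B := by
      rintro A hA B ⟨Z, hZ, hZ', hZB⟩
      refine ⟨Z, ⟨hZ, ?_⟩, hZ', hZB⟩
      rintro rfl
      exact (hlt A hA.1 hA.2).not_ge hZ'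
    obtain ⟨l, hl, hmem⟩ := ih (s := s \ {a}) hs.sdiff
      (fun A hA B hB hAB => (h A hA.1 B hB.1 hAB).imp (hrest A hA B) (hrest B hB A))
      (by rw [Set.ncard_sdiff_singleton_of_mem ha, hk]; rfl)
    refine ⟨a :: l, ?_, fun x => ?_⟩
    · cases l with
      | nil => simp
      | cons b l =>
        refine List.isChain_cons_cons.2 ⟨?_, hl⟩
        obtain ⟨hb, hba⟩ := (hmem b).2 List.mem_cons_self
        rcases h b hb a ha hba with ⟨Z, hZ, _, hZa⟩ | ⟨Z, hZ, _, hZb⟩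
        · exact absurd (hmin Z hZ) (ZFSet.rank_lt_of_mem hZa).not_ge
        · by_cases hZa : Z = a
          · exact hZa ▸ hZb
          -- A witness other than `a` would belong to `b :: l` yet have smaller rank than its head
          -- `b`.
          · exfalso
            obtain ⟨W, hW, hW', hWZ⟩ | ⟨W, hW, hW', hWb⟩ := h b hb Z hZ (by
              rintro rfl
              exact ZFSet.mem_irrefl _ hZb)
            · exact (hW'.trans_lt (ZFSet.rank_lt_of_mem hWZ)).asymm (ZFSet.rank_lt_of_mem hZb)
            · have hpw := pairwise_rank_lt hl
              rcases List.mem_cons.1 ((hmem Z).1 ⟨hZ, hZa⟩) with rfl | hZl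
              · exact ZFSet.mem_irrefl _ hZb
              · exact ((List.pairwise_cons.1 hpw).1 Z hZl).asymm (ZFSet.rank_lt_of_mem hZb)
    · rw [List.mem_cons, ← hmem]
      by_cases hx : x = a
      · simp [hx, ha]
      · simp [hx]

/-- This form without lists asks only for finiteness and pairwise comparability, which can be
checked by cases when side conditions are enlarged. -/
theorem isFiniteMemChain_iff : IsFiniteMemChain p ↔ (p : Set ZFSet.{u}).Finite ∧
    ∀ A ∈ p, ∀ B ∈ p, A ≠ B → Prec p A B ∨ Prec p B A := by
  constructor
  · rintro ⟨l, hl, hmem⟩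
    refine ⟨(List.finite_toSet l).subset fun x hx => (hmem x).1 hx, fun A hA B hB hAB => ?_⟩
    have hne : A.rank ≠ B.rank := by
      have : l.Pairwise fun x y => x.rank ≠ y.rank :=
        (pairwise_rank_lt hl).imp fun h => h.ne
      have : Std.Symm fun x y : ZFSet.{u} => x.rank ≠ y.rank := ⟨fun _ _ h => h.symm⟩
      exact List.Pairwise.forall ‹_› ((hmem A).1 hA) ((hmem B).1 hB) hAB
    have key : ∀ {A B}, A ∈ p → B ∈ p → A.rank < B.rank → Prec p A B := by
      intro A B hA hB h
      obtain ⟨Z, hZ, h'⟩ := exists_mem_of_isChain hl ((hmem A).1 hA) ((hmem B).1 hB) h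
      exact ⟨Z, (hmem Z).2 hZ, h'⟩
    exact hne.lt_or_gt.imp (key hA hB) (key hB hA)
  · rintro ⟨hfin, h⟩
    exact exists_isChain_list hfin h

end Chains

/-! ## Side conditions -/

section SideCondition

variable {r : H.{u} (ℵ_ 2) → H.{u} (ℵ_ 2) → Prop} {p q M A B C D K U X : ZFSet.{u}}

namespace IsSideCondition

theorem finite (hp : IsSideCondition r p) : (p : Set ZFSet.{u}).Finite :=
  (isFiniteMemChain_iff.1 hp.chain).1

theorem eq_of_rank_eq (hp : IsSideCondition r p) (hA : A ∈ p) (hB : B ∈ p)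
    (h : A.rank = B.rank) : A = B := by
  by_contra hne
  rcases (isFiniteMemChain_iff.1 hp.chain).2 A hA B hB hne with h' | h'
  · exact h'.rank_lt.ne h
  · exact h'.rank_lt.ne' h

theorem prec (hp : IsSideCondition r p) (hA : A ∈ p) (hB : B ∈ p) (h : A.rank < B.rank) :
    Prec p A B :=
  ((isFiniteMemChain_iff.1 hp.chain).2 A hA B hB fun h' => h.ne (congr_arg _ h')).resolve_right
    fun h' => h'.rank_lt.asymm h

/-- Every element of `p` of smaller rank belongs to an uncountable model in `p`. -/
theorem mem_of_rank_lt (hp : IsSideCondition r p) (hX : X ∈ p) (hU : U ∈ p) (hU₁ : U ∈ E1 r)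
    (h : X.rank < U.rank) : X ∈ U := by
  -- Take the lowest member of `p ∩ U` at or above `X`. If it is not `X`, one of its own elements is
  -- a lower candidate, since `U` is transitive.
  obtain ⟨Z, ⟨hZ, hXZ, hZU⟩, hmin⟩ := (InvImage.wf ZFSet.rank wellFounded_lt).has_min
    {Z | Z ∈ p ∧ X.rank ≤ Z.rank ∧ Z ∈ U} (hp.prec hX hU h)
  rcases hXZ.eq_or_lt with h' | h'
  · exact hp.eq_of_rank_eq hX hZ h' ▸ hZU
  · obtain ⟨W, hW, hXW, hWZ⟩ := hp.prec hX hZ h'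
    exact absurd (ZFSet.rank_lt_of_mem hWZ) (hmin W ⟨hW, hXW, subset_of_mem_E1 hU₁ hZU hWZ⟩)

/-- An element `D` of `p` below a countable model `C ∈ p` which does not belong to `C` lies in an
interval `[N ∩ C, N)` for some uncountable model `N ∈ p ∩ C`. -/
theorem exists_interval (hp : IsSideCondition r p) (hC : C ∈ p) (hC₀ : C ∈ E0 r) (hD : D ∈ p)
    (h : D.rank < C.rank) (hDC : D ∉ C) :
    ∃ N ∈ p, N ∈ C ∧ N ∈ E1 r ∧ (N ∩ C).rank ≤ D.rank ∧ D ∈ N := by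
  -- `N` is the lowest member of `p ∩ C` at or above `D`.
  obtain ⟨N, ⟨hN, hDN, hNC⟩, hmin⟩ := (InvImage.wf ZFSet.rank wellFounded_lt).has_min
    {Z | Z ∈ p ∧ D.rank ≤ Z.rank ∧ Z ∈ C} (hp.prec hD hC h)
  have hlt : D.rank < N.rank := hDN.lt_of_ne fun h' => hDC (hp.eq_of_rank_eq hD hN h' ▸ hNC)
  -- A countable `N ∈ C` would satisfy `N ⊆ C`, and a member of `p` in `N` at or above `D` would
  -- contradict minimality.
  have hN₁ : N ∈ E1 r := by
    refine (hp.models N hN).resolve_left fun hN₀ => ?_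
    obtain ⟨Z, hZ, hDZ, hZN⟩ := hp.prec hD hN hlt
    exact hmin Z ⟨hZ, hDZ, subset_of_mem_E0 hN₀ (Or.inl hC₀) hNC hZN⟩ (ZFSet.rank_lt_of_mem hZN)
  refine ⟨N, hN, hNC, hN₁, ?_, hp.mem_of_rank_lt hD hN hN₁ hlt⟩
  -- If `D` came before `N ∩ C`, some member of `p` in `N ∩ C` at or above `D` would be lower than
  -- `N`.
  by_contra! hcon
  obtain ⟨Z, hZ, hDZ, hZN⟩ := hp.prec hD (hp.inter N hN C hC) hcon
  obtain ⟨hZN, hZC⟩ := ZFSet.mem_inter.1 hZN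
  exact hmin Z ⟨hZ, hDZ, hZC⟩ (ZFSet.rank_lt_of_mem hZN)

/-- The restriction of a side condition to a model is a side condition. -/
theorem restrict (hp : IsSideCondition r p) (hM : M ∈ E2 r) : IsSideCondition r (p ∩ M) := by
  have hsub : p ∩ M ⊆ p := fun x hx => (ZFSet.mem_inter.1 hx).1
  refine ⟨fun A hA => hp.models A (hsub hA), isFiniteMemChain_iff.2 ⟨hp.finite.subset hsub, ?_⟩,
    fun A hA B hB => ?_⟩
  -- If `B` is countable then `B ⊆ M`, so the old witness lies in `M`; if `B` is uncountable, `A`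
  -- itself is an element of `B`.
  · have key : ∀ A ∈ p ∩ M, ∀ B ∈ p ∩ M, Prec p A B → Prec (p ∩ M) A B := by
      intro A hA B hB h
      rcases hp.models B (hsub hB) with hB₀ | hB₁
      · obtain ⟨Z, hZ, hAZ, hZB⟩ := h
        exact ⟨Z, ZFSet.mem_inter.2
          ⟨hZ, subset_of_mem_E0 hB₀ hM (ZFSet.mem_inter.1 hB).2 hZB⟩, hAZ, hZB⟩
      · exact ⟨A, hA, le_rfl, hp.mem_of_rank_lt (hsub hA) (hsub hB) hB₁ h.rank_lt⟩
    exact fun A hA B hB hAB => ((isFiniteMemChain_iff.1 hp.chain).2 A (hsub hA) B (hsub hB) hAB).imp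
      (key A hA B hB) (key B hB A hA)
  · exact ZFSet.mem_inter.2 ⟨hp.inter A (hsub hA) B (hsub hB), (isModel_of_mem_E2 hM).inter_mem
      (ZFSet.mem_inter.1 hA).2 (ZFSet.mem_inter.1 hB).2⟩

theorem restrict_mem (hp : IsSideCondition r p) (hM : M ∈ E2 r) : p ∩ M ∈ M :=
  (isModel_of_mem_E2 hM).mem_of_finite
    (hp.finite.subset fun _ hx => (ZFSet.mem_inter.1 hx).1) fun _ hx => (ZFSet.mem_inter.1 hx).2

theorem subset_of_mem (hp : IsSideCondition r p) (hM : M ∈ E2 r) (h : p ∈ M) : p ⊆ M :=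
  (isModel_of_mem_E2 hM).subset_of_countable h hp.finite.countable

theorem _root_.SideConditions.isSideCondition_singleton (hM : M ∈ E2 r) : IsSideCondition r {M} := by
  refine ⟨fun A hA => ?_, ⟨[M], by simp, by simp⟩, fun A hA B hB => ?_⟩
  · rwa [ZFSet.mem_singleton.1 hA]
  · rw [ZFSet.mem_singleton.1 hA, ZFSet.mem_singleton.1 hB]
    simp

/-- Amalgamation over an uncountable model. -/
theorem amalgamate_E1 (hp : IsSideCondition r p) (hq : IsSideCondition r q) (hM : M ∈ p)
    (hM₁ : M ∈ E1 r) (hqM : q ⊆ M) (hpq : ∀ A ∈ p, A ∈ M → A ∈ q) : IsSideCondition r (p ∪ q) := by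
  have hmem : ∀ {x}, x ∈ p ∪ q ↔ x ∈ p ∨ x ∈ q := ZFSet.mem_union
  have hp' : p ⊆ p ∪ q := fun x hx => hmem.2 (Or.inl hx)
  have hq' : q ⊆ p ∪ q := fun x hx => hmem.2 (Or.inr hx)
  -- `M` is transitive, so `A ⊆ M` and `B` may be replaced by `M ∩ B`, which is either `M` or a
  -- member of `p ∩ M ⊆ q`.
  have hinter : ∀ A ∈ q, ∀ B ∈ p, A ∩ B ∈ p ∪ q := by
    intro A hA B hB
    have hAM := subset_of_mem_E1 hM₁ (hqM hA)
    have hAB : A ∩ B = A ∩ (M ∩ B) := by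
      ext z
      simp only [ZFSet.mem_inter]
      exact ⟨fun h => ⟨h.1, hAM h.1, h.2⟩, fun h => ⟨h.1, h.2.2⟩⟩
    have hD := hp.inter M hM B hB
    have hle : (M ∩ B).rank ≤ M.rank := ZFSet.rank_mono fun x hx => (ZFSet.mem_inter.1 hx).1
    rw [hAB]
    rcases hle.eq_or_lt with h | h
    · rw [hp.eq_of_rank_eq hD hM h, ZFSet.inter_eq_left_of_subset hAM]
      exact hq' hA
    · exact hq' (hq.inter A hA _ (hpq _ hD (hp.mem_of_rank_lt hD hM hM₁ h)))
  have hchain : ∀ A ∈ q, ∀ B ∈ p, A ≠ B → Prec (p ∪ q) A B ∨ Prec (p ∪ q) B A := by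
    intro A hA B hB hAB
    by_cases hBM : B ∈ M
    · exact ((isFiniteMemChain_iff.1 hq.chain).2 A hA B (hpq B hB hBM) hAB).imp
        (fun h => h.mono hq') fun h => h.mono hq'
    · left
      have hA' := ZFSet.rank_lt_of_mem (hqM hA)
      rcases lt_trichotomy B.rank M.rank with h | h | h
      · exact absurd (hp.mem_of_rank_lt hB hM hM₁ h) hBM
      · rw [hp.eq_of_rank_eq hB hM h]
        exact ⟨A, hq' hA, le_rfl, hqM hA⟩
      · obtain ⟨Z, hZ, hMZ, hZB⟩ := hp.prec hM hB h
        exact ⟨Z, hp' hZ, hA'.le.trans hMZ, hZB⟩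
  refine ⟨fun A hA => (hmem.1 hA).elim (hp.models A) (hq.models A),
    isFiniteMemChain_iff.2 ⟨?_, fun A hA B hB hAB => ?_⟩, fun A hA B hB => ?_⟩
  · rw [ZFSet.coe_union]
    exact hp.finite.union hq.finite
  · rcases hmem.1 hA with hA | hA <;> rcases hmem.1 hB with hB | hB
    · exact ((isFiniteMemChain_iff.1 hp.chain).2 A hA B hB hAB).imp
        (fun h => h.mono hp') fun h => h.mono hp'
    · exact (hchain B hB A hA hAB.symm).symm
    · exact hchain A hA B hB hAB
    · exact ((isFiniteMemChain_iff.1 hq.chain).2 A hA B hB hAB).imp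
        (fun h => h.mono hq') fun h => h.mono hq'
  · rcases hmem.1 hA with hA | hA <;> rcases hmem.1 hB with hB | hB
    · exact hp' (hp.inter A hA B hB)
    · have : A ∩ B = B ∩ A := by ext; simp [and_comm]
      rw [this]
      exact hinter B hB A hA
    · exact hinter A hA B hB
    · exact hq' (hq.inter A hA B hB)

/-- The traces on `A` of countable models of `p` containing `A` form an `∈`-chain. -/
theorem inter_trichotomy [IsWellOrder _ r] (hp : IsSideCondition r p) (hA : A ∈ E1 r) {K' : ZFSet.{u}}
    (hK : K ∈ p) (hK' : K' ∈ p) (hK₀ : K ∈ E0 r) (hK'₀ : K' ∈ E0 r) (hAK : A ∈ K) (hAK' : A ∈ K')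
    (hle : K.rank ≤ K'.rank) :
    A ∩ K = A ∩ K' ∨ A ∩ K ∈ A ∩ K' ∨ A ∩ K' ∈ A ∩ K := by
  obtain ⟨o, ho⟩ : ∃ o, K'.rank = o := ⟨_, rfl⟩
  induction o using WellFoundedLT.induction generalizing K K' with
  | ind o ih =>
    rcases hle.eq_or_lt with h | h
    · rw [hp.eq_of_rank_eq hK hK' h]
      exact Or.inl rfl
    by_cases hmem : K ∈ K'
    · exact Or.inr (Or.inl (ZFSet.mem_inter.2
        ⟨inter_mem_of_mem_E1 hA hK₀ hAK, hK'₀.1.inter_mem hAK' hmem⟩))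
    · obtain ⟨L, hL, hLK', hL₁, hrank, hKL⟩ := hp.exists_interval hK' hK'₀ hK h hmem
      have hAL : A ∈ L := subset_of_mem_E1 hL₁ hKL hAK
      have hAL' : A ⊆ L := subset_of_mem_E1 hL₁ hAL
      have heq : A ∩ K' = A ∩ (L ∩ K') := by
        ext z
        simp only [ZFSet.mem_inter]
        exact ⟨fun h => ⟨h.1, hAL' h.1, h.2⟩, fun h => ⟨h.1, h.2.2⟩⟩
      rw [heq]
      -- The induction is on the rank of the higher model. Replacing `K'` by `L ∩ K'` keeps the
      -- trace on `A ⊆ L`, and now `K` is the higher of the two, so the roles are exchanged.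
      rcases ih _ (ho ▸ h) (hp.inter L hL K' hK') hK (inter_mem_E0 (Or.inr hL₁) hK'₀) hK₀
        (ZFSet.mem_inter.2 ⟨hAL, hAK'⟩) hAK hrank rfl with h | h | h
      · exact Or.inl h.symm
      · exact Or.inr (Or.inr h)
      · exact Or.inr (Or.inl h)

end IsSideCondition

end SideCondition

/-! ## Amalgamation over a countable model -/

section Amalgamation

variable {r : H.{u} (ℵ_ 2) → H.{u} (ℵ_ 2) → Prop}

/-- `p` is a side condition containing the countable model `M`, and `q ⊆ M` is a side condition
extending `p ∩ M`. -/
structure Amalgam (r : H.{u} (ℵ_ 2) → H.{u} (ℵ_ 2) → Prop) (p q M : ZFSet.{u}) : Prop where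
  left : IsSideCondition r p
  right : IsSideCondition r q
  mem : M ∈ p
  mem_E0 : M ∈ E0 r
  subset : q ⊆ M
  mem_right : ∀ A ∈ p, A ∈ M → A ∈ q

/-- `M` or `N ∩ M` for some uncountable model `N ∈ p ∩ M`. -/
def IsTrace (r : H.{u} (ℵ_ 2) → H.{u} (ℵ_ 2) → Prop) (p M T : ZFSet.{u}) : Prop :=
  T = M ∨ ∃ N ∈ p, N ∈ M ∧ N ∈ E1 r ∧ T = N ∩ M

/-- The members of the common extension of `p` and `q`. -/
def InAmalgam (r : H.{u} (ℵ_ 2) → H.{u} (ℵ_ 2) → Prop) (p q M X : ZFSet.{u}) : Prop :=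
  X ∈ q ∨ X ∈ p ∨ ∃ A ∈ q, A ∈ E1 r ∧ ∃ K ∈ p, K ∈ E0 r ∧
    ∃ T, IsTrace r p M T ∧ A ∈ T ∧ T ⊆ K ∧ X = A ∩ K

namespace Amalgam

variable {p q M A B K T X Y : ZFSet.{u}}

theorem trace_mem (h : Amalgam r p q M) (hT : IsTrace r p M T) : T ∈ p := by
  rcases hT with rfl | ⟨N, hN, _, _, rfl⟩
  · exact h.mem
  · exact h.left.inter N hN M h.mem

theorem trace_mem_E0 [IsWellOrder _ r] (h : Amalgam r p q M) (hT : IsTrace r p M T) : T ∈ E0 r := by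
  rcases hT with rfl | ⟨N, _, _, hN, rfl⟩
  · exact h.mem_E0
  · exact inter_mem_E0 (Or.inr hN) h.mem_E0

theorem mem_trace (h : Amalgam r p q M) (hT : IsTrace r p M T) (hAT : A ∈ T)
    (hB : B ∈ q) (hBA : B ∈ A) : B ∈ T := by
  rcases hT with rfl | ⟨N, _, _, hN, rfl⟩
  · exact h.subset hB
  · exact ZFSet.mem_inter.2 ⟨subset_of_mem_E1 hN (ZFSet.mem_inter.1 hAT).1 hBA, h.subset hB⟩

theorem subset_of_countable (h : Amalgam r p q M) (hA : A ∈ q) (hA₀ : A ∈ E0 r) : A ⊆ M :=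
  subset_of_mem_E0 hA₀ (Or.inl h.mem_E0) (h.subset hA)

theorem mem_or_eq_of_rank_le (hq : IsSideCondition r q) (hA : A ∈ q) (hB : B ∈ q) (hB₁ : B ∈ E1 r)
    (hle : A.rank ≤ B.rank) : A = B ∨ A ∈ B :=
  hle.eq_or_lt.imp (hq.eq_of_rank_eq hA hB) (hq.mem_of_rank_lt hA hB hB₁)

/-- As `A ⊆ M`, only `M ∩ B` matters. It is `M`, or belongs to `M` and so to `q`, or equals `N ∩ M`
for some uncountable `N ∈ p ∩ M`; in the last case `A ∩ B = A ∩ N`. -/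
theorem inter_of_countable (h : Amalgam r p q M) (hA : A ∈ q) (hA₀ : A ∈ E0 r) (hB : B ∈ p) :
    A ∩ B ∈ q := by
  have hAM := h.subset_of_countable hA hA₀
  have hAB : A ∩ B = A ∩ (M ∩ B) := by
    ext z
    simp only [ZFSet.mem_inter]
    exact ⟨fun h => ⟨h.1, hAM h.1, h.2⟩, fun h => ⟨h.1, h.2.2⟩⟩
  rw [hAB]
  have hD := h.left.inter M h.mem B hB
  have hDM : M ∩ B ⊆ M := fun x hx => (ZFSet.mem_inter.1 hx).1
  by_cases hmem : M ∩ B ∈ M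
  · exact h.right.inter A hA _ (h.mem_right _ hD hmem)
  rcases (ZFSet.rank_mono hDM).eq_or_lt with hr | hr
  · rw [h.left.eq_of_rank_eq hD h.mem hr, ZFSet.inter_eq_left_of_subset hAM]
    exact hA
  · obtain ⟨N, hN, hNM, hN₁, hle, hDN⟩ := h.left.exists_interval h.mem h.mem_E0 hD hr hmem
    have hsub : M ∩ B ⊆ N ∩ M := fun x hx =>
      ZFSet.mem_inter.2 ⟨subset_of_mem_E1 hN₁ hDN hx, hDM hx⟩
    have heq : M ∩ B = N ∩ M := h.left.eq_of_rank_eq hD (h.left.inter N hN M h.mem)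
      ((ZFSet.rank_mono hsub).antisymm hle)
    have : A ∩ (N ∩ M) = A ∩ N := by
      ext z
      simp only [ZFSet.mem_inter]
      exact ⟨fun h => ⟨h.1, h.2.1⟩, fun h => ⟨h.1, h.2, hAM h.1⟩⟩
    rw [heq, this]
    exact h.right.inter A hA N (h.mem_right N hN hNM)

/-- The position of an element of `p` outside `M` relative to an uncountable `A ∈ q`. -/
theorem exists_trace_or (h : Amalgam r p q M) (hA : A ∈ q) (hA₁ : A ∈ E1 r) (hB : B ∈ p)
    (hBM : B ∉ M) : (∃ T, IsTrace r p M T ∧ A ∈ T ∧ T.rank ≤ B.rank) ∨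
      ∃ N ∈ p, N ∈ M ∧ N ∈ E1 r ∧ B ∈ N ∧ (N = A ∨ N ∈ A) := by
  rcases le_or_gt M.rank B.rank with hr | hr
  · exact Or.inl ⟨M, Or.inl rfl, h.subset hA, hr⟩
  · obtain ⟨N, hN, hNM, hN₁, hle, hBN⟩ := h.left.exists_interval h.mem h.mem_E0 hB hr hBM
    have hNq := h.mem_right N hN hNM
    rcases le_or_gt N.rank A.rank with hr' | hr'
    · exact Or.inr ⟨N, hN, hNM, hN₁, hBN, mem_or_eq_of_rank_le h.right hNq hA hA₁ hr'⟩
    · exact Or.inl ⟨N ∩ M, Or.inr ⟨N, hN, hNM, hN₁, rfl⟩, ZFSet.mem_inter.2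
        ⟨h.right.mem_of_rank_lt hA hNq hN₁ hr', h.subset hA⟩, hle⟩

/-- One model includes the other unless `B ∈ M`. A trace containing `A` at or below `B` is an
element of `B`, being countable while `B` is not, so `A ⊆ B`. In the remaining case `B ∈ A`, and so
`B ⊆ A`. -/
theorem inter_of_uncountable (h : Amalgam r p q M) (hA : A ∈ q) (hA₁ : A ∈ E1 r) (hB : B ∈ p)
    (hB₁ : B ∈ E1 r) [IsWellOrder _ r] : A ∩ B ∈ q ∨ A ∩ B ∈ p := by
  by_cases hBM : B ∈ M
  · exact Or.inl (h.right.inter A hA B (h.mem_right B hB hBM))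
  rcases h.exists_trace_or hA hA₁ hB hBM with ⟨T, hT, hAT, hle⟩ | ⟨N, hN, hNM, hN₁, hBN, hNA⟩
  · have hTB : T ∈ B := by
      refine h.left.mem_of_rank_lt (h.trace_mem hT) hB hB₁ (hle.lt_of_ne fun hr => ?_)
      have := h.left.eq_of_rank_eq (h.trace_mem hT) hB hr
      exact not_mem_E1_of_mem_E0 (h.trace_mem_E0 hT) (this ▸ hB₁)
    rw [ZFSet.inter_eq_left_of_subset (subset_of_mem_E1 hB₁ (subset_of_mem_E1 hB₁ hTB hAT))]
    exact Or.inl hA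
  · have hBA : B ∈ A := hNA.elim (fun e => e ▸ hBN) fun h => subset_of_mem_E1 hA₁ h hBN
    rw [ZFSet.inter_eq_right_of_subset (subset_of_mem_E1 hA₁ hBA)]
    exact Or.inr hB

/-- The essential case has a trace `T ∋ A` at or below `B`. If `T ⊆ B`, the intersection is one of
the added models. Otherwise `T` lies in an interval of `B` given by some `L`; then `A ⊆ L`, and `B`
can be replaced by `L ∩ B`, of smaller rank. -/
theorem inter_mixed [IsWellOrder _ r] (h : Amalgam r p q M) (hA : A ∈ q) (hA₁ : A ∈ E1 r)
    (hB : B ∈ p) (hB₀ : B ∈ E0 r) : InAmalgam r p q M (A ∩ B) := by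
  obtain ⟨o, ho⟩ : ∃ o, B.rank = o := ⟨_, rfl⟩
  induction o using WellFoundedLT.induction generalizing B with
  | ind o ih =>
    by_cases hBM : B ∈ M
    · exact Or.inl (h.right.inter A hA B (h.mem_right B hB hBM))
    rcases h.exists_trace_or hA hA₁ hB hBM with ⟨T, hT, hAT, hle⟩ | ⟨N, hN, hNM, hN₁, hBN, hNA⟩
    · by_cases hTB : T ⊆ B
      · exact Or.inr (Or.inr ⟨A, hA, hA₁, B, hB, hB₀, T, hT, hAT, hTB, rfl⟩)
      have hTp := h.trace_mem hT
      have hlt : T.rank < B.rank := hle.lt_of_ne fun hr =>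
        hTB (h.left.eq_of_rank_eq hTp hB hr ▸ fun _ => id)
      obtain ⟨L, hL, hLB, hL₁, hrank, hTL⟩ := h.left.exists_interval hB hB₀ hTp hlt
        fun hmem => hTB (subset_of_mem_E0 (h.trace_mem_E0 hT) (Or.inl hB₀) hmem)
      have hAL := subset_of_mem_E1 hL₁ (subset_of_mem_E1 hL₁ hTL hAT)
      have heq : A ∩ B = A ∩ (L ∩ B) := by
        ext z
        simp only [ZFSet.mem_inter]
        exact ⟨fun h => ⟨h.1, hAL h.1, h.2⟩, fun h => ⟨h.1, h.2.2⟩⟩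
      rw [heq]
      exact ih _ (ho ▸ hrank.trans_lt hlt) (h.left.inter L hL B hB)
        (inter_mem_E0 (Or.inr hL₁) hB₀) rfl
    · have hBA : B ∈ A := hNA.elim (fun e => e ▸ hBN) fun h => subset_of_mem_E1 hA₁ h hBN
      rw [ZFSet.inter_eq_right_of_subset (subset_of_mem_E0 hB₀ (Or.inr hA₁) hBA)]
      exact Or.inr (Or.inl hB)

theorem inter_left_right [IsWellOrder _ r] (h : Amalgam r p q M) (hA : A ∈ q) (hB : B ∈ p) :
    InAmalgam r p q M (A ∩ B) := by
  rcases h.right.models A hA with hA₀ | hA₁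
  · exact Or.inl (h.inter_of_countable hA hA₀ hB)
  rcases h.left.models B hB with hB₀ | hB₁
  · exact h.inter_mixed hA hA₁ hB hB₀
  · exact (h.inter_of_uncountable hA hA₁ hB hB₁).imp id Or.inl

theorem exists_eq_inter (hX : InAmalgam r p q M X) :
    X ∈ q ∨ X ∈ p ∨ ∃ A ∈ q, ∃ B ∈ p, X = A ∩ B :=
  hX.imp id (Or.imp id fun ⟨A, hA, _, K, hK, _, _, _, _, _, e⟩ => ⟨A, hA, K, hK, e⟩)

/-- Every member has the form `A`, `B` or `A ∩ B` with `A ∈ q` and `B ∈ p`. Regrouping the factors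
from each side leaves only intersections already handled. -/
theorem inter [IsWellOrder _ r] (h : Amalgam r p q M) (hX : InAmalgam r p q M X)
    (hY : InAmalgam r p q M Y) : InAmalgam r p q M (X ∩ Y) := by
  have comm : ∀ X Y : ZFSet.{u}, X ∩ Y = Y ∩ X := fun X Y => by ext; simp [and_comm]
  rcases exists_eq_inter hX with hX | hX | ⟨A, hA, B, hB, rfl⟩ <;>
  rcases exists_eq_inter hY with hY | hY | ⟨A', hA', B', hB', rfl⟩
  · exact Or.inl (h.right.inter X hX Y hY)
  · exact h.inter_left_right hX hY
  · have : X ∩ (A' ∩ B') = (X ∩ A') ∩ B' := by ext; simp [and_assoc]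
    rw [this]
    exact h.inter_left_right (h.right.inter X hX A' hA') hB'
  · rw [comm]
    exact h.inter_left_right hY hX
  · exact Or.inr (Or.inl (h.left.inter X hX Y hY))
  · have : X ∩ (A' ∩ B') = A' ∩ (X ∩ B') := by ext; simp only [ZFSet.mem_inter]; tauto
    rw [this]
    exact h.inter_left_right hA' (h.left.inter X hX B' hB')
  · have : A ∩ B ∩ Y = A ∩ Y ∩ B := by ext; simp only [ZFSet.mem_inter]; tauto
    rw [this]
    exact h.inter_left_right (h.right.inter A hA Y hY) hB
  · have : A ∩ B ∩ Y = A ∩ (B ∩ Y) := by ext; simp only [ZFSet.mem_inter]; tauto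
    rw [this]
    exact h.inter_left_right hA (h.left.inter B hB Y hY)
  · have : A ∩ B ∩ (A' ∩ B') = (A ∩ A') ∩ (B ∩ B') := by ext; simp only [ZFSet.mem_inter]; tauto
    rw [this]
    exact h.inter_left_right (h.right.inter A hA A' hA') (h.left.inter B hB B' hB')

/-- The common extension of `p` and `q`. -/
noncomputable def ext (r : H.{u} (ℵ_ 2) → H.{u} (ℵ_ 2) → Prop) (p q M : ZFSet.{u}) : ZFSet.{u} :=
  ZFSet.sep (InAmalgam r p q M) (ZFSet.powerset (H (ℵ_ 2)))

theorem models [IsWellOrder _ r] (h : Amalgam r p q M) (hX : InAmalgam r p q M X) : X ∈ E2 r := by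
  rcases hX with hX | hX | ⟨A, _, hA, K, _, hK, _, _, _, _, rfl⟩
  · exact h.right.models X hX
  · exact h.left.models X hX
  · exact Or.inl (inter_mem_E0 (Or.inr hA) hK)

theorem mem_ext [IsWellOrder _ r] (h : Amalgam r p q M) : X ∈ ext r p q M ↔ InAmalgam r p q M X :=
  ZFSet.mem_sep.trans (and_iff_right_of_imp fun hX =>
    ZFSet.mem_powerset.2 (isModel_of_mem_E2 (h.models hX)).subset)

theorem finite_ext [IsWellOrder _ r] (h : Amalgam r p q M) :
    (ext r p q M : Set ZFSet.{u}).Finite := by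
  refine ((h.right.finite.union h.left.finite).union
    ((h.right.finite.prod h.left.finite).image fun x => x.1 ∩ x.2)).subset fun X hX => ?_
  rcases exists_eq_inter (h.mem_ext.1 hX) with hX | hX | ⟨A, hA, B, hB, rfl⟩
  · exact Or.inl (Or.inl hX)
  · exact Or.inl (Or.inr hX)
  · exact Or.inr ⟨(A, B), ⟨hA, hB⟩, rfl⟩

theorem left_subset [IsWellOrder _ r] (h : Amalgam r p q M) : p ⊆ ext r p q M :=
  fun _ hX => h.mem_ext.2 (Or.inr (Or.inl hX))

theorem right_subset [IsWellOrder _ r] (h : Amalgam r p q M) : q ⊆ ext r p q M :=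
  fun _ hX => h.mem_ext.2 (Or.inl hX)

/-- Two elements are comparable in the chain. -/
def Cmp (s X Y : ZFSet.{u}) : Prop := X ≠ Y → Prec s X Y ∨ Prec s Y X

theorem _root_.SideConditions.IsSideCondition.cmp {s : ZFSet.{u}} (hp : IsSideCondition r p)
    (hps : p ⊆ s) (hX : X ∈ p) (hY : Y ∈ p) : Cmp s X Y := fun hXY =>
  ((isFiniteMemChain_iff.1 hp.chain).2 X hX Y hY hXY).imp (fun h => h.mono hps) fun h => h.mono hps

/-- If `Y` is not in `M`, it is either at or above `M`, hence above `X`, or in an interval `[N ∩ M,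
N)`. In the interval case `X` precedes `Y` when it is below `N`, and follows `Y` otherwise. -/
theorem cmp_right_left [IsWellOrder _ r] (h : Amalgam r p q M) (hX : X ∈ q) (hY : Y ∈ p) :
    Cmp (ext r p q M) X Y := by
  by_cases hYM : Y ∈ M
  · exact h.right.cmp h.right_subset hX (h.mem_right Y hY hYM)
  have key : ∀ T ∈ p, X ∈ T → T.rank ≤ Y.rank → Cmp (ext r p q M) X Y := by
    intro T hT hXT hle _
    left
    rcases hle.eq_or_lt with hr | hr
    · exact ⟨X, h.right_subset hX, le_rfl, h.left.eq_of_rank_eq hT hY hr ▸ hXT⟩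
    · obtain ⟨Z, hZ, hTZ, hZY⟩ := h.left.prec hT hY hr
      exact ⟨Z, h.left_subset hZ, (ZFSet.rank_lt_of_mem hXT).le.trans hTZ, hZY⟩
  rcases le_or_gt M.rank Y.rank with hr | hr
  · exact key M h.mem (h.subset hX) hr
  · obtain ⟨N, hN, hNM, hN₁, hle, hYN⟩ := h.left.exists_interval h.mem h.mem_E0 hY hr hYM
    have hNq := h.mem_right N hN hNM
    rcases lt_trichotomy X.rank N.rank with hr' | hr' | hr'
    · exact key (N ∩ M) (h.left.inter N hN M h.mem) (ZFSet.mem_inter.2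
        ⟨h.right.mem_of_rank_lt hX hNq hN₁ hr', h.subset hX⟩) hle
    · rw [h.right.eq_of_rank_eq hX hNq hr']
      exact fun _ => Or.inr ⟨Y, h.left_subset hY, le_rfl, hYN⟩
    · obtain ⟨Z, hZ, hNZ, hZX⟩ := h.right.prec hNq hX hr'
      exact fun _ => Or.inr ⟨Z, h.right_subset hZ, (ZFSet.rank_lt_of_mem hYN).le.trans hNZ, hZX⟩

/-- The new model `A ∩ K` is an element of `A`, and every element of `q` in `A` is in `T ⊆ K`. Thus
it lies immediately below `A` relative to `q`. -/
theorem cmp_mixed_right [IsWellOrder _ r] (h : Amalgam r p q M) (hA : A ∈ q) (hA₁ : A ∈ E1 r)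
    (hK : K ∈ p) (hK₀ : K ∈ E0 r) (hT : IsTrace r p M T) (hAT : A ∈ T) (hTK : T ⊆ K) (hY : Y ∈ q) :
    Cmp (ext r p q M) (A ∩ K) Y := by
  have hXA : A ∩ K ∈ A := inter_mem_of_mem_E1 hA₁ hK₀ (hTK hAT)
  have hX : A ∩ K ∈ ext r p q M :=
    h.mem_ext.2 (Or.inr (Or.inr ⟨A, hA, hA₁, K, hK, hK₀, T, hT, hAT, hTK, rfl⟩))
  intro _
  rcases lt_trichotomy Y.rank A.rank with hr | hr | hr
  · have hYA := h.right.mem_of_rank_lt hY hA hA₁ hr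
    exact Or.inr ⟨Y, h.right_subset hY, le_rfl,
      ZFSet.mem_inter.2 ⟨hYA, hTK (h.mem_trace hT hAT hY hYA)⟩⟩
  · rw [h.right.eq_of_rank_eq hY hA hr]
    exact Or.inl ⟨_, hX, le_rfl, hXA⟩
  · obtain ⟨Z, hZ, hAZ, hZY⟩ := h.right.prec hA hY hr
    exact Or.inl ⟨Z, h.right_subset hZ, (ZFSet.rank_lt_of_mem hXA).le.trans hAZ, hZY⟩

/-- For `Y ∉ M`, either a trace containing `A` is at or below `Y`, which puts `A ∩ K` below `Y`, or
`Y ∈ N` with `N = A` or `N ∈ A`. If `N = A`, then `A ∩ K` is already in `p`; if `N ∈ A`, then `N ∈ A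
∩ K` witnesses that `Y` comes first. -/
theorem cmp_mixed_left [IsWellOrder _ r] (h : Amalgam r p q M) (hA : A ∈ q) (hA₁ : A ∈ E1 r)
    (hK : K ∈ p) (hK₀ : K ∈ E0 r) (hT : IsTrace r p M T) (hAT : A ∈ T) (hTK : T ⊆ K) (hY : Y ∈ p) :
    Cmp (ext r p q M) (A ∩ K) Y := by
  by_cases hYM : Y ∈ M
  · exact h.cmp_mixed_right hA hA₁ hK hK₀ hT hAT hTK (h.mem_right Y hY hYM)
  have hXA : (A ∩ K).rank < A.rank :=
    ZFSet.rank_lt_of_mem (inter_mem_of_mem_E1 hA₁ hK₀ (hTK hAT))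
  rcases h.exists_trace_or hA hA₁ hY hYM with ⟨T', hT', hAT', hle⟩ | ⟨N, hN, hNM, hN₁, hYN, hNA⟩
  · intro _
    left
    rcases hle.eq_or_lt with hr | hr
    · exact ⟨A, h.right_subset hA, hXA.le, h.left.eq_of_rank_eq (h.trace_mem hT') hY hr ▸ hAT'⟩
    · obtain ⟨Z, hZ, hTZ, hZY⟩ := h.left.prec (h.trace_mem hT') hY hr
      exact ⟨Z, h.left_subset hZ, hXA.le.trans ((ZFSet.rank_lt_of_mem hAT').le.trans hTZ), hZY⟩
  · rcases hNA with rfl | hNA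
    · exact h.left.cmp h.left_subset (h.left.inter N hN K hK) hY
    · exact fun _ => Or.inr ⟨N, h.left_subset hN, (ZFSet.rank_lt_of_mem hYN).le, ZFSet.mem_inter.2
        ⟨hNA, hTK (h.mem_trace hT hAT (h.mem_right N hN hNM) hNA)⟩⟩

theorem cmp_symm {s : ZFSet.{u}} (h : Cmp s X Y) : Cmp s Y X := fun hne => (h hne.symm).symm

/-- For different `A` and `A'`, the lower one is an element of the intersection formed with the
higher one. For `A = A'` the comparison is `inter_trichotomy`. -/
theorem cmp_mixed_mixed [IsWellOrder _ r] (h : Amalgam r p q M) {A' K' T' : ZFSet.{u}}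
    (hA : A ∈ q) (hA₁ : A ∈ E1 r)
    (hK : K ∈ p) (hK₀ : K ∈ E0 r) (hT : IsTrace r p M T) (hAT : A ∈ T) (hTK : T ⊆ K)
    (hA' : A' ∈ q) (hA'₁ : A' ∈ E1 r)
    (hK' : K' ∈ p) (hK'₀ : K' ∈ E0 r) (hT' : IsTrace r p M T') (hAT' : A' ∈ T') (hTK' : T' ⊆ K') :
    Cmp (ext r p q M) (A ∩ K) (A' ∩ K') := by
  have key : ∀ {A K A' K' T T'}, A ∈ q → A ∈ E1 r → K ∈ E0 r → IsTrace r p M T → A ∈ T → T ⊆ K →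
      A' ∈ q → A' ∈ E1 r → IsTrace r p M T' → A' ∈ T' → T' ⊆ K' → A.rank < A'.rank →
      Prec (ext r p q M) (A ∩ K) (A' ∩ K') := by
    intro A K A' K' T T' hA hA₁ hK₀ hT hAT hTK hA' hA'₁ hT' hAT' hTK' hr
    have hAA' := h.right.mem_of_rank_lt hA hA' hA'₁ hr
    exact ⟨A, h.right_subset hA,
      (ZFSet.rank_lt_of_mem (inter_mem_of_mem_E1 hA₁ hK₀ (hTK hAT))).le,
      ZFSet.mem_inter.2 ⟨hAA', hTK' (h.mem_trace hT' hAT' hA hAA')⟩⟩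
  rcases lt_trichotomy A.rank A'.rank with hr | hr | hr
  · exact fun _ => Or.inl (key hA hA₁ hK₀ hT hAT hTK hA' hA'₁ hT' hAT' hTK' hr)
  · obtain rfl := h.right.eq_of_rank_eq hA hA' hr
    have hX : A ∩ K ∈ ext r p q M :=
      h.mem_ext.2 (Or.inr (Or.inr ⟨A, hA, hA₁, K, hK, hK₀, T, hT, hAT, hTK, rfl⟩))
    have hY : A ∩ K' ∈ ext r p q M :=
      h.mem_ext.2 (Or.inr (Or.inr ⟨A, hA, hA₁, K', hK', hK'₀, T', hT', hAT', hTK', rfl⟩))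
    intro hne
    have tri : A ∩ K ∈ A ∩ K' ∨ A ∩ K' ∈ A ∩ K := by
      rcases le_total K.rank K'.rank with hr | hr
      · exact (h.left.inter_trichotomy hA₁ hK hK' hK₀ hK'₀ (hTK hAT) (hTK' hAT') hr).resolve_left hne
      · exact ((h.left.inter_trichotomy hA₁ hK' hK hK'₀ hK₀ (hTK' hAT') (hTK hAT) hr).resolve_left
          hne.symm).symm
    exact tri.imp (fun h' => ⟨_, hX, le_rfl, h'⟩) fun h' => ⟨_, hY, le_rfl, h'⟩
  · exact fun _ => Or.inr (key hA' hA'₁ hK'₀ hT' hAT' hTK' hA hA₁ hT hAT hTK hr)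

theorem isSideCondition_ext [IsWellOrder _ r] (h : Amalgam r p q M) :
    IsSideCondition r (ext r p q M) := by
  refine ⟨fun X hX => h.models (h.mem_ext.1 hX), isFiniteMemChain_iff.2 ⟨h.finite_ext, ?_⟩,
    fun X hX Y hY => h.mem_ext.2 (h.inter (h.mem_ext.1 hX) (h.mem_ext.1 hY))⟩
  intro X hX Y hY
  change Cmp _ X Y
  rcases h.mem_ext.1 hX with hX | hX | ⟨A, hA, hA₁, K, hK, hK₀, T, hT, hAT, hTK, rfl⟩ <;>
  rcases h.mem_ext.1 hY with hY | hY | ⟨A', hA', hA'₁, K', hK', hK'₀, T', hT', hAT', hTK', rfl⟩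
  · exact h.right.cmp h.right_subset hX hY
  · exact h.cmp_right_left hX hY
  · exact cmp_symm (h.cmp_mixed_right hA' hA'₁ hK' hK'₀ hT' hAT' hTK' hX)
  · exact cmp_symm (h.cmp_right_left hY hX)
  · exact h.left.cmp h.left_subset hX hY
  · exact cmp_symm (h.cmp_mixed_left hA' hA'₁ hK' hK'₀ hT' hAT' hTK' hX)
  · exact h.cmp_mixed_right hA hA₁ hK hK₀ hT hAT hTK hY
  · exact h.cmp_mixed_left hA hA₁ hK hK₀ hT hAT hTK hY
  · exact h.cmp_mixed_mixed hA hA₁ hK hK₀ hT hAT hTK hA' hA'₁ hK' hK'₀ hT' hAT' hTK'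

end Amalgam

/-- If `M ∈ p` and `q ⊆ M` extends `p ∩ M`, then `p` and `q` are compatible. -/
theorem IsSideCondition.exists_common_extension [IsWellOrder _ r] {p q M : ZFSet.{u}}
    (hp : IsSideCondition r p) (hq : IsSideCondition r q) (hM : M ∈ p) (hqM : q ⊆ M)
    (hpq : p ∩ M ⊆ q) : ∃ s, IsSideCondition r s ∧ p ⊆ s ∧ q ⊆ s := by
  have hpq' : ∀ A ∈ p, A ∈ M → A ∈ q := fun A hA hAM => hpq (ZFSet.mem_inter.2 ⟨hA, hAM⟩)
  rcases hp.models M hM with hM₀ | hM₁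
  · have h : Amalgam r p q M := ⟨hp, hq, hM, hM₀, hqM, hpq'⟩
    exact ⟨_, h.isSideCondition_ext, h.left_subset, h.right_subset⟩
  · exact ⟨p ∪ q, hp.amalgamate_E1 hq hM hM₁ hqM hpq', fun x hx => ZFSet.mem_union.2 (Or.inl hx),
      fun x hx => ZFSet.mem_union.2 (Or.inr hx)⟩

end Amalgamation

/-! ## The forcing relation -/

section ForcingRelation

variable {ℙ : Type v} [Preorder ℙ] {a b c x y z w f : PName.{u} ℙ} {p q : ℙ} {φ ψ φ' ψ' : Stmt ℙ}

theorem forcesEq.mono (h : forcesEq a b p) (hq : q ≤ p) : forcesEq a b q := by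
  cases a; cases b
  exact ⟨fun i t ht => h.1 i t (ht.trans hq), fun i t ht => h.2 i t (ht.trans hq)⟩

theorem forcesEq.refl (a : PName.{u} ℙ) (p : ℙ) : forcesEq a a p := by
  induction a generalizing p with
  | mk ι a s ih =>
    exact ⟨fun i q _ hi => ⟨q, le_rfl, i, hi, ih i q⟩, fun i q _ hi => ⟨q, le_rfl, i, hi, ih i q⟩⟩

theorem forcesEq.symm (h : forcesEq a b p) : forcesEq b a p := by
  induction a generalizing b p with
  | mk ι a s ih =>
    cases b
    refine ⟨fun j q hq hj => ?_, fun i q hq hi => ?_⟩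
    · obtain ⟨t, ht, i, hti, h⟩ := h.2 j q hq hj
      exact ⟨t, ht, i, hti, ih i h⟩
    · obtain ⟨t, ht, j, htj, h⟩ := h.1 i q hq hi
      exact ⟨t, ht, j, htj, ih i h⟩

theorem forcesEq.trans (h : forcesEq a b p) (h' : forcesEq b c p) : forcesEq a c p := by
  induction a generalizing b c p with
  | mk ι a s ih =>
    cases b; cases c
    refine ⟨fun i q hq hi => ?_, fun k q hq hk => ?_⟩
    · obtain ⟨t, ht, j, htj, e⟩ := h.1 i q hq hi
      obtain ⟨t', ht', k, htk, e'⟩ := h'.1 j t (ht.trans hq) htj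
      exact ⟨t', ht'.trans ht, k, htk, ih i (e.mono ht') e'⟩
    · obtain ⟨t, ht, j, htj, e⟩ := h'.2 k q hq hk
      obtain ⟨t', ht', i, hti, e'⟩ := h.2 j t (ht.trans hq) htj
      exact ⟨t', ht'.trans ht, i, hti, ih i e' (e.mono ht')⟩

theorem forcesMem.mono (h : forcesMem a b p) (hq : q ≤ p) : forcesMem a b q := by
  cases b
  exact fun t ht => h t (ht.trans hq)

theorem forcesMem.congr_right (h : forcesMem a b p) (e : forcesEq b c p) : forcesMem a c p := by
  cases b; cases c
  intro q hq
  obtain ⟨t, ht, i, hti, h⟩ := h q hq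
  obtain ⟨t', ht', j, htj, h'⟩ := e.1 i t (ht.trans hq) hti
  exact ⟨t', ht'.trans ht, j, htj, (h.mono ht').trans h'⟩

/-- The connectives are built from negation, so an implication only asks for `ψ` at some extension;
no density closure of `ψ` is required. -/
theorem fImp_iff : fImp φ ψ p ↔ ∀ q ≤ p, φ q → ∃ t ≤ q, ψ t := by
  simp only [fImp, fNot, fAnd, not_and, not_forall, not_not, exists_prop]

theorem fAllIn_iff {φ : PName.{u} ℙ → Stmt ℙ} :
    fAllIn a φ p ↔ ∀ x, ∀ q ≤ p, forcesMem x a q → ∃ t ≤ q, φ x t :=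
  forall_congr' fun _ => fImp_iff

theorem fEx_iff {φ : PName.{u} ℙ → Stmt ℙ} : fEx φ p ↔ ∀ q ≤ p, ∃ x, ∃ t ≤ q, φ x t := by
  simp only [fEx, fNot, fAll, not_forall, not_not, exists_prop]

theorem fExIn_iff {φ : PName.{u} ℙ → Stmt ℙ} :
    fExIn a φ p ↔ ∀ q ≤ p, ∃ x, ∃ t ≤ q, forcesMem x a t ∧ φ x t :=
  fEx_iff

theorem fEx.mono {φ : PName.{u} ℙ → Stmt ℙ} (h : fEx φ p) (hq : q ≤ p) : fEx φ q :=
  fun t ht => h t (ht.trans hq)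

/-- `φ` and `ψ` are equivalent below `p`. -/
def AgreeBelow (p : ℙ) (φ ψ : Stmt ℙ) : Prop := ∀ q ≤ p, φ q ↔ ψ q

namespace AgreeBelow

theorem refl (p : ℙ) (φ : Stmt ℙ) : AgreeBelow p φ φ := fun _ _ => Iff.rfl

theorem fNot (h : AgreeBelow p φ ψ) : AgreeBelow p (fNot φ) (fNot ψ) := fun _ hq =>
  forall₂_congr fun t ht => not_congr (h t (ht.trans hq))

theorem fAnd (h : AgreeBelow p φ ψ) (h' : AgreeBelow p φ' ψ') :
    AgreeBelow p (fAnd φ φ') (fAnd ψ ψ') := fun q hq => and_congr (h q hq) (h' q hq)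

theorem fOr (h : AgreeBelow p φ ψ) (h' : AgreeBelow p φ' ψ') :
    AgreeBelow p (fOr φ φ') (fOr ψ ψ') := (h.fNot.fAnd h'.fNot).fNot

theorem fImp (h : AgreeBelow p φ ψ) (h' : AgreeBelow p φ' ψ') :
    AgreeBelow p (fImp φ φ') (fImp ψ ψ') := (h.fAnd h'.fNot).fNot

theorem fIff (h : AgreeBelow p φ ψ) (h' : AgreeBelow p φ' ψ') :
    AgreeBelow p (fIff φ φ') (fIff ψ ψ') := (h.fImp h').fAnd (h'.fImp h)

theorem fAll {φ ψ : PName.{u} ℙ → Stmt ℙ} (h : ∀ x, AgreeBelow p (φ x) (ψ x)) :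
    AgreeBelow p (fAll φ) (fAll ψ) := fun q hq => forall_congr' fun x => h x q hq

theorem fEx {φ ψ : PName.{u} ℙ → Stmt ℙ} (h : ∀ x, AgreeBelow p (φ x) (ψ x)) :
    AgreeBelow p (fEx φ) (fEx ψ) := (fAll fun x => (h x).fNot).fNot

theorem forcesEq (e : forcesEq x y p) : AgreeBelow p (forcesEq w x) (forcesEq w y) := fun _ hq =>
  ⟨fun h => h.trans (e.mono hq), fun h => h.trans (e.mono hq).symm⟩

theorem fIsUPair {x' y' : PName.{u} ℙ} (e : SideConditions.forcesEq x x' p)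
    (e' : SideConditions.forcesEq y y' p) : AgreeBelow p (fIsUPair z x y) (fIsUPair z x' y') :=
  fAll fun _ => (refl p _).fIff ((forcesEq e).fOr (forcesEq e'))

theorem fIsPair {x' y' : PName.{u} ℙ} (e : SideConditions.forcesEq x x' p)
    (e' : SideConditions.forcesEq y y' p) : AgreeBelow p (fIsPair z x y) (fIsPair z x' y') :=
  fEx fun _ => fEx fun _ => (fIsUPair e e).fAnd ((fIsUPair e e').fAnd (refl p _))

theorem fPairMem {x' y' : PName.{u} ℙ} (e : SideConditions.forcesEq x x' p)
    (e' : SideConditions.forcesEq y y' p) : AgreeBelow p (fPairMem x y f) (fPairMem x' y' f) :=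
  fEx fun _ => (refl p _).fAnd (fIsPair e e')

theorem forcesMem (e : SideConditions.forcesEq x y p) :
    AgreeBelow p (forcesMem w x) (forcesMem w y) := fun _ hq =>
  ⟨fun h => h.congr_right (e.mono hq), fun h => h.congr_right (e.mono hq).symm⟩

theorem fExIn {φ ψ : PName.{u} ℙ → Stmt ℙ} (e : SideConditions.forcesEq x y p)
    (h : ∀ z, AgreeBelow p (φ z) (ψ z)) : AgreeBelow p (fExIn x φ) (fExIn y ψ) :=
  fEx fun z => (forcesMem e).fAnd (h z)

theorem fAllIn {φ ψ : PName.{u} ℙ → Stmt ℙ} (e : SideConditions.forcesEq x y p)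
    (h : ∀ z, AgreeBelow p (φ z) (ψ z)) : AgreeBelow p (fAllIn x φ) (fAllIn y ψ) :=
  fAll fun z => (forcesMem e).fImp (h z)

theorem fIsSurjection (e : SideConditions.forcesEq x y p) :
    AgreeBelow p (fIsSurjection f x z) (fIsSurjection f y z) :=
  (fAllIn (.refl f p) fun _ => fExIn e fun _ => refl p _).fAnd <|
    (fAllIn e fun _ => refl p _).fAnd <| (refl p _).fAnd <|
    fAllIn (.refl z p) fun _ => fExIn e fun _ => refl p _

end AgreeBelow

theorem fPairMem.congr {x' y' : PName.{u} ℙ} (h : fPairMem x y f p) (e : forcesEq x x' p)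
    (e' : forcesEq y y' p) : fPairMem x' y' f p :=
  (AgreeBelow.fPairMem e e' p le_rfl).1 h

theorem fPairMem.mono (h : fPairMem x y f p) (hq : q ≤ p) : fPairMem x y f q := fEx.mono h hq

/-! ### Canonical names and cardinals -/

section Check

variable [OrderTop ℙ] {A B C : ZFSet.{u}}

theorem forcesMem_check_iff :
    forcesMem x (check A) p ↔ ∀ q ≤ p, ∃ t ≤ q, ∃ y ∈ A, forcesEq x (check y) t := by
  rw [check]
  refine forall₂_congr fun q _ => exists_congr fun t => and_congr_right fun _ => ?_
  constructor
  · rintro ⟨i, _, h⟩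
    exact ⟨_, ((equivShrink A).symm i).2, h⟩
  · rintro ⟨y, hy, h⟩
    exact ⟨equivShrink A ⟨y, hy⟩, le_top, by simpa using h⟩

theorem forcesMem_check (h : B ∈ A) (e : forcesEq x (check B) p) : forcesMem x (check A) p :=
  forcesMem_check_iff.2 fun q hq => ⟨q, le_rfl, B, h, e.mono hq⟩

theorem forcesMem.exists_check (h : forcesMem x (check A) p) :
    ∃ t ≤ p, ∃ y ∈ A, forcesEq x (check y) t :=
  forcesMem_check_iff.1 h p le_rfl

theorem subset_of_forcesEq_check
    (ih : ∀ y ∈ A, ∀ (B : ZFSet.{u}) (p : ℙ), forcesEq (check y) (check B) p → y = B)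
    (h : forcesEq (check A) (check B) p) : A ⊆ B := by
  intro y hy
  obtain ⟨t, _, z, hz, e⟩ :=
    ((forcesMem_check hy (forcesEq.refl _ p)).congr_right h).exists_check
  exact ih y hy z t e ▸ hz

theorem eq_of_forcesEq_check (h : forcesEq (check A) (check B) p) : A = B := by
  induction A using ZFSet.inductionOn generalizing B p with
  | _ A ih =>
    have hAB := subset_of_forcesEq_check (fun y hy _ _ => ih y hy) h
    refine ZFSet.ext fun z => ⟨fun hz => hAB hz, fun hz => ?_⟩
    obtain ⟨t, _, y, hy, e⟩ :=
      ((forcesMem_check hz (forcesEq.refl _ p)).congr_right h.symm).exists_check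
    exact ih y hy e.symm ▸ hy

theorem fIsTransitive_of_forcesEq (hA : A.IsTransitive) (e : forcesEq x (check A) p) :
    fIsTransitive x p := by
  refine fAllIn_iff.2 fun y q hq hy => ?_
  obtain ⟨t, ht, B, hB, eB⟩ := (hy.congr_right (e.mono hq)).exists_check
  refine ⟨t, ht, fAllIn_iff.2 fun z q' hq' hz => ?_⟩
  obtain ⟨t', ht', C, hC, eC⟩ := (hz.congr_right (eB.mono hq')).exists_check
  have h' := ht'.trans (hq'.trans (ht.trans hq))
  exact ⟨t', ht', (forcesMem_check (hA B hB hC) eC).congr_right (e.mono h').symm⟩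

/-- A name for an element of `check A` can be decided as some `check B` with `B ∈ A`, and
`AgreeBelow` transfers the surjection to the canonical name. Only surjections from ground model
elements need to be excluded. -/
theorem fIsCardinal_check (hA : A.IsTransitive) (hA' : ∀ B ∈ A, B.IsTransitive)
    (h : ∀ B ∈ A, ∀ f : PName.{u} ℙ, ∀ q ≤ p, ¬ fIsSurjection f (check B) (check A) q) :
    fIsCardinal (check A) p := by
  refine ⟨⟨fIsTransitive_of_forcesEq hA (forcesEq.refl _ _), fAllIn_iff.2 fun x q _ hx => ?_⟩,
    fAllIn_iff.2 fun x q hq hx => ?_⟩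
  · obtain ⟨t, ht, B, hB, e⟩ := hx.exists_check
    exact ⟨t, ht, fIsTransitive_of_forcesEq (hA' B hB) e⟩
  · obtain ⟨t, ht, B, hB, e⟩ := hx.exists_check
    refine ⟨t, ht, fun q' hq' hf => ?_⟩
    obtain ⟨f, t', ht', hf⟩ := fEx_iff.1 hf q' le_rfl
    exact h B hB f t' (ht'.trans (hq'.trans (ht.trans hq)))
      ((AgreeBelow.fIsSurjection (e.mono (ht'.trans hq')) t' le_rfl).1 hf)

end Check

end ForcingRelation

namespace ForcingNotion

variable {P : ForcingNotion.{u}} {p q : P.Cond} {a b D : ZFSet.{u}}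

theorem forcesMem_check_gdot_iff :
    forcesMem (check a) P.gdot p ↔ ∀ q ≤ p, ∃ t ≤ q, ∃ s : P.Cond, s.val = a ∧ t ≤ s := by
  rw [gdot]
  refine forall₂_congr fun q _ => exists_congr fun t => and_congr_right fun _ => ?_
  constructor
  · rintro ⟨i, hi, h⟩
    exact ⟨_, (eq_of_forcesEq_check h).symm, hi⟩
  · rintro ⟨s, rfl, h⟩
    exact ⟨equivShrink _ s, by simpa using h, by simpa using forcesEq.refl _ t⟩

theorem forcesMem_gdot_of_le (s : P.Cond) (h : p ≤ s) : forcesMem (check s.val) P.gdot p :=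
  forcesMem_check_gdot_iff.2 fun q hq => ⟨q, le_rfl, s, rfl, hq.trans h⟩

theorem exists_le_of_forcesMem_gdot (h : forcesMem (check a) P.gdot p) :
    ∃ t ≤ p, ∃ s : P.Cond, s.val = a ∧ t ≤ s :=
  forcesMem_check_gdot_iff.1 h p le_rfl

theorem fMeets_of_dense (h : ∀ q ≤ p, ∃ t ≤ q, ∃ d : P.Cond, d.val ∈ D ∧ t ≤ d) :
    P.fMeets D p := by
  refine fExIn_iff.2 fun q hq => ?_
  obtain ⟨t, ht, d, hd, htd⟩ := h q hq
  exact ⟨check d.val, t, ht, forcesMem_check hd (forcesEq.refl _ t), forcesMem_gdot_of_le d htd⟩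

end ForcingNotion

/-! ## Strong genericity -/

section StronglyGeneric

variable {r : H.{u} (ℵ_ 2) → H.{u} (ℵ_ 2) → Prop} {M : ZFSet.{u}}

theorem cond_le_iff {p q : (sidePoset r).Cond} : q ≤ p ↔ p.val ⊆ q.val := Iff.rfl

theorem Cond.isSideCondition (p : (sidePoset r).Cond) : IsSideCondition r p.val :=
  (mem_sidePoset r _).1 p.property

/-- A side condition, as an element of the poset. -/
def IsSideCondition.toCond {p : ZFSet.{u}} (hp : IsSideCondition r p) : (sidePoset r).Cond :=
  ⟨p, (mem_sidePoset r p).2 hp⟩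

/-- Any common extension, intersected with `M`, remains a common extension because conditions in `M`
are subsets of `M`. -/
theorem isAdequate_sidePoset (hM : M ∈ E2 r) : (sidePoset r).IsAdequate M := by
  rintro p hp q hq ⟨s, hs, hps, hqs⟩
  simp only [ZFSet.mem_inter, mem_sidePoset] at *
  exact ⟨s ∩ M, ⟨hs.restrict hM, hs.restrict_mem hM⟩,
    fun x hx => ZFSet.mem_inter.2 ⟨hps hx, hp.1.subset_of_mem hM hp.2 hx⟩,
    fun x hx => ZFSet.mem_inter.2 ⟨hqs hx, hq.1.subset_of_mem hM hq.2 hx⟩⟩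

/-- Every `q` below `p` still has `M` as a member, so each extension of `q ∩ M` inside `M` is
compatible with `q`; this meets dense sets. For directedness, `w ∩ M` is a common extension for any
`w` below both conditions. -/
theorem isStronglyGeneric_of_mem [IsWellOrder _ r] (p : (sidePoset r).Cond) (hMp : M ∈ p.val) :
    (sidePoset r).IsStronglyGeneric M p := by
  have hM : M ∈ E2 r := (Cond.isSideCondition p).models M hMp
  refine ⟨fun a ha b hb hab => fImp_iff.2 fun q _ haG => ?_,
    fun a ha b hb => fImp_iff.2 fun q _ hG => ?_, fun D hD => ForcingNotion.fMeets_of_dense fun q hq => ?_⟩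
  · obtain ⟨t, ht, s, rfl, hts⟩ := ForcingNotion.exists_le_of_forcesMem_gdot haG
    let c : (sidePoset r).Cond := ⟨b, (ZFSet.mem_inter.1 hb).1⟩
    exact ⟨t, ht, ForcingNotion.forcesMem_gdot_of_le c (hts.trans (show s ≤ c from hab))⟩
  · obtain ⟨t, ht, s, rfl, hts⟩ := ForcingNotion.exists_le_of_forcesMem_gdot hG.1
    obtain ⟨t', ht', s', rfl, hts'⟩ :=
      ForcingNotion.exists_le_of_forcesMem_gdot (hG.2.mono ht)
    refine ⟨t', ht'.trans ht, ForcingNotion.fMeets_of_dense fun w hw => ?_⟩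
    have hw' := Cond.isSideCondition w
    have h₁ : s.val ⊆ w.val := cond_le_iff.1 (hw.trans (ht'.trans hts))
    have h₂ : s'.val ⊆ w.val := cond_le_iff.1 (hw.trans hts')
    have hs := (Cond.isSideCondition s).subset_of_mem hM (ZFSet.mem_inter.1 ha).2
    have hs' := (Cond.isSideCondition s').subset_of_mem hM (ZFSet.mem_inter.1 hb).2
    refine ⟨w, le_rfl, (hw'.restrict hM).toCond, ?_, fun x hx => (ZFSet.mem_inter.1 hx).1⟩
    refine ZFSet.mem_sep.2 ⟨ZFSet.mem_inter.2 ⟨(hw'.restrict hM).toCond.property, hw'.restrict_mem hM⟩, ?_, ?_⟩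
    · exact fun x hx => ZFSet.mem_inter.2 ⟨h₁ hx, hs hx⟩
    · exact fun x hx => ZFSet.mem_inter.2 ⟨h₂ hx, hs' hx⟩
  · have hq' := Cond.isSideCondition q
    -- Density is applied to the reduction of `q`, and amalgamation turns the resulting `d` into an
    -- extension of `q`.
    obtain ⟨d, hd, hqd⟩ := hD.2 (q.val ∩ M) (ZFSet.mem_inter.2
      ⟨(hq'.restrict hM).toCond.property, hq'.restrict_mem hM⟩)
    obtain ⟨hd', hdM⟩ := ZFSet.mem_inter.1 (hD.1 hd)
    have hd' := (mem_sidePoset r d).1 hd'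
    obtain ⟨s, hs, hqs, hds⟩ := hq'.exists_common_extension hd' (hq hMp) (hd'.subset_of_mem hM hdM) hqd
    exact ⟨hs.toCond, hqs, hd'.toCond, hd, hds⟩

/-- Amalgamate `{M}` with `p`: the requirement on `{M} ∩ M` is vacuous, as `M ∉ M`. -/
theorem exists_le_mem [IsWellOrder _ r] (hM : M ∈ E2 r) (p : (sidePoset r).Cond)
    (hp : p.val ⊆ M) : ∃ q ≤ p, M ∈ q.val := by
  obtain ⟨s, hs, hMs, hps⟩ := (isSideCondition_singleton hM).exists_common_extension
    (Cond.isSideCondition p) (ZFSet.mem_singleton.2 rfl) hp (by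
      intro x hx
      obtain ⟨hx, hx'⟩ := ZFSet.mem_inter.1 hx
      rw [ZFSet.mem_singleton.1 hx] at hx'
      exact absurd hx' (ZFSet.mem_irrefl M))
  exact ⟨hs.toCond, hps, hMs (ZFSet.mem_singleton.2 rfl)⟩

theorem isStronglyProper_sidePoset [IsWellOrder _ r] : (sidePoset r).IsStronglyProper (E2 r) := by
  refine fun M hM => ⟨isAdequate_sidePoset hM, fun p hp => ?_⟩
  obtain ⟨q, hq, hMq⟩ := exists_le_mem hM p ((Cond.isSideCondition p).subset_of_mem hM hp)
  exact ⟨q, hq, isStronglyGeneric_of_mem q hMq⟩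

end StronglyGeneric

/-! ## Properness -/

section Properness

variable {r : H.{u} (ℵ_ 2) → H.{u} (ℵ_ 2) → Prop} {M : ZFSet.{u}} {θ : Cardinal.{u}}

theorem IsSideCondition.mem_H {p : ZFSet.{u}} (hp : IsSideCondition r p) : p ∈ H (ℵ_ 2) :=
  mem_H_of_finite isRegular_aleph_two (fun _ hx => mem_H_of_mem_E2 (hp.models _ hx)) hp.finite

/-- The Kuratowski pair has `{P.carrier}` as an element, and countable elements of `M` are subsets
of `M`, so two steps down suffice. -/
theorem carrier_mem_of_code_mem {P : ForcingNotion.{u}} (hθ : θ.IsRegular) (h₀ : ℵ₀ < θ)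
    (hM : IsElementarySubmodel (H θ) ![memRel (H θ)] M) (h : P.code ∈ M) : P.carrier ∈ M := by
  have hsub : ∀ x ∈ M, (x : Set ZFSet.{u}).Countable → x ⊆ M := fun x hx hc =>
    hM.subset_of_countable (i := 0) hθ h₀ rfl hx hc
  have hpair : ∀ a b : ZFSet.{u}, (({a, b} : ZFSet.{u}) : Set ZFSet.{u}).Countable := fun a b =>
    (Set.toFinite {a, b}).countable.mono fun x hx => by simpa using hx
  have h₁ : ({P.carrier} : ZFSet.{u}) ∈ M := hsub _ h (hpair _ _) (by simp [ForcingNotion.code, ZFSet.pair])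
  refine hsub _ h₁ ?_ (ZFSet.mem_singleton.2 rfl)
  exact (Set.countable_singleton P.carrier).mono fun x hx => by simpa using hx

/-- Non-transitivity distinguishes the countable models in `𝓔²`. With `mem_E2_iff_exists`, this
defines `E0` in `H(θ)` from the carrier alone, without requiring `H(ℵ₂)` or `r` to be elements of
the submodel. -/
theorem mem_E0_iff_not_transitive {C : ZFSet.{u}} (hC : C ∈ E2 r) :
    C ∈ E0 r ↔ ∃ x ∈ C, ¬ x ⊆ C :=
  ⟨exists_not_subset_of_mem_E0, fun ⟨_, hx, hxC⟩ =>
    hC.resolve_right fun hU => hxC (subset_of_mem_E1 hU hx)⟩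

theorem mem_E2_iff_exists {C : ZFSet.{u}} : C ∈ E2 r ↔ ∃ p ∈ (sidePoset r).carrier, C ∈ p := by
  refine ⟨fun hC => ⟨{C}, (mem_sidePoset r _).2 (isSideCondition_singleton hC), ?_⟩, ?_⟩
  · exact ZFSet.mem_singleton.2 rfl
  · rintro ⟨p, hp, hCp⟩
    exact ((mem_sidePoset r p).1 hp).models C hCp

theorem exists_mem_E0_of_countable {a : ZFSet.{u}} (ha : a ⊆ H (ℵ_ 2))
    (hc : (a : Set ZFSet.{u}).Countable) : ∃ C ∈ E0 r, a ⊆ C := by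
  obtain ⟨C, hC, hC', h⟩ := exists_countable_submodel isRegular_aleph_two ![memRel (H (ℵ_ 2)), r]
    (S := {x | (x : ZFSet.{u}) ∈ a}) (hc.preimage Subtype.val_injective)
  exact ⟨C, mem_E0_iff.2 ⟨hC, hC'⟩, fun x hx => h ⟨x, ha hx⟩ hx⟩

/-- An elementary submodel of `H(θ)` with enough information has as element a countable model of
`H(ℵ₂)` which covers any two given countable sets. -/
theorem exists_mem_E0_inter (hM : IsElementarySubmodel (H θ) ![memRel (H θ)] M)
    (hP : (sidePoset r).carrier ∈ M) {a b : ZFSet.{u}} (ha : a ∈ M) (hb : b ∈ M)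
    (ha' : a ⊆ H (ℵ_ 2)) (hb' : b ⊆ H (ℵ_ 2)) (hac : (a : Set ZFSet.{u}).Countable)
    (hbc : (b : Set ZFSet.{u}).Countable) : ∃ C ∈ E0 r, C ∈ M ∧ a ⊆ C ∧ b ⊆ C := by
  let K : H θ := ⟨_, hM.subset hP⟩
  let a' : H θ := ⟨a, hM.subset ha⟩
  let b' : H θ := ⟨b, hM.subset hb⟩
  have hi : (![memRel (H θ)] : Fin 1 → _) 0 = memRel (H θ) := rfl
  have hE : ∀ C : H θ, ((∃ p : H θ, (p : ZFSet.{u}) ∈ (K : ZFSet.{u}) ∧ (C : ZFSet.{u}) ∈ (p : ZFSet.{u})) ∧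
      ∃ x : H θ, (x : ZFSet.{u}) ∈ (C : ZFSet.{u}) ∧ ¬ (x : ZFSet.{u}) ⊆ (C : ZFSet.{u})) ↔
      (C : ZFSet.{u}) ∈ E0 r := by
    intro C
    constructor
    · rintro ⟨⟨p, hp, hCp⟩, x, hx, hxC⟩
      exact (mem_E0_iff_not_transitive (mem_E2_iff_exists.2 ⟨p, hp, hCp⟩)).2 ⟨x, hx, hxC⟩
    · intro hC
      obtain ⟨p, hp, hCp⟩ := mem_E2_iff_exists.1 (show (C : ZFSet.{u}) ∈ E2 r from Or.inl hC)
      obtain ⟨x, hx, hxC⟩ := exists_not_subset_of_mem_E0 hC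
      exact ⟨⟨⟨p, mem_H_of_mem K.2 hp⟩, hp, hCp⟩, ⟨x, mem_H_of_mem C.2 hx⟩, hx, hxC⟩
  obtain ⟨C, hCM, hC, haC, hbC⟩ := hM.exists_mem (Q := fun C =>
      ((∃ p : H θ, (p : ZFSet.{u}) ∈ (K : ZFSet.{u}) ∧ (C : ZFSet.{u}) ∈ (p : ZFSet.{u})) ∧
        ∃ x : H θ, (x : ZFSet.{u}) ∈ (C : ZFSet.{u}) ∧ ¬ (x : ZFSet.{u}) ⊆ (C : ZFSet.{u})) ∧
      (a' : ZFSet.{u}) ⊆ (C : ZFSet.{u}) ∧ (b' : ZFSet.{u}) ⊆ (C : ZFSet.{u})) (by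
    have hK : Tm (inside (H θ) M) fun _ => K := Tm.param K hP
    have ha'' : Tm (inside (H θ) M) fun _ => a' := Tm.param a' ha
    have hb'' : Tm (inside (H θ) M) fun _ => b' := Tm.param b' hb
    refine Dfn.and (Dfn.and (Dfn.ex (Dfn.and (Dfn.mem hi (Tm.var 0) hK)
      (Dfn.mem hi (Tm.var 1) (Tm.var 0)))) (Dfn.ex (Dfn.and (Dfn.mem hi (Tm.var 0) (Tm.var 1))
      (Dfn.not (Dfn.subset hi (Tm.var 0) (Tm.var 1)))))) (Dfn.and (Dfn.subset hi ha'' (Tm.var 0))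
      (Dfn.subset hi hb'' (Tm.var 0)))) (by
    obtain ⟨C, hC, h⟩ := exists_mem_E0_of_countable (r := r) (a := a ∪ b)
      (fun x hx => (ZFSet.mem_union.1 hx).elim (fun h => ha' h) fun h => hb' h)
      ((hac.union hbc).mono fun x hx => ZFSet.mem_union.1 hx)
    obtain ⟨p, hp, hCp⟩ := mem_E2_iff_exists.1 (show C ∈ E2 r from Or.inl hC)
    exact ⟨⟨C, mem_H_of_mem (mem_H_of_mem K.2 hp) hCp⟩, (hE _).2 hC,
      fun x hx => h (ZFSet.mem_union.2 (Or.inl hx)), fun x hx => h (ZFSet.mem_union.2 (Or.inr hx))⟩)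
  exact ⟨C, (hE C).1 hC, hCM, haC, hbC⟩

/-- The trace on `H(ℵ₂)` of a countable elementary submodel of `H(θ)` is a countable model. -/
theorem inter_H_mem_E0 (hθ : θ.IsRegular) (h₀ : ℵ₀ < θ)
    (hM : IsElementarySubmodel (H θ) ![memRel (H θ)] M) (hMc : (M : Set ZFSet.{u}).Countable)
    (hP : (sidePoset r).carrier ∈ M) : M ∩ H (ℵ_ 2) ∈ E0 r := by
  have hi : (![memRel (H θ)] : Fin 1 → _) 0 = memRel (H θ) := rfl
  have he : ∅ ∈ M := hM.empty_mem hθ hi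
  have hec : ((∅ : ZFSet.{u}) : Set ZFSet.{u}).Countable :=
    Set.countable_empty.mono fun x hx => absurd hx (ZFSet.notMem_empty x)
  refine mem_E0_iff.2 ⟨?_, hMc.mono fun x hx => (ZFSet.mem_inter.1 hx).1⟩
  -- The trace is the union of the countable models belonging to `M`; covering two of them by a
  -- third inside `M` makes the system directed.
  refine isElementarySubmodel_of_directed (𝓒 := {C | C ∈ E0 r ∧ C ∈ M}) (fun C hC => hC.1.1) ?_ ?_ ?_
  · obtain ⟨C, hC, hCM, -⟩ := exists_mem_E0_inter hM hP he he (ZFSet.empty_subset _)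
      (ZFSet.empty_subset _) hec hec
    exact ⟨C, hC, hCM⟩
  · rintro C ⟨hC, hCM⟩ D ⟨hD, hDM⟩
    obtain ⟨E, hE, hEM, hCE, hDE⟩ := exists_mem_E0_inter hM hP hCM hDM hC.1.subset hD.1.subset
      (countable_of_mem_E0 hC) (countable_of_mem_E0 hD)
    exact ⟨E, ⟨hE, hEM⟩, hCE, hDE⟩
  · intro x
    constructor
    · intro hx
      obtain ⟨hxM, hxH⟩ := ZFSet.mem_inter.1 hx
      obtain ⟨C, hC, hCM, hxC, -⟩ := exists_mem_E0_inter (a := {x}) hM hP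
        (hM.insert_mem hθ hi hxM he) he (fun y hy => by rwa [ZFSet.mem_singleton.1 hy])
        (ZFSet.empty_subset _)
        ((Set.countable_singleton x).mono fun y hy => by simpa using hy) hec
      exact ⟨C, ⟨hC, hCM⟩, hxC (ZFSet.mem_singleton.2 rfl)⟩
    · rintro ⟨C, ⟨hC, hCM⟩, hxC⟩
      exact ZFSet.mem_inter.2 ⟨hM.subset_of_countable (i := 0) hθ h₀ hi hCM (countable_of_mem_E0 hC) hxC,
        hC.1.subset hxC⟩

theorem isDenseIn_inter (hM : IsElementarySubmodel (H θ) ![memRel (H θ)] M) {D : ZFSet.{u}}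
    (hDM : D ∈ M) (hD : (sidePoset r).IsDenseIn (sidePoset r).carrier D) :
    (sidePoset r).IsDenseIn ((sidePoset r).carrier ∩ (M ∩ H (ℵ_ 2))) (D ∩ M) := by
  have hi : (![memRel (H θ)] : Fin 1 → _) 0 = memRel (H θ) := rfl
  constructor
  · intro d hd
    obtain ⟨hd, hdM⟩ := ZFSet.mem_inter.1 hd
    exact ZFSet.mem_inter.2 ⟨hD.1 hd,
      ZFSet.mem_inter.2 ⟨hdM, ((mem_sidePoset r d).1 (hD.1 hd)).mem_H⟩⟩
  · intro p hp
    obtain ⟨hp, hpM⟩ := ZFSet.mem_inter.1 hp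
    obtain ⟨hpM, -⟩ := ZFSet.mem_inter.1 hpM
    let D' : H θ := ⟨D, hM.subset hDM⟩
    let p' : H θ := ⟨p, hM.subset hpM⟩
    obtain ⟨d, hdM, hd, hpd⟩ := hM.exists_mem (Q := fun d =>
        (d : ZFSet.{u}) ∈ (D' : ZFSet.{u}) ∧ (p' : ZFSet.{u}) ⊆ (d : ZFSet.{u}))
      (Dfn.and (Dfn.mem hi (Tm.var 0) (Tm.param D' hDM)) (Dfn.subset hi (Tm.param p' hpM) (Tm.var 0)))
      (by
        obtain ⟨d, hd, hpd⟩ := hD.2 p hp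
        exact ⟨⟨d, mem_H_of_mem D'.2 hd⟩, hd, hpd⟩)
    exact ⟨d, ZFSet.mem_inter.2 ⟨hd, hdM⟩, hpd⟩

/-- A condition with `M ∩ H(ℵ₂)` as a member is strongly generic for it, and by elementarity a dense
`D ∈ M` yields the dense subset `D ∩ M` of the suborder. -/
theorem isProper_sidePoset [IsWellOrder _ r] : (sidePoset r).IsProper := by
  intro θ hθ h₀ _ M hM hMc hcode p hp
  have hP := carrier_mem_of_code_mem hθ h₀ hM hcode
  have hN : M ∩ H (ℵ_ 2) ∈ E2 r :=
    Or.inl (inter_H_mem_E0 hθ h₀ hM (countable_iff_card_le.2 hMc) hP)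
  have hpN : p.val ∈ M ∩ H (ℵ_ 2) := ZFSet.mem_inter.2 ⟨hp, (Cond.isSideCondition p).mem_H⟩
  obtain ⟨q, hq, hNq⟩ := exists_le_mem hN p ((Cond.isSideCondition p).subset_of_mem hN hpN)
  exact ⟨q, hq, fun D hDM hD =>
    (isStronglyGeneric_of_mem q hNq).generic _ (isDenseIn_inter hM hDM hD)⟩

end Properness

/-! ## Preservation of `ω₂` -/

section Surjection

variable {ℙ : Type v} [Preorder ℙ] [OrderTop ℙ] {f : PName.{u} ℙ} {A B y y' z : ZFSet.{u}} {p q : ℙ}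

theorem fIsSurjection.exists_value (h : fIsSurjection f (check B) (check A) p) (hq : q ≤ p)
    (hz : z ∈ B) : ∃ t ≤ q, ∃ y ∈ A, fPairMem (check z) (check y) f t := by
  obtain ⟨q₁, hq₁, h₁⟩ := fAllIn_iff.1 h.2.1 _ q hq (forcesMem_check hz (.refl _ q))
  obtain ⟨x, q₂, hq₂, hx, h₂⟩ := fExIn_iff.1 h₁ q₁ le_rfl
  obtain ⟨q₃, hq₃, y, hy, e⟩ := hx.exists_check
  exact ⟨q₃, hq₃.trans (hq₂.trans hq₁), y, hy, (h₂.mono hq₃).congr (.refl _ _) e⟩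

theorem fIsSurjection.exists_preimage (h : fIsSurjection f (check B) (check A) p) (hq : q ≤ p)
    (hy : y ∈ A) : ∃ t ≤ q, ∃ z ∈ B, fPairMem (check z) (check y) f t := by
  obtain ⟨q₁, hq₁, h₁⟩ := fAllIn_iff.1 h.2.2.2 _ q hq (forcesMem_check hy (.refl _ q))
  obtain ⟨x, q₂, hq₂, hx, h₂⟩ := fExIn_iff.1 h₁ q₁ le_rfl
  obtain ⟨q₃, hq₃, z, hz, e⟩ := hx.exists_check
  exact ⟨q₃, hq₃.trans (hq₂.trans hq₁), z, hz, (h₂.mono hq₃).congr e (.refl _ _)⟩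

theorem fIsSurjection.value_unique (h : fIsSurjection f (check B) (check A) p) (hq : q ≤ p)
    (hy : fPairMem (check z) (check y) f q) (hy' : fPairMem (check z) (check y') f q) : y = y' := by
  obtain ⟨t, _, e⟩ := fImp_iff.1 (h.2.2.1 (check z) (check y) (check y')) q hq ⟨hy, hy'⟩
  exact eq_of_forcesEq_check e

end Surjection

section PreservesOmegaTwo

variable {r : H.{u} (ℵ_ 2) → H.{u} (ℵ_ 2) → Prop}

theorem not_subset_of_mem_E1 {U : ZFSet.{u}} (hU : U ∈ E1 r) :
    ∃ y ∈ (ω_ 2 : Ordinal.{u}).toZFSet, y ∉ U := by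
  by_contra! h
  have := ZFSet.card_mono (show (ω_ 2 : Ordinal.{u}).toZFSet ⊆ U from fun y hy => h y hy)
  rw [Ordinal.card_toZFSet, card_omega, hU.2.1] at this
  exact this.not_gt aleph_one_lt_aleph_two

/-- Pure side conditions add no surjection from a smaller ordinal onto `ω₂`. -/
theorem not_fIsSurjection [IsWellOrder _ r] {B : ZFSet.{u}} (hB : B ∈ (ω_ 2 : Ordinal.{u}).toZFSet)
    (f : PName.{u} (sidePoset r).Cond) (t : (sidePoset r).Cond) :
    ¬ fIsSurjection f (check B) (check (ω_ 2).toZFSet) t := by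
  intro hf
  have hH : ∀ y ∈ (ω_ 2 : Ordinal.{u}).toZFSet, y ∈ H (ℵ_ 2) := by
    intro y hy
    obtain ⟨a, ha, rfl⟩ := Ordinal.mem_toZFSet_iff.1 hy
    exact toZFSet_mem_H ha
  -- These are total functions on `H(ℵ₂)`: they choose an extension deciding the value at `z` and
  -- the value itself, with irrelevant output when the input is not of the intended kind.
  have key : ∀ q z : H.{u} (ℵ_ 2), ∃ q' y : H.{u} (ℵ_ 2), ∀ c : (sidePoset r).Cond, c.val = q → c ≤ t →
      (z : ZFSet.{u}) ∈ B → ∃ c' : (sidePoset r).Cond, c'.val = q' ∧ c' ≤ c ∧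
        fPairMem (check z) (check y) f c' := by
    intro q z
    by_cases h : ∃ c : (sidePoset r).Cond, c.val = q ∧ c ≤ t ∧ (z : ZFSet.{u}) ∈ B
    · obtain ⟨c, hc, hct, hz⟩ := h
      obtain ⟨c', hc', y, hy, h'⟩ := hf.exists_value hct hz
      exact ⟨⟨c'.val, (Cond.isSideCondition c').mem_H⟩, ⟨y, hH y hy⟩, fun d hd _ _ =>
        ⟨c', rfl, cond_le_iff.2 (by rw [hd, ← hc]; exact cond_le_iff.1 hc'), h'⟩⟩
    · exact ⟨q, z, fun c hc hct hz => absurd ⟨c, hc, hct, hz⟩ h⟩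
  choose G₁ G₂ hG using key
  let t' : H.{u} (ℵ_ 2) := ⟨t.val, (Cond.isSideCondition t).mem_H⟩
  let B' : H.{u} (ℵ_ 2) := ⟨B, hH B hB⟩
  -- A single function on lists encodes both choices by length; the third entry is a dummy, and `t'`
  -- is the value at other lengths.
  obtain ⟨U, hU₁, hA, hF⟩ := exists_mem_E1 r (A := {t', B'}) (Set.toFinite _).countable fun l =>
    match l with
    | [q, z] => G₁ q z
    | [q, z, _] => G₂ q z
    | _ => t'
  have hU : U ∈ E2 r := Or.inr hU₁
  have htU : t.val ∈ U := hA t' (by simp)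
  have hBU : B ⊆ U := subset_of_mem_E1 hU₁ (hA B' (by simp))
  have htU' := (Cond.isSideCondition t).subset_of_mem hU htU
  obtain ⟨s, hst, hUs⟩ := exists_le_mem hU t htU'
  -- `U` has size `ℵ₁`, so it omits some `y < ω₂`; the extension `s'` is then chosen to name a
  -- preimage `z` of `y`.
  obtain ⟨y, hy, hyU⟩ := not_subset_of_mem_E1 hU₁
  obtain ⟨s', hs', z, hz, hsy⟩ := hf.exists_preimage hst hy
  have hs'' := Cond.isSideCondition s'
  let q := (hs''.restrict hU).toCond
  have hqt : q ≤ t := fun x hx =>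
    ZFSet.mem_inter.2 ⟨cond_le_iff.1 (hs'.trans hst) hx, htU' hx⟩
  have hqU : q.val ∈ U := hs''.restrict_mem hU
  let q' : H.{u} (ℵ_ 2) := ⟨q.val, (Cond.isSideCondition q).mem_H⟩
  let z' : H.{u} (ℵ_ 2) := ⟨z, mem_H_of_mem B'.2 hz⟩
  have hmem : ∀ a ∈ [q', z', z'], (a : ZFSet.{u}) ∈ U := by
    simpa [q', z'] using ⟨hqU, hBU hz⟩
  have h₁ : (G₁ q' z' : ZFSet.{u}) ∈ U := hF [q', z'] fun a ha => hmem a (by simp at ha ⊢; tauto)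
  have h₂ : (G₂ q' z' : ZFSet.{u}) ∈ U := hF [q', z', z'] hmem
  obtain ⟨c, hc, hcq, hcy⟩ := hG q' z' q rfl hqt hz
  have hcU : c.val ⊆ U := (Cond.isSideCondition c).subset_of_mem hU (hc ▸ h₁)
  -- `c` lies in `U` and extends `s' ∩ U`, so it is compatible with `s'`. A common extension forces
  -- both `y` and a value from `U` to be the image of `z`.
  obtain ⟨w, hw, hsw, hcw⟩ := hs''.exists_common_extension (Cond.isSideCondition c)
    (cond_le_iff.1 hs' hUs) hcU (cond_le_iff.1 hcq)
  have hws : hw.toCond ≤ s' := hsw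
  have hwc : hw.toCond ≤ c := hcw
  refine hyU ?_
  rw [hf.value_unique (hws.trans (hs'.trans hst)) (hsy.mono hws) (hcy.mono hwc)]
  exact h₂

theorem preservesOmega_two_sidePoset [IsWellOrder _ r] : (sidePoset r).PreservesOmega 2 := by
  intro p
  refine fIsCardinal_check (ZFSet.isOrdinal_toZFSet _).isTransitive (fun B hB => ?_)
    fun B hB f q _ => not_fIsSurjection hB f q
  obtain ⟨a, _, rfl⟩ := Ordinal.mem_toZFSet_iff.1 hB
  exact (ZFSet.isOrdinal_toZFSet a).isTransitive

end PreservesOmegaTwo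

end SideConditions

theorem mainTheorem1
    (r : SideConditions.H.{u} (ℵ_ 2) → SideConditions.H.{u} (ℵ_ 2) → Prop)
    (hr : IsWellOrder (SideConditions.H.{u} (ℵ_ 2)) r) :
    (SideConditions.sidePoset r).IsStronglyProper (SideConditions.E2 r) ∧
      (SideConditions.sidePoset r).IsProper ∧
      (SideConditions.sidePoset r).PreservesOmega 2 :=
  ⟨SideConditions.isStronglyProper_sidePoset, SideConditions.isProper_sidePoset,
    SideConditions.preservesOmega_two_sidePoset⟩
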